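/- Let $(\mathsf M,\otimes,I)$ be a pointed closed symmetric monoidal model category (model structure satisfying the pushout-product axiom, with cofibrant unit). Let $H$ be a Hopf algebra in $\mathsf M$ (a bialgebra with multiplication $\mu$, comultiplication $\Delta$, unit $\eta$, counit $\varepsilon$, and an antipode $\chi\colon H\to H$, i.e. $\mu(\chi\otimes H)\Delta=\eta\varepsilon=\mu(H\otimes\chi)\Delta$) whose underlying object is cofibrant in $\mathsf M$. Suppose that $H$ is dualizable in $\operatorname{Ho}\mathsf M$: for $DH=\mathbb R\mathrm{Hom}(H,I)$, the canonical map $DH\otimes^{\mathbb L}H\to\mathbb R\mathrm{Hom}(H,H)$ is an isomorphism. Suppose that the categories ${}_H\mathsf{Mod}$, $\mathsf{Mod}_H$ and ${}_H\mathsf{Mod}_H$ of left $H$-modules, right $H$-modules and $H$-bimodules carry model structures in which a map is a weak equivalence if and only if it is one in $\mathsf M$, such that the forgetful functors ${}_H\mathsf{Mod}_H\to{}_H\mathsf{Mod}\to\mathsf M$ and ${}_H\mathsf{Mod}_H\to\mathsf{Mod}_H\to\mathsf M$ are left and right Quillen functors, the trivial right action functors $\mathrm{triv}\colon\mathsf M\to\mathsf{Mod}_H$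 and $\mathrm{triv}\colon{}_H\mathsf{Mod}\to{}_H\mathsf{Mod}_H$ are left Quillen functors, and the trivial left action functors $\mathrm{triv}\colon\mathsf M\to{}_H\mathsf{Mod}$ and $\mathrm{triv}\colon\mathsf{Mod}_H\to{}_H\mathsf{Mod}_H$ are right Quillen functors. (Homotopy) fixed points $(-)^{hH}$ are the derived right adjoints of trivial right action functors, and (homotopy) orbits $(-)_{hH}$ are the derived left adjoints of trivial left action functors. Let $\kappa\colon((-)^{hH})_{hH}\Rightarrow((-)_{hH})^{hH}$, a transformation of functors $\operatorname{Ho}({}_H\mathsf{Mod}_H)\to\operatorname{Ho}\mathsf M$, be the mate of the canonical isomorphism $(-)_{hH}\circ\mathrm{triv}\cong\mathrm{triv}\circ(-)_{hH}$. Let $M$ be a right $H$-module with cofibrant underlying object, considered also as a left $H$-module through the antipode, $hm=m\chi(h)$. For a left $H$-module or an $H$-bimodule $N$, let $M\otimes^{\mathbb L}N$ carry the diagonal left action and, if $N$ is a bimodule, the right action of $H$ on $N$. The norm map of $M$ is the composite $$(M\otimes^{\mathbb L}H^{hH})_{hH}\longrightarrow\big((M\otimes^{\mathbb L}H)^{hH}\big)_{hH}\xrightarrow{\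 \kappa\ }\big((M\otimes^{\mathbb L}H)_{hH}\big)^{hH}\longrightarrow M^{hH},$$ where the first map is induced by the canonical map $M\otimes^{\mathbb L}H^{hH}\to(M\otimes^{\mathbb L}H)^{hH}$ of left $H$-modules and the last one by the bimodule map $M\otimes H\to\mathrm{triv}\,M$, $m\otimes h\mapsto mh$. Let $X$ be an object of $\operatorname{Ho}\mathsf M$. If $M$ is induced up from $X$, i.e. if $M$ is isomorphic to the free left module $H\otimes^{\mathbb L}X$ in $\operatorname{Ho}({}_H\mathsf{Mod})$, or to the free right module $X\otimes^{\mathbb L}H$ in $\operatorname{Ho}(\mathsf{Mod}_H)$, then the norm map of $M$, $$(M\otimes^{\mathbb L}H^{hH})_{hH}\longrightarrow M^{hH},$$ is an isomorphism in $\operatorname{Ho}\mathsf M$. -/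

import Mathlib

open CategoryTheory MonoidalCategory HomotopicalAlgebra Limits

universe v v₁ v₂ v₃ v₄ u u₁ u₂ u₃ u₄

namespace HopfNorm

noncomputable section

section Homotopical

/-- The homotopy category: the localization at the weak equivalences. -/
abbrev Ho (C : Type u) [Category.{v} C] [CategoryWithWeakEquivalences C] :
    Type u :=
  (weakEquivalences C).Localization

/-- The localization functor to the homotopy category. -/
abbrev hoQ (C : Type u) [Category.{v} C] [CategoryWithWeakEquivalences C] : C ⥤ Ho C :=
  (weakEquivalences C).Q

variable {C : Type u₁} [Category.{v₁} C] {D : Type u₂} [Category.{v₂} D]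

/-- The functor is a left Quillen functor, i.e. the left adjoint of a Quillen pair. -/
structure IsLeftQuillen [ModelCategory C] [ModelCategory D] (F : C ⥤ D) : Prop where
  isLeftAdjoint : F.IsLeftAdjoint
  cofibration {X Y : C} (f : X ⟶ Y) [Cofibration f] : Cofibration (F.map f)
  weakEquivalence {X Y : C} (f : X ⟶ Y) [Cofibration f] [WeakEquivalence f] :
    WeakEquivalence (F.map f)

/-- The functor is a right Quillen functor, i.e. the right adjoint of a Quillen pair. -/
structure IsRightQuillen [ModelCategory C] [ModelCategory D] (G : C ⥤ D) : Prop where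
  isRightAdjoint : G.IsRightAdjoint
  fibration {X Y : C} (f : X ⟶ Y) [Fibration f] : Fibration (G.map f)
  weakEquivalence {X Y : C} (f : X ⟶ Y) [Fibration f] [WeakEquivalence f] :
    WeakEquivalence (G.map f)

/-- The functor preserves all weak equivalences. -/
class PreservesWE [CategoryWithWeakEquivalences C] [CategoryWithWeakEquivalences D]
    (F : C ⥤ D) : Prop where
  map_we {X Y : C} (f : X ⟶ Y) (hf : WeakEquivalence f) : WeakEquivalence (F.map f)

/-- The functor sends weak equivalences between cofibrant objects to weak equivalences. -/
class LeftDerivable [ModelCategory C] [CategoryWithWeakEquivalences D] (F : C ⥤ D) : Prop where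
  map_we {X Y : C} (f : X ⟶ Y) (hX : IsCofibrant X) (hY : IsCofibrant Y)
    (hf : WeakEquivalence f) : WeakEquivalence (F.map f)

/-- The functor sends weak equivalences between fibrant objects to weak equivalences. -/
class RightDerivable [ModelCategory C] [CategoryWithWeakEquivalences D] (F : C ⥤ D) : Prop where
  map_we {X Y : C} (f : X ⟶ Y) (hX : IsFibrant X) (hY : IsFibrant Y)
    (hf : WeakEquivalence f) : WeakEquivalence (F.map f)

/-- The functor preserves cofibrant objects. -/
class PreservesCofibrant [ModelCategory C] [ModelCategory D] (F : C ⥤ D) : Prop where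
  isCofibrant (X : C) (hX : IsCofibrant X) : IsCofibrant (F.obj X)

/-- Ken Brown's lemma. -/
lemma leftDerivable_of_trivialCofibration [ModelCategory C] [ModelCategory D] (F : C ⥤ D)
    (h : ∀ {X Y : C} (f : X ⟶ Y), IsCofibrant X → IsCofibrant Y → Cofibration f →
      WeakEquivalence f → WeakEquivalence (F.map f)) : LeftDerivable F where
  map_we {X Y} f hX hY hf := by
    let b := (inferInstance : Nonempty (CofibrantBrownFactorization f)).some
    have hi : Cofibration b.i := by rw [cofibration_iff]; exact b.hi
    have hZ : IsCofibrant b.Z := isCofibrant_of_cofibration b.i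
    have h1 := h b.i hX hZ inferInstance inferInstance
    have h2 := h b.s hY hZ inferInstance inferInstance
    have h3 : WeakEquivalence (F.map b.p) := by
      refine weakEquivalence_of_precomp_of_fac (f := F.map b.s) (fg := 𝟙 _) ?_
      rw [← F.map_comp, b.s_p, F.map_id]
    rw [← b.fac, F.map_comp]
    infer_instance

/-- Ken Brown's lemma, dual form. -/
lemma rightDerivable_of_trivialFibration [ModelCategory C] [ModelCategory D] (F : C ⥤ D)
    (h : ∀ {X Y : C} (f : X ⟶ Y), IsFibrant X → IsFibrant Y → Fibration f →
      WeakEquivalence f → WeakEquivalence (F.map f)) : RightDerivable F where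
  map_we {X Y} f hX hY hf := by
    let b := (inferInstance : Nonempty (FibrantBrownFactorization f)).some
    have hi : Fibration b.p := by rw [fibration_iff]; exact b.hp
    have hZ : IsFibrant b.Z := isFibrant_of_fibration b.p
    have h1 := h b.p hZ hY inferInstance inferInstance
    have h2 := h b.r hZ hX inferInstance inferInstance
    have h3 : WeakEquivalence (F.map b.i) := by
      refine weakEquivalence_of_postcomp_of_fac (g := F.map b.r) (fg := 𝟙 _) ?_
      rw [← F.map_comp, b.i_r, F.map_id]
    rw [← b.fac, F.map_comp]
    infer_instance

lemma IsLeftQuillen.leftDerivable [ModelCategory C] [ModelCategory D] {F : C ⥤ D}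
    (hF : IsLeftQuillen F) : LeftDerivable F :=
  leftDerivable_of_trivialCofibration F (fun f _ _ _ _ => hF.weakEquivalence f)

lemma IsRightQuillen.rightDerivable [ModelCategory C] [ModelCategory D] {F : C ⥤ D}
    (hF : IsRightQuillen F) : RightDerivable F :=
  rightDerivable_of_trivialFibration F (fun f _ _ _ _ => hF.weakEquivalence f)

lemma IsLeftQuillen.preservesCofibrant [ModelCategory C] [ModelCategory D] {F : C ⥤ D}
    (hF : IsLeftQuillen F) : PreservesCofibrant F where
  isCofibrant X hX := by
    have := hF.isLeftAdjoint
    have h := hF.cofibration (initial.to X)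
    have hi : IsInitial (F.obj (⊥_ C)) := IsInitial.isInitialObj F _ initialIsInitial
    rw [isCofibrant_iff_of_isInitial (F.map (initial.to X)) hi]
    exact h

lemma isLeftQuillen_of_adj [ModelCategory C] [ModelCategory D] {F : C ⥤ D} {G : D ⥤ C}
    (adj : F ⊣ G) (hG : IsRightQuillen G) : IsLeftQuillen F where
  isLeftAdjoint := adj.isLeftAdjoint
  cofibration {X Y} f hf := by
    rw [cofibration_iff, ← trivialFibrations_llp]
    intro A B p hp
    rw [mem_trivialFibrations_iff] at hp
    have := hp.1
    have := hp.2
    have := hG.fibration p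
    have := hG.weakEquivalence p
    rw [adj.hasLiftingProperty_iff]
    infer_instance
  weakEquivalence {X Y} f hf hf' := by
    have : trivialCofibrations D (F.map f) := by
      rw [← fibrations_llp]
      intro A B p hp
      rw [← fibration_iff] at hp
      have := hG.fibration p
      rw [adj.hasLiftingProperty_iff]
      infer_instance
    rw [mem_trivialCofibrations_iff] at this
    exact this.2

lemma isRightQuillen_of_adj [ModelCategory C] [ModelCategory D] {F : C ⥤ D} {G : D ⥤ C}
    (adj : F ⊣ G) (hF : IsLeftQuillen F) : IsRightQuillen G where
  isRightAdjoint := adj.isRightAdjoint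
  fibration {X Y} f hf := by
    rw [fibration_iff, ← trivialCofibrations_rlp]
    intro A B p hp
    rw [mem_trivialCofibrations_iff] at hp
    have := hp.1
    have := hp.2
    have := hF.cofibration p
    have := hF.weakEquivalence p
    rw [← adj.hasLiftingProperty_iff]
    infer_instance
  weakEquivalence {X Y} f hf hf' := by
    have : trivialFibrations C (G.map f) := by
      rw [← cofibrations_rlp]
      intro A B p hp
      rw [← cofibration_iff] at hp
      have := hF.cofibration p
      rw [← adj.hasLiftingProperty_iff]
      infer_instance
    rw [mem_trivialFibrations_iff] at this
    exact this.2

section LeftDerived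

variable [ModelCategory C] {H : Type u₃} [Category.{v₃} H] (F : C ⥤ H)

/-- The functor inverts weak equivalences between cofibrant objects. -/
def InvertsCofibrant : Prop :=
  (weakEquivalences (CofibrantObject C)).IsInvertedBy (CofibrantObject.ι ⋙ F)

variable {F}

/-- A natural transformation that is invertible on cofibrant objects exhibits a left derived
functor. -/
lemma isLeftDerivedFunctor_of_isIso (LF : Ho C ⥤ H) (α : hoQ C ⋙ LF ⟶ F)
    (hα : ∀ X : C, IsCofibrant X → IsIso (α.app X)) :
    LF.IsLeftDerivedFunctor α (weakEquivalences C) := by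
  let L := CofibrantObject.ι ⋙ hoQ C
  let W := weakEquivalences (CofibrantObject C)
  let αc : L ⋙ LF ⟶ CofibrantObject.ι ⋙ F := Functor.whiskerLeft CofibrantObject.ι α
  have : IsIso αc := by
    rw [NatTrans.isIso_iff_isIso_app]
    intro X
    exact hα X.1 X.2
  have hsurj : ∀ (G : Ho C ⥤ H) (β : hoQ C ⋙ G ⟶ F),
      ∃! γ : G ⟶ LF, Functor.whiskerLeft (hoQ C) γ ≫ α = β := by
    intro G β
    let τ : L ⋙ G ⟶ L ⋙ LF := Functor.whiskerLeft CofibrantObject.ι β ≫ inv αc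
    let γ : G ⟶ LF := Localization.liftNatTrans L W (L ⋙ G) (L ⋙ LF) G LF τ
    have hγ : ∀ X : CofibrantObject C,
        γ.app ((hoQ C).obj X.obj) ≫ α.app X.obj = β.app X.obj := by
      intro X
      have h1 : γ.app (L.obj X) = τ.app X := by
        simp [γ, Localization.Lifting.iso]
      have h2 : τ.app X ≫ αc.app X = β.app X.obj := by
        rw [← NatTrans.comp_app]
        simp [τ]
      rw [← h2, ← h1]
      rfl
    refine ⟨γ, ?_, ?_⟩
    · ext X
      have hw : IsIso ((hoQ C).map (CofibrantObject.HoCat.pResolutionObj X)) :=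
        Localization.inverts (hoQ C) (weakEquivalences C) _ (mem_weakEquivalences _)
      rw [← cancel_epi (G.map ((hoQ C).map (CofibrantObject.HoCat.pResolutionObj X)))]
      have h := hγ (.mk (CofibrantObject.HoCat.resolutionObj X))
      have n1 := α.naturality (CofibrantObject.HoCat.pResolutionObj X)
      have n2 := β.naturality (CofibrantObject.HoCat.pResolutionObj X)
      have n3 := γ.naturality ((hoQ C).map (CofibrantObject.HoCat.pResolutionObj X))
      simp only [Functor.comp_obj, Functor.comp_map] at n1 n2
      simp only [NatTrans.comp_app, Functor.whiskerLeft_app]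
      rw [reassoc_of% n3, n1, n2, ← h, Category.assoc]
    · intro γ' hγ'
      refine Localization.natTrans_ext L W (fun X => ?_)
      have := hα X.obj X.2
      have e : ∀ (δ : G ⟶ LF), δ.app (L.obj X) = δ.app ((hoQ C).obj X.obj) := fun _ => rfl
      rw [e, e, ← cancel_mono (α.app X.obj), hγ X, ← hγ']
      rfl
  refine ⟨⟨⟨IsTerminal.ofUniqueHom
    (fun E => CostructuredArrow.homMk (hsurj E.left E.hom).choose
      (hsurj E.left E.hom).choose_spec.1) ?_⟩⟩⟩
  intro E m
  ext1
  exact (hsurj E.left E.hom).choose_spec.2 _ (CostructuredArrow.w m)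

variable (F)

/-- Cofibrant replacement provides left derived functors. -/
lemma exists_leftDerived (hF : InvertsCofibrant F) :
    ∃ (LF : Ho C ⥤ H) (α : hoQ C ⋙ LF ⟶ F), ∀ X : C, IsCofibrant X → IsIso (α.app X) := by
  let L := CofibrantObject.ι ⋙ hoQ C
  let W := weakEquivalences (CofibrantObject C)
  let LF : Ho C ⥤ H := Localization.lift (CofibrantObject.ι ⋙ F) hF L
  let e : L ⋙ LF ≅ CofibrantObject.ι ⋙ F := Localization.fac _ hF L
  have hw : ∀ {X Y : C} (f : X ⟶ Y) [WeakEquivalence f], IsIso ((hoQ C).map f) := fun f _ =>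
    Localization.inverts (hoQ C) (weakEquivalences C) _ (mem_weakEquivalences _)
  let p := fun X : C => CofibrantObject.HoCat.pResolutionObj X
  let r := fun X : C => CofibrantObject.mk (CofibrantObject.HoCat.resolutionObj X)
  have hp : ∀ X, IsIso ((hoQ C).map (p X)) := fun X => hw _
  let α : hoQ C ⋙ LF ⟶ F :=
    { app X := inv (LF.map ((hoQ C).map (p X))) ≫ e.hom.app (r X) ≫ F.map (p X)
      naturality {X Y} f := by
        have n := e.hom.naturality (X := r X) (Y := r Y)
          (CofibrantObject.homMk (CofibrantObject.HoCat.resolutionMap f))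
        have fac : CofibrantObject.HoCat.resolutionMap f ≫ p Y = p X ≫ f :=
          CofibrantObject.HoCat.resolutionMap_fac f
        have n' : LF.map ((hoQ C).map (CofibrantObject.HoCat.resolutionMap f)) ≫
            e.hom.app (r Y) = e.hom.app (r X) ≫
              F.map (CofibrantObject.HoCat.resolutionMap f) := n
        rw [← cancel_epi (LF.map ((hoQ C).map (p X)))]
        simp only [Functor.comp_map, Category.assoc, IsIso.hom_inv_id_assoc, ← F.map_comp]
        rw [← fac, F.map_comp, ← reassoc_of% n', ← Functor.map_comp_assoc LF,
          ← (hoQ C).map_comp, ← fac, (hoQ C).map_comp, LF.map_comp, Category.assoc,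
          IsIso.hom_inv_id_assoc] }
  have hα : ∀ X : C, IsCofibrant X → IsIso (α.app X) := by
    intro X hX
    have h1 : IsIso (F.map (p X)) := by
      refine hF (X := r X) (Y := CofibrantObject.mk X)
        (CofibrantObject.homMk (p X)) ?_
      rw [← weakEquivalence_iff, CofibrantObject.weakEquivalence_homMk_iff]
      infer_instance
    dsimp [α]
    infer_instance
  exact ⟨LF, α, hα⟩

lemma hasLeftDerivedFunctor_of_inverts (hF : InvertsCofibrant F) :
    F.HasLeftDerivedFunctor (weakEquivalences C) := by
  obtain ⟨LF, α, hα⟩ := exists_leftDerived F hF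
  have := isLeftDerivedFunctor_of_isIso LF α hα
  exact Functor.HasLeftDerivedFunctor.mk' LF α

variable {F}

lemma isIso_app_of_isLeftDerivedFunctor (hF : InvertsCofibrant F) (LF : Ho C ⥤ H)
    (α : hoQ C ⋙ LF ⟶ F) [LF.IsLeftDerivedFunctor α (weakEquivalences C)] (X : C)
    (hX : IsCofibrant X) : IsIso (α.app X) := by
  obtain ⟨LF', α', hα'⟩ := exists_leftDerived F hF
  have := isLeftDerivedFunctor_of_isIso LF' α' hα'
  have h := hα' X hX
  have e := Functor.leftDerived_fac_app LF' α' (weakEquivalences C) LF α X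
  rw [← e]
  have : IsIso (LF'.leftDerivedLift α' (weakEquivalences C) LF α) :=
    (LF'.isLeftDerivedFunctor_iff_isIso_leftDerivedLift α' (weakEquivalences C) LF α).1
      inferInstance
  infer_instance

end LeftDerived

lemma invertsCofibrant_of_leftDerivable [ModelCategory C] [CategoryWithWeakEquivalences D]
    (F : C ⥤ D) [h : LeftDerivable F] : InvertsCofibrant (F ⋙ hoQ D) := by
  intro X Y f hf
  have h1 : WeakEquivalence f.hom := (weakEquivalence_iff _).2 hf
  have h2 := h.map_we f.hom X.2 Y.2 h1
  exact Localization.inverts (hoQ D) (weakEquivalences D) _ (mem_weakEquivalences (F.map f.hom))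

lemma derives_of_rightDerivable [ModelCategory C] [CategoryWithWeakEquivalences D]
    (F : C ⥤ D) [h : RightDerivable F] :
    (FibrantObject.localizerMorphism C).Derives (F ⋙ hoQ D) := by
  intro X Y f hf
  have h1 : WeakEquivalence f.hom := (weakEquivalence_iff _).2 hf
  have h2 := h.map_we f.hom X.2 Y.2 h1
  exact Localization.inverts (hoQ D) (weakEquivalences D) _ (mem_weakEquivalences (F.map f.hom))

lemma isInvertedBy_of_preservesWE [CategoryWithWeakEquivalences C]
    [CategoryWithWeakEquivalences D] (F : C ⥤ D) [h : PreservesWE F] :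
    (weakEquivalences C).IsInvertedBy (F ⋙ hoQ D) := by
  intro X Y f hf
  have h2 := h.map_we f ((weakEquivalence_iff _).2 hf)
  exact Localization.inverts (hoQ D) (weakEquivalences D) _ (mem_weakEquivalences (F.map f))

/-- The functor induced on homotopy categories by a functor that preserves weak equivalences. -/
def hoMap [CategoryWithWeakEquivalences C] [CategoryWithWeakEquivalences D] (F : C ⥤ D)
    [PreservesWE F] : Ho C ⥤ Ho D :=
  Localization.lift (F ⋙ hoQ D) (isInvertedBy_of_preservesWE F) (hoQ C)

/-- `hoMap F` is computed by `F`. -/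
def hoMapFac [CategoryWithWeakEquivalences C] [CategoryWithWeakEquivalences D] (F : C ⥤ D)
    [PreservesWE F] : hoQ C ⋙ hoMap F ≅ F ⋙ hoQ D :=
  Localization.fac (F ⋙ hoQ D) (isInvertedBy_of_preservesWE F) (hoQ C)

/-- The total left derived functor, computed on cofibrant replacements. -/
def leftDerived [ModelCategory C] [CategoryWithWeakEquivalences D] (F : C ⥤ D)
    [LeftDerivable F] : Ho C ⥤ Ho D :=
  have := hasLeftDerivedFunctor_of_inverts _ (invertsCofibrant_of_leftDerivable F)
  (F ⋙ hoQ D).totalLeftDerived (hoQ C) (weakEquivalences C)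

/-- The canonical map from the left derived functor to the functor. -/
def leftDerivedCounit [ModelCategory C] [CategoryWithWeakEquivalences D] (F : C ⥤ D)
    [LeftDerivable F] : hoQ C ⋙ leftDerived F ⟶ F ⋙ hoQ D :=
  have := hasLeftDerivedFunctor_of_inverts _ (invertsCofibrant_of_leftDerivable F)
  (F ⋙ hoQ D).totalLeftDerivedCounit (hoQ C) (weakEquivalences C)

instance [ModelCategory C] [CategoryWithWeakEquivalences D] (F : C ⥤ D) [LeftDerivable F] :
    (leftDerived F).IsLeftDerivedFunctor (leftDerivedCounit F) (weakEquivalences C) :=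
  have := hasLeftDerivedFunctor_of_inverts _ (invertsCofibrant_of_leftDerivable F)
  inferInstanceAs (((F ⋙ hoQ D).totalLeftDerived (hoQ C)
    (weakEquivalences C)).IsLeftDerivedFunctor
      ((F ⋙ hoQ D).totalLeftDerivedCounit (hoQ C) (weakEquivalences C)) (weakEquivalences C))

/-- The total right derived functor, computed on fibrant replacements. -/
def rightDerived [ModelCategory C] [CategoryWithWeakEquivalences D] (F : C ⥤ D)
    [RightDerivable F] : Ho C ⥤ Ho D :=
  have := (derives_of_rightDerivable F).hasPointwiseRightDerivedFunctor
  (F ⋙ hoQ D).totalRightDerived (hoQ C) (weakEquivalences C)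

/-- The canonical map from the functor to the right derived functor. -/
def rightDerivedUnit [ModelCategory C] [CategoryWithWeakEquivalences D] (F : C ⥤ D)
    [RightDerivable F] : F ⋙ hoQ D ⟶ hoQ C ⋙ rightDerived F :=
  have := (derives_of_rightDerivable F).hasPointwiseRightDerivedFunctor
  (F ⋙ hoQ D).totalRightDerivedUnit (hoQ C) (weakEquivalences C)

instance [ModelCategory C] [CategoryWithWeakEquivalences D] (F : C ⥤ D) [RightDerivable F] :
    (rightDerived F).IsRightDerivedFunctor (rightDerivedUnit F) (weakEquivalences C) :=
  have := (derives_of_rightDerivable F).hasPointwiseRightDerivedFunctor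
  inferInstanceAs (((F ⋙ hoQ D).totalRightDerived (hoQ C)
    (weakEquivalences C)).IsRightDerivedFunctor
      ((F ⋙ hoQ D).totalRightDerivedUnit (hoQ C) (weakEquivalences C)) (weakEquivalences C))

/-- If `F ⊣ G`, where `F` preserves weak equivalences and `G` is right derivable, then there is
an induced adjunction between the homotopy categories. -/
def derivedAdjunction [ModelCategory C] [ModelCategory D] {F : C ⥤ D} {G : D ⥤ C}
    (adj : F ⊣ G) [PreservesWE F] [RightDerivable G] : hoMap F ⊣ rightDerived G := by
  have h1 : (hoMap F).IsLeftDerivedFunctor (hoMapFac F).hom (weakEquivalences C) :=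
    Functor.isLeftDerivedFunctor_of_inverts _ _ _
  have h2 : (hoMap F ⋙ rightDerived G).IsLeftDerivedFunctor
      ((Functor.associator _ _ _).inv ≫ Functor.whiskerRight (hoMapFac F).hom (rightDerived G))
      (weakEquivalences C) :=
    Functor.isLeftDerivedFunctor_of_inverts _ _
      ((Functor.associator _ _ _).symm ≪≫
        Functor.isoWhiskerRight (hoMapFac F) (rightDerived G))
  have h3 : (rightDerived G ⋙ hoMap F).IsRightDerivedFunctor
      (Functor.whiskerRight (rightDerivedUnit G) (hoMap F) ≫ (Functor.associator _ _ _).hom)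
      (weakEquivalences D) := by
    have hd : (FibrantObject.localizerMorphism D).Derives ((G ⋙ hoQ C) ⋙ hoMap F) := by
      intro X Y f hf
      have := derives_of_rightDerivable G f hf
      dsimp at this ⊢
      infer_instance
    refine hd.isRightDerivedFunctor_of_isIso _ (fun X => ?_)
    have := (derives_of_rightDerivable G).isIso_of_isRightDerivedFunctor (rightDerivedUnit G) X
    dsimp at this ⊢
    infer_instance
  exact adj.derived (weakEquivalences C) (weakEquivalences D) (hoMapFac F).hom
    (rightDerivedUnit G)

/-- Two composites of functors that agree before passing to homotopy categories agree afterwards: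
if `E ⋙ F' ≅ F ⋙ E'`, where `E` and `E'` preserve weak equivalences and `E` preserves cofibrant
objects, then the total left derived functors of `F` and `F'` are compatible with `E` and `E'`. -/
def leftDerivedCommIso {C' : Type u₃} [Category.{v₃} C'] {D' : Type u₄} [Category.{v₄} D']
    [ModelCategory C] [CategoryWithWeakEquivalences D] [ModelCategory C']
    [CategoryWithWeakEquivalences D'] (F : C ⥤ D) (F' : C' ⥤ D') (E : C ⥤ C') (E' : D ⥤ D')
    [LeftDerivable F] [LeftDerivable F'] [PreservesWE E] [hE : PreservesCofibrant E]
    [PreservesWE E'] (e : E ⋙ F' ≅ F ⋙ E') :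
    hoMap E ⋙ leftDerived F' ≅ leftDerived F ⋙ hoMap E' := by
  let α : hoQ C ⋙ hoMap E ⋙ leftDerived F' ⟶ (E ⋙ F') ⋙ hoQ D' :=
    Functor.whiskerRight (hoMapFac E).hom (leftDerived F') ≫
      Functor.whiskerLeft E (leftDerivedCounit F')
  let β : hoQ C ⋙ leftDerived F ⋙ hoMap E' ⟶ (F ⋙ E') ⋙ hoQ D' :=
    Functor.whiskerRight (leftDerivedCounit F) (hoMap E') ≫
      Functor.whiskerLeft F (hoMapFac E').hom
  have hα : (hoMap E ⋙ leftDerived F').IsLeftDerivedFunctor α (weakEquivalences C) :=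
    isLeftDerivedFunctor_of_isIso _ _ (fun X hX => by
      have := isIso_app_of_isLeftDerivedFunctor (invertsCofibrant_of_leftDerivable F')
        (leftDerived F') (leftDerivedCounit F') (E.obj X) (hE.isCofibrant X hX)
      dsimp [α] at this ⊢
      infer_instance)
  have hβ : (leftDerived F ⋙ hoMap E').IsLeftDerivedFunctor β (weakEquivalences C) :=
    isLeftDerivedFunctor_of_isIso _ _ (fun X hX => by
      have := isIso_app_of_isLeftDerivedFunctor (invertsCofibrant_of_leftDerivable F)
        (leftDerived F) (leftDerivedCounit F) X hX
      dsimp [β] at this ⊢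
      infer_instance)
  exact Functor.leftDerivedNatIso _ _ α β (weakEquivalences C)
    (Functor.isoWhiskerRight e (hoQ D'))

end Homotopical

section Lemmas

open MonObj ComonObj HopfObj

variable {C : Type u} [Category.{v} C] [MonoidalCategory C]

lemma restrict_left_assoc {A A' M : C} [MonObj A] [MonObj A'] (f : A' ⟶ A) [IsMonHom f]
    (a : A ⊗ M ⟶ M) (ha : μ[A] ▷ M ≫ a = (α_ A A M).hom ≫ A ◁ a ≫ a) :
    μ[A'] ▷ M ≫ f ▷ M ≫ a = (α_ A' A' M).hom ≫ A' ◁ (f ▷ M ≫ a) ≫ f ▷ M ≫ a := by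
  rw [← comp_whiskerRight_assoc, IsMonHom.mul_hom, comp_whiskerRight_assoc, ha,
    MonoidalCategory.tensorHom_def']
  simp only [comp_whiskerRight, whisker_assoc, Category.assoc,
    MonoidalCategory.whiskerLeft_comp]
  rw [whisker_exchange_assoc, associator_naturality_left_assoc]
  simp

lemma restrict_right_assoc {B B' M : C} [MonObj B] [MonObj B'] (f : B' ⟶ B) [IsMonHom f]
    (a : M ⊗ B ⟶ M) (ha : M ◁ μ[B] ≫ a = (α_ M B B).inv ≫ a ▷ B ≫ a) :
    M ◁ μ[B'] ≫ M ◁ f ≫ a = (α_ M B' B').inv ≫ (M ◁ f ≫ a) ▷ B' ≫ M ◁ f ≫ a := by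
  rw [← MonoidalCategory.whiskerLeft_comp_assoc, IsMonHom.mul_hom,
    MonoidalCategory.whiskerLeft_comp_assoc, ha, MonoidalCategory.tensorHom_def]
  simp only [comp_whiskerRight, whisker_assoc, Category.assoc, Iso.inv_hom_id_assoc,
    MonoidalCategory.whiskerLeft_comp]
  rw [← whisker_exchange_assoc, associator_inv_naturality_right_assoc]

lemma restrict_left_middle {A A' B M : C} (f : A' ⟶ A) (a : A ⊗ M ⟶ M) (r : M ⊗ B ⟶ M)
    (h : a ▷ B ≫ r = (α_ A M B).hom ≫ A ◁ r ≫ a) :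
    (f ▷ M ≫ a) ▷ B ≫ r = (α_ A' M B).hom ≫ A' ◁ r ≫ f ▷ M ≫ a := by
  rw [comp_whiskerRight_assoc, h, associator_naturality_left_assoc, whisker_exchange_assoc]

lemma restrict_right_middle {A B B' M : C} (f : B' ⟶ B) (a : A ⊗ M ⟶ M) (r : M ⊗ B ⟶ M)
    (h : a ▷ B ≫ r = (α_ A M B).hom ≫ A ◁ r ≫ a) :
    a ▷ B' ≫ M ◁ f ≫ r = (α_ A M B').hom ≫ A ◁ (M ◁ f ≫ r) ≫ a := by
  rw [← whisker_exchange_assoc, h, MonoidalCategory.whiskerLeft_comp,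
    associator_naturality_right_assoc, Category.assoc]

lemma restrict_left_map {A A' M N : C} (f : A' ⟶ A) (a : A ⊗ M ⟶ M) (b : A ⊗ N ⟶ N) (g : M ⟶ N)
    (h : a ≫ g = A ◁ g ≫ b) : (f ▷ M ≫ a) ≫ g = A' ◁ g ≫ f ▷ N ≫ b := by
  rw [Category.assoc, h, whisker_exchange_assoc]

lemma restrict_right_map {B B' M N : C} (f : B' ⟶ B) (a : M ⊗ B ⟶ M) (b : N ⊗ B ⟶ N) (g : M ⟶ N)
    (h : a ≫ g = g ▷ B ≫ b) : (M ◁ f ≫ a) ≫ g = g ▷ B' ≫ N ◁ f ≫ b := by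
  rw [Category.assoc, h, ← whisker_exchange_assoc]

lemma unit_right_assoc (M : C) :
    M ◁ μ[𝟙_ C] ≫ (ρ_ M).hom = (α_ M (𝟙_ C) (𝟙_ C)).inv ≫ (ρ_ M).hom ▷ 𝟙_ C ≫ (ρ_ M).hom := by
  rw [show μ[𝟙_ C] = (λ_ (𝟙_ C)).hom from rfl]
  monoidal

lemma unit_right_middle {A M : C} (a : A ⊗ M ⟶ M) :
    a ▷ 𝟙_ C ≫ (ρ_ M).hom = (α_ A M (𝟙_ C)).hom ≫ A ◁ (ρ_ M).hom ≫ a := by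
  simp

lemma free_left_one (A X : C) [MonObj A] :
    η[A] ▷ (A ⊗ X) ≫ (α_ A A X).inv ≫ μ[A] ▷ X = (λ_ (A ⊗ X)).hom := by
  rw [associator_inv_naturality_left_assoc, ← comp_whiskerRight, MonObj.one_mul]
  monoidal

lemma free_left_assoc (A X : C) [MonObj A] :
    μ[A] ▷ (A ⊗ X) ≫ (α_ A A X).inv ≫ μ[A] ▷ X = (α_ A A (A ⊗ X)).hom ≫
      A ◁ ((α_ A A X).inv ≫ μ[A] ▷ X) ≫ (α_ A A X).inv ≫ μ[A] ▷ X := by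
  rw [associator_inv_naturality_left_assoc, ← comp_whiskerRight, MonObj.mul_assoc]
  simp

lemma free_right_one (A X : C) [MonObj A] :
    (X ⊗ A) ◁ η[A] ≫ (α_ X A A).hom ≫ X ◁ μ[A] = (ρ_ (X ⊗ A)).hom := by
  rw [associator_naturality_right_assoc, ← MonoidalCategory.whiskerLeft_comp, MonObj.mul_one]
  monoidal

lemma free_right_assoc (A X : C) [MonObj A] :
    (X ⊗ A) ◁ μ[A] ≫ (α_ X A A).hom ≫ X ◁ μ[A] = (α_ (X ⊗ A) A A).inv ≫
      ((α_ X A A).hom ≫ X ◁ μ[A]) ▷ A ≫ (α_ X A A).hom ≫ X ◁ μ[A] := by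
  rw [associator_naturality_right_assoc, ← MonoidalCategory.whiskerLeft_comp,
    MonObj.mul_assoc_flip]
  simp only [comp_whiskerRight, Category.assoc, whisker_assoc, Iso.inv_hom_id_assoc,
    MonoidalCategory.whiskerLeft_comp]
  monoidal

variable [SymmetricCategory C] {H : C}

section
variable [BimonObj H] {P N B : C} (a : H ⊗ P ⟶ P) (b : H ⊗ N ⟶ N)

lemma diag_one (ha : η[H] ▷ P ≫ a = (λ_ P).hom) (hb : η[H] ▷ N ≫ b = (λ_ N).hom) :
    η[H] ▷ (P ⊗ N) ≫ Δ[H] ▷ (P ⊗ N) ≫ tensorμ H H P N ≫ (a ⊗ₘ b) = (λ_ (P ⊗ N)).hom := by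
  rw [← comp_whiskerRight_assoc, BimonObj.one_comul, MonObj.tensorObj.one_def,
    comp_whiskerRight_assoc, tensorμ_natural_left_assoc, tensorHom_comp_tensorHom, ha, hb,
    ← tensor_left_unitality]

lemma diag_assoc (ha : μ[H] ▷ P ≫ a = (α_ H H P).hom ≫ H ◁ a ≫ a)
    (hb : μ[H] ▷ N ≫ b = (α_ H H N).hom ≫ H ◁ b ≫ b) :
    μ[H] ▷ (P ⊗ N) ≫ Δ[H] ▷ (P ⊗ N) ≫ tensorμ H H P N ≫ (a ⊗ₘ b) =
      (α_ H H (P ⊗ N)).hom ≫ H ◁ (Δ[H] ▷ (P ⊗ N) ≫ tensorμ H H P N ≫ (a ⊗ₘ b)) ≫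
        Δ[H] ▷ (P ⊗ N) ≫ tensorμ H H P N ≫ (a ⊗ₘ b) := by
  rw [← comp_whiskerRight_assoc, BimonObj.mul_comul, comp_whiskerRight_assoc,
    comp_whiskerRight_assoc, tensorμ_natural_left_assoc, tensorHom_comp_tensorHom, ha, hb,
    ← tensorHom_comp_tensorHom, tensor_associativity_assoc, ← tensorHom_comp_tensorHom,
    ← tensorμ_natural_right_assoc]
  simp only [MonoidalCategory.whiskerLeft_comp, Category.assoc]
  rw [whisker_exchange_assoc, whisker_exchange_assoc, MonoidalCategory.tensorHom_def',
    comp_whiskerRight_assoc, associator_naturality_left_assoc]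
  simp only [whisker_assoc, Category.assoc, Iso.inv_hom_id_assoc]

lemma diag_middle (r : N ⊗ B ⟶ N) (hb : b ▷ B ≫ r = (α_ H N B).hom ≫ H ◁ r ≫ b) :
    (Δ[H] ▷ (P ⊗ N) ≫ tensorμ H H P N ≫ (a ⊗ₘ b)) ▷ B ≫ (α_ P N B).hom ≫ P ◁ r =
      (α_ H (P ⊗ N) B).hom ≫ H ◁ ((α_ P N B).hom ≫ P ◁ r) ≫
        Δ[H] ▷ (P ⊗ N) ≫ tensorμ H H P N ≫ (a ⊗ₘ b) := by
  have key : tensorμ H H P N ▷ B ≫ (α_ (H ⊗ P) (H ⊗ N) B).hom ≫ (H ⊗ P) ◁ (α_ H N B).hom =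
      (α_ (H ⊗ H) (P ⊗ N) B).hom ≫ (H ⊗ H) ◁ (α_ P N B).hom ≫ tensorμ H H P (N ⊗ B) := by
    simp only [tensorμ]
    monoidal
  have h1 : (a ⊗ₘ b) ▷ B ≫ (α_ P N B).hom ≫ P ◁ r =
      (α_ (H ⊗ P) (H ⊗ N) B).hom ≫ (H ⊗ P) ◁ (α_ H N B).hom ≫ (H ⊗ P) ◁ H ◁ r ≫ (a ⊗ₘ b) := by
    rw [MonoidalCategory.tensorHom_def, comp_whiskerRight_assoc, whisker_assoc_assoc]
    simp only [Iso.inv_hom_id_assoc, ← MonoidalCategory.whiskerLeft_comp]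
    rw [hb, associator_naturality_left_assoc, ← whisker_exchange]
    simp only [MonoidalCategory.whiskerLeft_comp, Category.assoc]
    rw [← whisker_exchange]
  have h2 : (H ⊗ H) ◁ P ◁ r ≫ tensorμ H H P N = tensorμ H H P (N ⊗ B) ≫ (H ⊗ P) ◁ H ◁ r := by
    have := tensorμ_natural_right (Z₁ := H) (Z₂ := H) (𝟙 P) r
    simpa using this
  rw [comp_whiskerRight, comp_whiskerRight, Category.assoc, Category.assoc, h1, reassoc_of% key,
    ← reassoc_of% h2]
  simp only [← MonoidalCategory.whiskerLeft_comp_assoc]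
  rw [associator_naturality_left_assoc, whisker_exchange_assoc]
end

section
variable [HopfObj H] {M : C} (r : M ⊗ H ⟶ M)

lemma antipode_one (h1 : M ◁ η[H] ≫ r = (ρ_ M).hom) :
    η[H] ▷ M ≫ (β_ H M).hom ≫ M ◁ 𝒮[H] ≫ r = (λ_ M).hom := by
  rw [BraidedCategory.braiding_naturality_left_assoc, ← MonoidalCategory.whiskerLeft_comp_assoc,
    HopfObj.one_antipode, h1]
  simp

lemma antipode_assoc (h2 : M ◁ μ[H] ≫ r = (α_ M H H).inv ≫ r ▷ H ≫ r) :
    μ[H] ▷ M ≫ (β_ H M).hom ≫ M ◁ 𝒮[H] ≫ r =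
      (α_ H H M).hom ≫ H ◁ ((β_ H M).hom ≫ M ◁ 𝒮[H] ≫ r) ≫ (β_ H M).hom ≫ M ◁ 𝒮[H] ≫ r := by
  rw [BraidedCategory.braiding_naturality_left_assoc, ← MonoidalCategory.whiskerLeft_comp_assoc,
    HopfObj.mul_antipode]
  simp only [MonoidalCategory.whiskerLeft_comp, Category.assoc]
  rw [h2]
  have c : (β_ (H ⊗ H) M).hom ≫ M ◁ (β_ H H).hom ≫ (α_ M H H).inv =
      (α_ H H M).hom ≫ H ◁ (β_ H M).hom ≫ (β_ H (M ⊗ H)).hom := by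
    rw [BraidedCategory.braiding_tensor_left_hom, BraidedCategory.braiding_tensor_right_hom]
    simp only [Category.assoc]
  have h3 : M ◁ (𝒮[H] ⊗ₘ 𝒮[H]) ≫ M ◁ (β_ H H).hom ≫ (α_ M H H).inv =
      M ◁ (β_ H H).hom ≫ (α_ M H H).inv ≫ (M ◁ 𝒮[H]) ▷ H ≫ (M ⊗ H) ◁ 𝒮[H] := by
    rw [← MonoidalCategory.whiskerLeft_comp_assoc, BraidedCategory.braiding_naturality,
      MonoidalCategory.tensorHom_def]
    simp
  rw [reassoc_of% h3, reassoc_of% c]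
  rw [BraidedCategory.braiding_naturality_right_assoc H r,
    BraidedCategory.braiding_naturality_right_assoc H (M ◁ 𝒮[H]), whisker_exchange_assoc]

lemma act_left (h2 : M ◁ μ[H] ≫ r = (α_ M H H).inv ≫ r ▷ H ≫ r) :
    (Δ[H] ▷ (M ⊗ H) ≫ tensorμ H H M H ≫ (((β_ H M).hom ≫ M ◁ 𝒮[H] ≫ r) ⊗ₘ μ[H])) ≫ r =
      H ◁ r ≫ ε[H] ▷ M ≫ (λ_ M).hom := by
  have h3 : r ▷ H ≫ r = (α_ M H H).hom ≫ M ◁ μ[H] ≫ r := by simp [h2]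
  have h4 : Δ[H] ▷ H ≫ (α_ H H H).hom ≫ 𝒮[H] ▷ (H ⊗ H) ≫ H ◁ μ[H] ≫ μ[H] =
      ε[H] ▷ H ≫ (λ_ H).hom := by
    rw [← associator_naturality_left_assoc, ← MonObj.mul_assoc]
    simp only [← comp_whiskerRight_assoc]
    rw [HopfObj.antipode_left, comp_whiskerRight_assoc, MonObj.one_mul]
  have key : Δ[H] ▷ (M ⊗ H) ≫ tensorμ H H M H ≫ (β_ H M).hom ▷ (H ⊗ H) ≫
      (α_ M H (H ⊗ H)).hom = (α_ H M H).inv ≫ (β_ H M).hom ▷ H ≫ (α_ M H H).hom ≫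
        M ◁ (Δ[H] ▷ H ≫ (α_ H H H).hom) := by
    have k : tensorμ H H M H ≫ (β_ H M).hom ▷ (H ⊗ H) ≫ (α_ M H (H ⊗ H)).hom =
        (α_ (H ⊗ H) M H).inv ≫ (β_ (H ⊗ H) M).hom ▷ H ≫ (α_ M (H ⊗ H) H).hom ≫
          M ◁ (α_ H H H).hom := by
      rw [BraidedCategory.braiding_tensor_left_hom]
      simp only [tensorμ]
      monoidal
    rw [k, associator_inv_naturality_left_assoc, ← comp_whiskerRight_assoc,
      BraidedCategory.braiding_naturality_left]
    simp
  have h5 : (((β_ H M).hom ≫ M ◁ 𝒮[H] ≫ r) ⊗ₘ μ[H]) ≫ r =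
      (β_ H M).hom ▷ (H ⊗ H) ≫ (α_ M H (H ⊗ H)).hom ≫
        M ◁ (𝒮[H] ▷ (H ⊗ H) ≫ H ◁ μ[H] ≫ μ[H]) ≫ r := by
    rw [MonoidalCategory.tensorHom_def]
    simp only [comp_whiskerRight, Category.assoc]
    rw [← whisker_exchange_assoc, h3]
    simp
  simp only [Category.assoc]
  rw [h5, reassoc_of% key]
  simp only [← MonoidalCategory.whiskerLeft_comp_assoc, Category.assoc]
  rw [h4, whisker_exchange_assoc, leftUnitor_naturality, MonoidalCategory.whiskerLeft_comp_assoc,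
    ← associator_naturality_middle_assoc, ← comp_whiskerRight_assoc,
    ← BraidedCategory.braiding_naturality_left]
  simp

end

end Lemmas

section RawActions

variable {C : Type u} [Category.{v} C] [MonoidalCategory C]

lemma refl_left {A X : C} (a : A ⊗ X ⟶ X) : a ≫ (Iso.refl X).hom = A ◁ (Iso.refl X).hom ≫ a := by
  simp

lemma refl_right {A X : C} (a : X ⊗ A ⟶ X) : a ≫ (Iso.refl X).hom = (Iso.refl X).hom ▷ A ≫ a := by
  simp

lemma diag_triv_right {P N A B : C} (r : N ⊗ B ⟶ N) (f : A ⟶ B) :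
    ((α_ P N A).hom ≫ P ◁ (N ◁ f ≫ r)) ≫ (Iso.refl (P ⊗ N)).hom =
      (Iso.refl (P ⊗ N)).hom ▷ A ≫ (P ⊗ N) ◁ f ≫ (α_ P N B).hom ≫ P ◁ r := by
  simp

end RawActions

section Modules

open MonObj ComonObj HopfObj

variable {C : Type u} [Category.{v} C] [MonoidalCategory C]

/-- Restriction of scalars on the left. -/
def restrictLeft {A A' : Mon C} (f : A' ⟶ A) (B : Mon C) : Bimod A B ⥤ Bimod A' B where
  obj M :=
    { X := M.X
      actLeft := f.hom ▷ M.X ≫ M.actLeft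
      actRight := M.actRight
      one_actLeft := by
        rw [← comp_whiskerRight_assoc, IsMonHom.one_hom, M.one_actLeft]
      left_assoc := restrict_left_assoc f.hom M.actLeft M.left_assoc
      middle_assoc := restrict_left_middle f.hom M.actLeft M.actRight M.middle_assoc }
  map {M N} φ :=
    { hom := φ.hom
      left_act_hom := restrict_left_map f.hom M.actLeft N.actLeft φ.hom φ.left_act_hom
      right_act_hom := φ.right_act_hom }

/-- Restriction of scalars on the right. -/
def restrictRight (A : Mon C) {B B' : Mon C} (f : B' ⟶ B) : Bimod A B ⥤ Bimod A B' where
  obj M :=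
    { X := M.X
      actLeft := M.actLeft
      actRight := M.X ◁ f.hom ≫ M.actRight
      actRight_one := by
        rw [← MonoidalCategory.whiskerLeft_comp_assoc, IsMonHom.one_hom, M.actRight_one]
      right_assoc := restrict_right_assoc f.hom M.actRight M.right_assoc
      middle_assoc := restrict_right_middle f.hom M.actLeft M.actRight M.middle_assoc }
  map {M N} φ :=
    { hom := φ.hom
      left_act_hom := φ.left_act_hom
      right_act_hom := restrict_right_map f.hom M.actRight N.actRight φ.hom φ.right_act_hom }

/-- The unit object, as a monoid. -/
abbrev unitMon (C : Type u) [Category.{v} C] [MonoidalCategory C] : Mon C := Mon.mk (𝟙_ C)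

/-- An object, as a bimodule over the unit. -/
def unitBimod (C : Type u) [Category.{v} C] [MonoidalCategory C] :
    C ⥤ Bimod (unitMon C) (unitMon C) where
  obj X :=
    { X := X
      actLeft := (λ_ X).hom
      actRight := (ρ_ X).hom
      one_actLeft := by simp
      actRight_one := by simp
      left_assoc := by simp
      right_assoc := unit_right_assoc X
      middle_assoc := by simp }
  map f :=
    { hom := f
      left_act_hom := by simp
      right_act_hom := by simp }

lemma actRight_eq {A : Mon C} (M : Bimod A (unitMon C)) : M.actRight = (ρ_ M.X).hom := by
  simpa using M.actRight_one

lemma actLeft_eq {A : Mon C} (M : Bimod (unitMon C) A) : M.actLeft = (λ_ M.X).hom := by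
  simpa using M.one_actLeft

variable [SymmetricCategory C] (H : C)

section
variable [MonObj H]

/-- Left `H`-modules. (An action of the unit object on the right carries no information.) -/
abbrev LMod : Type (max u v) := Bimod (Mon.mk H) (unitMon C)

/-- Right `H`-modules. (An action of the unit object on the left carries no information.) -/
abbrev RMod : Type (max u v) := Bimod (unitMon C) (Mon.mk H)

/-- Objects with commuting left and right `H`-actions. -/
abbrev BMod : Type (max u v) := Bimod (Mon.mk H) (Mon.mk H)

/-- The underlying object of a left module. -/
abbrev forgetL : LMod H ⥤ C := Bimod.forget _

/-- The underlying object of a right module. -/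
abbrev forgetR : RMod H ⥤ C := Bimod.forget _

/-- The underlying object of a bimodule. -/
abbrev forgetB : BMod H ⥤ C := Bimod.forget _

/-- The unit of `H`, as a morphism of monoids. -/
def unitHom : unitMon C ⟶ Mon.mk H :=
  haveI : IsMonHom (M := 𝟙_ C) (N := H) η[H] :=
    { one_hom := by simp
      mul_hom := by simp [MonoidalCategory.tensorHom_def, unitors_equal] }
  Mon.Hom.mk (M := unitMon C) (N := Mon.mk H) η[H]

/-- The underlying left module of a bimodule. -/
abbrev forgetBL : BMod H ⥤ LMod H := restrictRight _ (unitHom H)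

/-- The underlying right module of a bimodule. -/
abbrev forgetBR : BMod H ⥤ RMod H := restrictLeft (unitHom H) _

/-- The free left `H`-module `H ⊗ X`. -/
def freeLeft : C ⥤ LMod H where
  obj X :=
    { X := H ⊗ X
      actLeft := (α_ H H X).inv ≫ μ[H] ▷ X
      actRight := (ρ_ (H ⊗ X)).hom
      one_actLeft := free_left_one H X
      left_assoc := free_left_assoc H X
      actRight_one := by simp
      right_assoc := unit_right_assoc (H ⊗ X)
      middle_assoc := unit_right_middle ((α_ H H X).inv ≫ μ[H] ▷ X) }
  map f :=
    { hom := H ◁ f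
      left_act_hom := by
        dsimp
        rw [Category.assoc, ← whisker_exchange, associator_inv_naturality_right_assoc]
      right_act_hom := by simp }

/-- The free right `H`-module `X ⊗ H`. -/
def freeRight : C ⥤ RMod H where
  obj X :=
    { X := X ⊗ H
      actLeft := (λ_ (X ⊗ H)).hom
      actRight := (α_ X H H).hom ≫ X ◁ μ[H]
      one_actLeft := by simp
      left_assoc := by simp
      actRight_one := free_right_one H X
      right_assoc := free_right_assoc H X
      middle_assoc := by simp }
  map f :=
    { hom := f ▷ H
      left_act_hom := by simp
      right_act_hom := by simp [whisker_exchange] }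

/-- The bimodule `H`. -/
def regularB : BMod H := Bimod.regular (Mon.mk H)

end

section
variable [BimonObj H]

/-- The counit of `H`, as a morphism of monoids. -/
def counitHom : Mon.mk H ⟶ unitMon C :=
  haveI : IsMonHom (M := H) (N := 𝟙_ C) ε[H] :=
    { one_hom := by simp
      mul_hom := by simp }
  Mon.Hom.mk (M := Mon.mk H) (N := unitMon C) ε[H]

/-- The trivial left action. -/
def trivL : C ⥤ LMod H := unitBimod C ⋙ restrictLeft (counitHom H) _

/-- The trivial right action. -/
def trivR : C ⥤ RMod H := unitBimod C ⋙ restrictRight _ (counitHom H)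

/-- The trivial left action on a right module. -/
def trivBL : RMod H ⥤ BMod H := restrictLeft (counitHom H) _

/-- The trivial right action on a left module. -/
def trivBR : LMod H ⥤ BMod H := restrictRight _ (counitHom H)

variable {H}

/-- The diagonal left action of `H` on `P ⊗ N`, where `P` is a left `H`-module and `N` is a left
`H`-module that may also have a right action of some `B`; the latter is kept. -/
def diagTensor (P : LMod H) (B : Mon C) : Bimod (Mon.mk H) B ⥤ Bimod (Mon.mk H) B where
  obj N :=
    { X := P.X ⊗ N.X
      actLeft := Δ[H] ▷ (P.X ⊗ N.X) ≫ tensorμ H H P.X N.X ≫ (P.actLeft ⊗ₘ N.actLeft)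
      actRight := (α_ P.X N.X B.X).hom ≫ P.X ◁ N.actRight
      one_actLeft := diag_one P.actLeft N.actLeft P.one_actLeft N.one_actLeft
      left_assoc := diag_assoc P.actLeft N.actLeft P.left_assoc N.left_assoc
      actRight_one := by
        rw [associator_naturality_right_assoc, ← MonoidalCategory.whiskerLeft_comp,
          N.actRight_one, rightUnitor_tensor_hom]
      right_assoc := by
        simp [← MonoidalCategory.whiskerLeft_comp]
      middle_assoc := diag_middle P.actLeft N.actLeft N.actRight N.middle_assoc }
  map {N N'} φ :=
    { hom := P.X ◁ φ.hom
      left_act_hom := by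
        have h := tensorμ_natural_right (Z₁ := H) (Z₂ := H) (𝟙 P.X) φ.hom
        have e := φ.left_act_hom
        dsimp at e
        simp only [id_tensorHom, MonoidalCategory.whiskerLeft_id] at h
        simp only [Category.assoc]
        rw [MonoidalCategory.tensorHom_def, Category.assoc,
          ← MonoidalCategory.whiskerLeft_comp, e, MonoidalCategory.whiskerLeft_comp,
          ← whisker_exchange_assoc, ← MonoidalCategory.tensorHom_def,
          whisker_exchange_assoc, reassoc_of% h]
      right_act_hom := by
        simp [← MonoidalCategory.whiskerLeft_comp] }

end

section
variable [HopfObj H]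

/-- The left action of `H` through inverses on a right `H`-module, i.e. through the antipode. -/
def leftOfRight : RMod H ⥤ LMod H where
  obj M :=
    { X := M.X
      actLeft := (β_ H M.X).hom ≫ M.X ◁ 𝒮[H] ≫ M.actRight
      actRight := (ρ_ M.X).hom
      one_actLeft := antipode_one M.actRight M.actRight_one
      left_assoc := antipode_assoc M.actRight M.right_assoc
      actRight_one := by simp
      right_assoc := unit_right_assoc M.X
      middle_assoc := by simp }
  map {M N} φ :=
    { hom := φ.hom
      left_act_hom := by
        have e := φ.right_act_hom
        dsimp at e
        simp only [Category.assoc]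
        rw [e, whisker_exchange_assoc]
        simp
      right_act_hom := by simp }

/-- `m ⊗ h ↦ m h`, as a bimodule map from `M ⊗ H`, with the diagonal left action, to `M` with the
trivial left action. -/
def actHom (M : RMod H) :
    (diagTensor ((leftOfRight H).obj M) (Mon.mk H)).obj (regularB H) ⟶ (trivBL H).obj M where
  hom := M.actRight
  left_act_hom := by
    refine (act_left M.actRight M.right_assoc).trans ?_
    rw [← actLeft_eq M]
    rfl
  right_act_hom := by
    have h : (α_ M.X H H).hom ≫ M.X ◁ μ[H] ≫ M.actRight = M.actRight ▷ H ≫ M.actRight :=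
      (Iso.inv_comp_eq _).1 M.right_assoc.symm |>.symm
    exact (Category.assoc _ _ _).trans h

end

end Modules

section Monoidal

/-- The pushout-product of two morphisms. -/
def pushoutProduct {C : Type u} [Category.{v} C] [MonoidalCategory C] [HasPushouts C]
    {A B K L : C} (f : A ⟶ B) (g : K ⟶ L) : pushout (f ▷ K) (A ◁ g) ⟶ B ⊗ L :=
  pushout.desc (B ◁ g) (f ▷ L) (whisker_exchange f g).symm

/-- The compatibility of a model structure with a symmetric monoidal closed structure: the
pushout-product axiom, and cofibrancy of the unit object. -/
class MonoidalModelCategory (C : Type u) [Category.{v} C] [MonoidalCategory C]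
    [ModelCategory C] : Prop where
  cofibration_pushoutProduct {A B K L : C} (f : A ⟶ B) (g : K ⟶ L) [Cofibration f]
    [Cofibration g] :
    Cofibration (pushoutProduct f g)
  weakEquivalence_pushoutProduct_left {A B K L : C} (f : A ⟶ B) (g : K ⟶ L) [Cofibration f]
    [Cofibration g] [WeakEquivalence f] :
    WeakEquivalence (pushoutProduct f g)
  weakEquivalence_pushoutProduct_right {A B K L : C} (f : A ⟶ B) (g : K ⟶ L) [Cofibration f]
    [Cofibration g] [WeakEquivalence g] :
    WeakEquivalence (pushoutProduct f g)
  isCofibrant_unit : IsCofibrant (𝟙_ C)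

variable {C : Type u} [Category.{v} C] [MonoidalCategory C] [SymmetricCategory C]
  [MonoidalClosed C] [ModelCategory C]

/-- `⊥ ⊗ K` is initial. -/
def isInitialTensor (K : C) : IsInitial ((⊥_ C) ⊗ K) :=
  (IsInitial.isInitialObj (tensorLeft K) _ initialIsInitial).ofIso (β_ K (⊥_ C))

lemma pushoutProduct_initial (B : C) {K L : C} (g : K ⟶ L) :
    IsIso (pushout.inl (initial.to B ▷ K) ((⊥_ C) ◁ g)) ∧
      pushout.inl (initial.to B ▷ K) ((⊥_ C) ◁ g) ≫ pushoutProduct (initial.to B) g = B ◁ g := by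
  have h : IsIso ((⊥_ C) ◁ g) := isIso_of_isInitial (isInitialTensor K) (isInitialTensor L) _
  exact ⟨(IsPushout.of_hasPushout (initial.to B ▷ K) ((⊥_ C) ◁ g)).isIso_inl_of_isIso,
    pushout.inl_desc _ _ _⟩

variable [MonoidalModelCategory C]

lemma cofibration_whiskerLeft (B : C) [IsCofibrant B] {K L : C} (g : K ⟶ L) [Cofibration g] :
    Cofibration (B ◁ g) := by
  obtain ⟨hi, e⟩ := pushoutProduct_initial B g
  have := MonoidalModelCategory.cofibration_pushoutProduct (initial.to B) g
  rw [← e]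
  infer_instance

lemma weakEquivalence_whiskerLeft_of_cofibration (B : C) [IsCofibrant B] {K L : C} (g : K ⟶ L)
    [Cofibration g] [WeakEquivalence g] : WeakEquivalence (B ◁ g) := by
  obtain ⟨hi, e⟩ := pushoutProduct_initial B g
  have := MonoidalModelCategory.weakEquivalence_pushoutProduct_right (initial.to B) g
  rw [← e]
  infer_instance

instance leftDerivable_tensorLeft (B : C) [IsCofibrant B] : LeftDerivable (tensorLeft B) :=
  leftDerivable_of_trivialCofibration _
    (fun g _ _ _ _ => weakEquivalence_whiskerLeft_of_cofibration B g)

lemma isCofibrant_tensor (B K : C) [IsCofibrant B] [IsCofibrant K] : IsCofibrant (B ⊗ K) := by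
  have h := cofibration_whiskerLeft B (initial.to K)
  have hi : IsInitial (B ⊗ (⊥_ C)) := IsInitial.isInitialObj (tensorLeft B) _ initialIsInitial
  rw [isCofibrant_iff_of_isInitial (B ◁ initial.to K) hi]
  exact h

lemma weakEquivalence_whiskerLeft (B : C) [IsCofibrant B] {K L : C} [hK : IsCofibrant K]
    [hL : IsCofibrant L] (g : K ⟶ L) [hg : WeakEquivalence g] : WeakEquivalence (B ◁ g) :=
  (leftDerivable_tensorLeft B).map_we g hK hL hg

lemma weakEquivalence_whiskerRight (B : C) [IsCofibrant B] {K L : C} [IsCofibrant K]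
    [IsCofibrant L] (g : K ⟶ L) [WeakEquivalence g] : WeakEquivalence (g ▷ B) := by
  have := weakEquivalence_whiskerLeft B g
  have e : g ▷ B = (β_ K B).hom ≫ B ◁ g ≫ (β_ B L).hom := by simp
  rw [e]
  infer_instance

instance : (cofibrantObjects C).IsMonoidal where
  prop_unit := MonoidalModelCategory.isCofibrant_unit
  prop_tensor X Y hX hY := by
    have : IsCofibrant X := hX
    have : IsCofibrant Y := hY
    exact isCofibrant_tensor X Y

instance : (weakEquivalences (CofibrantObject C)).IsMonoidal where
  whiskerLeft X {Y₁ Y₂} g hg := by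
    have : WeakEquivalence g.hom := (weakEquivalence_iff _).2 hg
    exact (weakEquivalence_iff (X.obj ◁ g.hom)).1 (weakEquivalence_whiskerLeft X.obj g.hom)
  whiskerRight {X₁ X₂} f hf Y := by
    have : WeakEquivalence f.hom := (weakEquivalence_iff _).2 hf
    exact (weakEquivalence_iff (f.hom ▷ Y.obj)).1 (weakEquivalence_whiskerRight Y.obj f.hom)

variable (C) in
/-- The homotopy category with its derived symmetric monoidal structure, which is obtained by
localizing the monoidal category of cofibrant objects at the weak equivalences. -/
abbrev MonoidalHo : Type u :=
  LocalizedMonoidal (hoQ (CofibrantObject C)) (weakEquivalences (CofibrantObject C))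
    (Iso.refl ((hoQ (CofibrantObject C)).obj (𝟙_ (CofibrantObject C))))

/-- A cofibrant object, as an object of the homotopy category. -/
def toMonoidalHo (X : C) [IsCofibrant X] : MonoidalHo C :=
  (hoQ (CofibrantObject C)).obj (CofibrantObject.mk X)

end Monoidal

section Dualizable

variable {T : Type u} [Category.{v} T] [MonoidalCategory T]

/-- `E`, with the evaluation map `ev`, is the internal hom object from `X` to `Y`. -/
def IsInternalHom {E X Y : T} (ev : E ⊗ X ⟶ Y) : Prop :=
  ∀ Z : T, Function.Bijective (fun g : Z ⟶ E => g ▷ X ≫ ev)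

/-- `X` is dualizable: the internal homs `DX` from `X` to the unit and `E` from `X` to `X` exist
(as they do in a closed category), and the canonical map `DX ⊗ X ⟶ E` is an isomorphism. The
canonical map is the transpose of
`(DX ⊗ X) ⊗ X ≅ (DX ⊗ X) ⊗ X ⟶ 𝟙 ⊗ X ≅ X`, where the first map exchanges the two copies of `X`
and the second one evaluates. -/
def IsDualizable [SymmetricCategory T] (X : T) : Prop :=
  ∃ (DX E : T) (ev : DX ⊗ X ⟶ 𝟙_ T) (ev' : E ⊗ X ⟶ X),
    IsInternalHom ev ∧ IsInternalHom ev' ∧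
      ∃ ν : DX ⊗ X ⟶ E, IsIso ν ∧
        ν ▷ X ≫ ev' = (α_ DX X X).hom ≫ DX ◁ (β_ X X).hom ≫ (α_ DX X X).inv ≫ ev ▷ X ≫
          (λ_ X).hom

end Dualizable

section Norm

open ComonObj

variable {C : Type u} [Category.{v} C] [MonoidalCategory C] [SymmetricCategory C]
  [ModelCategory C] (H : C)

/-- The assumptions on the model structures on the categories of left modules, right modules and
bimodules over `H`: a map is a weak equivalence if its underlying map is one, the forgetful
functors are both left and right Quillen functors, the trivial action functor is a left Quillen
functor for right actions (so that fixed points can be derived) and a right Quillen functor for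
left actions (so that orbits can be derived). -/
class CompatibleModuleModelStructures [BimonObj H] [ModelCategory (LMod H)]
    [ModelCategory (RMod H)] [ModelCategory (BMod H)] : Prop where
  weakEquivalences_L : weakEquivalences (LMod H) = (weakEquivalences C).inverseImage (forgetL H)
  weakEquivalences_R : weakEquivalences (RMod H) = (weakEquivalences C).inverseImage (forgetR H)
  weakEquivalences_B : weakEquivalences (BMod H) = (weakEquivalences C).inverseImage (forgetB H)
  isLeftQuillen_forgetL : IsLeftQuillen (forgetL H)
  isRightQuillen_forgetL : IsRightQuillen (forgetL H)
  isLeftQuillen_forgetR : IsLeftQuillen (forgetR H)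
  isRightQuillen_forgetR : IsRightQuillen (forgetR H)
  isLeftQuillen_forgetBL : IsLeftQuillen (forgetBL H)
  isRightQuillen_forgetBL : IsRightQuillen (forgetBL H)
  isLeftQuillen_forgetBR : IsLeftQuillen (forgetBR H)
  isRightQuillen_forgetBR : IsRightQuillen (forgetBR H)
  isLeftQuillen_trivR : IsLeftQuillen (trivR H)
  isLeftQuillen_trivBR : IsLeftQuillen (trivBR H)
  isRightQuillen_trivL : IsRightQuillen (trivL H)
  isRightQuillen_trivBL : IsRightQuillen (trivBL H)

open CompatibleModuleModelStructures

section Bimon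

variable [BimonObj H] [ModelCategory (LMod H)] [ModelCategory (RMod H)] [ModelCategory (BMod H)]
  [CompatibleModuleModelStructures H]

lemma weakEquivalence_L_iff {M N : LMod H} (f : M ⟶ N) :
    WeakEquivalence f ↔ WeakEquivalence f.hom := by
  rw [weakEquivalence_iff, weakEquivalence_iff, weakEquivalences_L]
  rfl

lemma weakEquivalence_R_iff {M N : RMod H} (f : M ⟶ N) :
    WeakEquivalence f ↔ WeakEquivalence f.hom := by
  rw [weakEquivalence_iff, weakEquivalence_iff, weakEquivalences_R]
  rfl

lemma weakEquivalence_B_iff {M N : BMod H} (f : M ⟶ N) :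
    WeakEquivalence f ↔ WeakEquivalence f.hom := by
  rw [weakEquivalence_iff, weakEquivalence_iff, weakEquivalences_B]
  rfl

instance : PreservesWE (trivL H) where
  map_we _ hf := (weakEquivalence_L_iff H _).2 hf

instance : PreservesWE (trivR H) where
  map_we _ hf := (weakEquivalence_R_iff H _).2 hf

instance : PreservesWE (trivBL H) where
  map_we f hf := (weakEquivalence_B_iff H _).2 ((weakEquivalence_R_iff H f).1 hf)

instance : PreservesWE (trivBR H) where
  map_we f hf := (weakEquivalence_B_iff H _).2 ((weakEquivalence_L_iff H f).1 hf)

instance : PreservesCofibrant (trivBR H) :=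
  (isLeftQuillen_trivBR (H := H)).preservesCofibrant

instance : (trivR H).IsLeftAdjoint := (isLeftQuillen_trivR (H := H)).isLeftAdjoint

instance : (trivBR H).IsLeftAdjoint := (isLeftQuillen_trivBR (H := H)).isLeftAdjoint

instance : (trivL H).IsRightAdjoint := (isRightQuillen_trivL (H := H)).isRightAdjoint

instance : (trivBL H).IsRightAdjoint := (isRightQuillen_trivBL (H := H)).isRightAdjoint

/-- The fixed points of a right module. -/
abbrev fixR : RMod H ⥤ C := (trivR H).rightAdjoint

/-- The fixed points of a bimodule under the right action, with the left action. -/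
abbrev fixBR : BMod H ⥤ LMod H := (trivBR H).rightAdjoint

/-- The orbits of a left module. -/
abbrev orbL : LMod H ⥤ C := (trivL H).leftAdjoint

/-- The orbits of a bimodule under the left action, with the right action. -/
abbrev orbBL : BMod H ⥤ RMod H := (trivBL H).leftAdjoint

/-- The adjunction between the trivial action and the fixed points. -/
abbrev adjFixR : trivR H ⊣ fixR H := Adjunction.ofIsLeftAdjoint _

/-- The adjunction between the trivial action and the fixed points. -/
abbrev adjFixBR : trivBR H ⊣ fixBR H := Adjunction.ofIsLeftAdjoint _

/-- The adjunction between the orbits and the trivial action. -/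
abbrev adjOrbL : orbL H ⊣ trivL H := Adjunction.ofIsRightAdjoint _

/-- The adjunction between the orbits and the trivial action. -/
abbrev adjOrbBL : orbBL H ⊣ trivBL H := Adjunction.ofIsRightAdjoint _

instance : RightDerivable (fixR H) :=
  (isRightQuillen_of_adj (adjFixR H) isLeftQuillen_trivR).rightDerivable

instance : RightDerivable (fixBR H) :=
  (isRightQuillen_of_adj (adjFixBR H) isLeftQuillen_trivBR).rightDerivable

instance : LeftDerivable (orbL H) :=
  (isLeftQuillen_of_adj (adjOrbL H) isRightQuillen_trivL).leftDerivable

instance : LeftDerivable (orbBL H) :=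
  (isLeftQuillen_of_adj (adjOrbBL H) isRightQuillen_trivBL).leftDerivable

/-- The two ways to put trivial actions on both sides agree. -/
def trivCommIso : trivL H ⋙ trivBR H ≅ trivR H ⋙ trivBL H :=
  NatIso.ofComponents (fun X => Bimod.isoOfIso (Iso.refl X)
    (refl_left _) (refl_right _))
    (fun f => by ext; exact (Category.comp_id f).trans (Category.id_comp f).symm)

/-- The comparison between the orbits of a trivial right action and the trivial right action on
the orbits. -/
def orbTrivHom : trivBR H ⋙ orbBL H ⟶ orbL H ⋙ trivR H :=
  ((mateEquiv (adjOrbL H) (adjOrbBL H)).symm (TwoSquare.mk _ _ _ _ (trivCommIso H).hom)).natTrans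

/-- The canonical map to the orbits. -/
def orbUnit (Y : LMod H) : Y.X ⟶ (orbL H).obj Y := ((adjOrbL H).unit.app Y).hom

/-- The canonical map from the fixed points. -/
def fixCounit (N : RMod H) : (fixR H).obj N ⟶ N.X := ((adjFixR H).counit.app N).hom

/-- Maps from an object to the fixed points are equivariant maps for the trivial action. -/
lemma fixR_hom_ext {Z : C} {N : RMod H} (a b : Z ⟶ (fixR H).obj N)
    (h : a ≫ fixCounit H N = b ≫ fixCounit H N) : a = b := by
  apply ((adjFixR H).homEquiv _ _).symm.injective
  rw [Adjunction.homEquiv_counit, Adjunction.homEquiv_counit]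
  ext
  exact h

lemma fixR_exists_hom {Z : C} {N : RMod H} (k : Z ⟶ N.X)
    (hk : (Z ◁ ε[H] ≫ (ρ_ Z).hom) ≫ k = k ▷ H ≫ N.actRight) :
    ∃ a : Z ⟶ (fixR H).obj N, a ≫ fixCounit H N = k := by
  let k' : (trivR H).obj Z ⟶ N :=
    { hom := k
      left_act_hom := by
        rw [actLeft_eq, actLeft_eq]
        exact (leftUnitor_naturality k).symm
      right_act_hom := hk }
  refine ⟨(adjFixR H).homEquiv _ _ k', ?_⟩
  have h := ((adjFixR H).homEquiv _ _).symm_apply_apply k'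
  rw [Adjunction.homEquiv_counit] at h
  exact congrArg Bimod.Hom.hom h

lemma trivR_hom_eq {Z : C} {N : RMod H} (f : (trivR H).obj Z ⟶ N) :
    (adjFixR H).homEquiv _ _ f ≫ fixCounit H N = f.hom := by
  have h := ((adjFixR H).homEquiv _ _).symm_apply_apply f
  rw [Adjunction.homEquiv_counit] at h
  exact congrArg Bimod.Hom.hom h

lemma orbL_hom_ext {Y : LMod H} {Z : C} (a b : (orbL H).obj Y ⟶ Z)
    (h : orbUnit H Y ≫ a = orbUnit H Y ≫ b) : a = b := by
  apply ((adjOrbL H).homEquiv _ _).injective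
  rw [Adjunction.homEquiv_unit, Adjunction.homEquiv_unit]
  ext
  exact h

lemma orbL_exists_hom {Y : LMod H} {Z : C} (k : Y.X ⟶ Z)
    (hk : Y.actLeft ≫ k = H ◁ k ≫ ε[H] ▷ Z ≫ (λ_ Z).hom) :
    ∃ a : (orbL H).obj Y ⟶ Z, orbUnit H Y ≫ a = k := by
  let k' : Y ⟶ (trivL H).obj Z :=
    { hom := k
      left_act_hom := hk
      right_act_hom := by
        rw [actRight_eq, actRight_eq]
        exact (rightUnitor_naturality k).symm }
  refine ⟨((adjOrbL H).homEquiv _ _).symm k', ?_⟩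
  have h := ((adjOrbL H).homEquiv _ _).apply_symm_apply k'
  rw [Adjunction.homEquiv_unit] at h
  exact congrArg Bimod.Hom.hom h

lemma orbTrivHom_homEquiv (Y : LMod H) (N : RMod H) (f : (trivR H).obj ((orbL H).obj Y) ⟶ N) :
    ((adjOrbBL H).homEquiv ((trivBR H).obj Y) N ((orbTrivHom H).app Y ≫ f)).hom =
      orbUnit H Y ≫ f.hom := by
  have e : (adjOrbBL H).homEquiv ((trivBR H).obj Y) N ((orbTrivHom H).app Y ≫ f) =
      (trivBR H).map ((adjOrbL H).unit.app Y) ≫ (trivCommIso H).hom.app ((orbL H).obj Y) ≫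
        (trivBL H).map f := by
    rw [Adjunction.homEquiv_naturality_right, ← Category.assoc]
    congr 1
    have h := unit_mateEquiv_symm (adjOrbL H) (adjOrbBL H)
      (TwoSquare.mk _ _ _ _ (trivCommIso H).hom) Y
    exact h.symm
  rw [e]
  exact congrArg (fun g => orbUnit H Y ≫ g) (Category.id_comp f.hom)

instance : IsIso (orbTrivHom H) := by
  rw [NatTrans.isIso_iff_isIso_app]
  intro Y
  refine isIso_of_coyoneda_map_bijective _ (fun N => ?_)
  constructor
  · intro f f' h
    have h' : orbUnit H Y ≫ f.hom = orbUnit H Y ≫ f'.hom := by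
      rw [← orbTrivHom_homEquiv, ← orbTrivHom_homEquiv]
      exact congrArg (fun g => ((adjOrbBL H).homEquiv ((trivBR H).obj Y) N g).hom) h
    apply ((adjFixR H).homEquiv _ _).injective
    apply orbL_hom_ext
    apply fixR_hom_ext
    rw [Category.assoc, Category.assoc, trivR_hom_eq, trivR_hom_eq]
    exact h'
  · intro g
    let k : (trivBR H).obj Y ⟶ (trivBL H).obj N := (adjOrbBL H).homEquiv _ _ g
    have hr : (Y.X ◁ ε[H] ≫ (ρ_ Y.X).hom) ≫ k.hom = k.hom ▷ H ≫ N.actRight := by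
      rw [← actRight_eq Y]
      exact k.right_act_hom
    have hl : Y.actLeft ≫ k.hom = H ◁ k.hom ≫ ε[H] ▷ N.X ≫ (λ_ N.X).hom := by
      rw [← actLeft_eq N]
      exact k.left_act_hom
    obtain ⟨a, ha⟩ : ∃ a : Y.X ⟶ (fixR H).obj N, a ≫ fixCounit H N = k.hom :=
      fixR_exists_hom H k.hom hr
    obtain ⟨b, hb⟩ := orbL_exists_hom H (Y := Y) a (by
      apply fixR_hom_ext
      have e : ε[H] ▷ (fixR H).obj N ≫ (λ_ _).hom ≫ fixCounit H N =
          H ◁ fixCounit H N ≫ ε[H] ▷ N.X ≫ (λ_ N.X).hom := by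
        rw [whisker_exchange_assoc, leftUnitor_naturality]
      rw [Category.assoc, Category.assoc, Category.assoc, e, ha, ← MonoidalCategory.whiskerLeft_comp_assoc,
        ha]
      exact hl)
    refine ⟨(trivR H).map b ≫ (adjFixR H).counit.app N, ?_⟩
    apply ((adjOrbBL H).homEquiv ((trivBR H).obj Y) N).injective
    ext
    refine (orbTrivHom_homEquiv H Y N _).trans ?_
    refine (Category.assoc _ _ _).symm.trans ?_
    exact (congrArg (fun z => z ≫ _) hb).trans ha

/-- The homotopy fixed points of a right module. -/
abbrev hfixR : Ho (RMod H) ⥤ Ho C := rightDerived (fixR H)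

/-- The homotopy fixed points of a bimodule under the right action. -/
abbrev hfixBR : Ho (BMod H) ⥤ Ho (LMod H) := rightDerived (fixBR H)

/-- The homotopy orbits of a left module. -/
abbrev horbL : Ho (LMod H) ⥤ Ho C := leftDerived (orbL H)

/-- The homotopy orbits of a bimodule under the left action. -/
abbrev horbBL : Ho (BMod H) ⥤ Ho (RMod H) := leftDerived (orbBL H)

/-- The transformation from the orbits of the fixed points to the fixed points of the orbits. It
is the mate of the isomorphism between the orbits of a trivial right action and the trivial right
action on the orbits. -/
def kappa : hfixBR H ⋙ horbL H ⟶ horbBL H ⋙ hfixR H :=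
  (mateEquiv (derivedAdjunction (adjFixBR H)) (derivedAdjunction (adjFixR H))
    (TwoSquare.mk _ _ _ _ (leftDerivedCommIso (orbL H) (orbBL H) (trivBR H) (trivR H)
      (asIso (orbTrivHom H))).inv)).natTrans

end Bimon

section Tensor

variable [MonoidalClosed C] [MonoidalModelCategory C] [BimonObj H] [ModelCategory (LMod H)]
  [ModelCategory (RMod H)] [ModelCategory (BMod H)] [CompatibleModuleModelStructures H]

variable {H} (P : LMod H) [IsCofibrant P.X]

instance : LeftDerivable (diagTensor P (unitMon C)) where
  map_we {M N} f hM hN hf := by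
    have h := (isLeftQuillen_forgetL (H := H)).preservesCofibrant
    have : IsCofibrant M.X := h.isCofibrant M hM
    have : IsCofibrant N.X := h.isCofibrant N hN
    have := (weakEquivalence_L_iff H f).1 hf
    exact (weakEquivalence_L_iff H _).2 (weakEquivalence_whiskerLeft P.X f.hom)

instance : LeftDerivable (diagTensor P (Mon.mk H)) where
  map_we {M N} f hM hN hf := by
    have h := (isLeftQuillen_forgetL (H := H)).preservesCofibrant
    have h' := (isLeftQuillen_forgetBL (H := H)).preservesCofibrant
    have : IsCofibrant M.X := h.isCofibrant _ (h'.isCofibrant M hM)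
    have : IsCofibrant N.X := h.isCofibrant _ (h'.isCofibrant N hN)
    have := (weakEquivalence_B_iff H f).1 hf
    exact (weakEquivalence_B_iff H _).2 (weakEquivalence_whiskerLeft P.X f.hom)

/-- The tensor product with `P` is compatible with the trivial right action. -/
def diagTrivIso : trivBR H ⋙ diagTensor P (Mon.mk H) ≅ diagTensor P (unitMon C) ⋙ trivBR H :=
  NatIso.ofComponents (fun N => Bimod.isoOfIso (Iso.refl (P.X ⊗ N.X))
    (refl_left _) (diag_triv_right N.actRight ε[H]))
    (fun f => by
      ext
      exact (Category.comp_id (P.X ◁ f.hom)).trans (Category.id_comp (P.X ◁ f.hom)).symm)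

/-- The canonical transformation `P ⊗ N^{hH} ⟶ (P ⊗ N)^{hH}`, where the right action on `P ⊗ N` is
that on `N`. It is the mate of the isomorphism between `P ⊗ (-)` with trivial right actions before
and after the tensor product. -/
def tensorFix : hfixBR H ⋙ leftDerived (diagTensor P (unitMon C)) ⟶
    leftDerived (diagTensor P (Mon.mk H)) ⋙ hfixBR H :=
  (mateEquiv (derivedAdjunction (adjFixBR H)) (derivedAdjunction (adjFixBR H))
    (TwoSquare.mk _ _ _ _ (leftDerivedCommIso (diagTensor P (unitMon C))
      (diagTensor P (Mon.mk H)) (trivBR H) (trivBR H) (diagTrivIso P)).inv)).natTrans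

variable (H) [IsCofibrant H]

instance : LeftDerivable (freeLeft H) where
  map_we f _ _ _ := (weakEquivalence_L_iff H _).2 (weakEquivalence_whiskerLeft H f)

instance : LeftDerivable (freeRight H) where
  map_we f _ _ _ := (weakEquivalence_R_iff H _).2 (weakEquivalence_whiskerRight H f)

end Tensor

section Hopf

variable [MonoidalClosed C] [MonoidalModelCategory C] [HopfObj H] [ModelCategory (LMod H)]
  [ModelCategory (RMod H)] [ModelCategory (BMod H)] [CompatibleModuleModelStructures H]

/-- The dualizing object `H^{hH}`: the homotopy fixed points of the bimodule `H` under the right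
action, with the left action. -/
def dualizing : Ho (LMod H) := (hfixBR H).obj ((hoQ (BMod H)).obj (regularB H))

variable {H}

instance (M : RMod H) [h : IsCofibrant M.X] : IsCofibrant ((leftOfRight H).obj M).X := h

variable (M : RMod H) [IsCofibrant M.X]

/-- The functor `M ⊗ (-)` on the homotopy category of left modules. -/
abbrev tensL : Ho (LMod H) ⥤ Ho (LMod H) :=
  leftDerived (diagTensor ((leftOfRight H).obj M) (unitMon C))

/-- The functor `M ⊗ (-)` on the homotopy category of bimodules. -/
abbrev tensB : Ho (BMod H) ⥤ Ho (BMod H) :=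
  leftDerived (diagTensor ((leftOfRight H).obj M) (Mon.mk H))

/-- The map `(M ⊗ H)_{hH} ⟶ M` of right modules that is induced by the action of `H` on `M`. -/
def orbTensorHom :
    (horbBL H).obj ((tensB M).obj ((hoQ (BMod H)).obj (regularB H))) ⟶ (hoQ (RMod H)).obj M :=
  (horbBL H).map ((leftDerivedCounit (diagTensor ((leftOfRight H).obj M) (Mon.mk H))).app
      (regularB H)) ≫
    (leftDerivedCounit (orbBL H)).app _ ≫
      (hoQ (RMod H)).map (((adjOrbBL H).homEquiv _ M).symm (actHom H M))

/-- The norm map `(M ⊗ H^{hH})_{hH} ⟶ M^{hH}`, i.e. the composite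
`(M ⊗ H^{hH})_{hH} ⟶ ((M ⊗ H)^{hH})_{hH} ⟶ ((M ⊗ H)_{hH})^{hH} ⟶ M^{hH}`. -/
def normMap :
    (horbL H).obj ((tensL M).obj (dualizing H)) ⟶ (hfixR H).obj ((hoQ (RMod H)).obj M) :=
  (horbL H).map ((tensorFix ((leftOfRight H).obj M)).app ((hoQ (BMod H)).obj (regularB H))) ≫
    (kappa H).app ((tensB M).obj ((hoQ (BMod H)).obj (regularB H))) ≫
      (hfixR H).map (orbTensorHom M)

end Hopf

end Norm

end

end HopfNorm

open HopfNorm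

/-! The norm map is a composite of three maps, and each of them is invertible. Apart from formal
properties of derived adjunctions, two facts about a Hopf monoid H with a dual E in a symmetric
monoidal category are needed, and they are applied in Ho C: the right module E ⊗ H is cofree, and
the antipode S is invertible.

First map. Fixed points of bimodules are computed on underlying right modules, so the left actions
can be forgotten, and it remains to see that p ⊗ H^{hH} ⟶ (p ⊗ H)^{hH} is invertible for every
cofibrant object p. The fixed points of a cofree module on Z are Z. Now E ⊗ H is cofree on H along ξ
⊗ h ↦ ξ(h₁) h₂ (`isPerfect_mul_dualPairing`), and p ⊗ (E ⊗ H) is cofree on p ⊗ H, because a perfect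
pairing stays perfect after tensoring. So the claim holds for E ⊗ H in place of H. The unit is a
retract of E, by the counit of H and evaluation at 1, hence H is a retract of E ⊗ H and inherits the
claim (`isIso_tensFix_app_free`, `isIso_tensorFix_app`).

Last map. With the diagonal left action, M ⊗ H is free on M, so its derived orbits are M
(`isIso_orbTensorHom`). This needs no freeness of M.

Middle map. If M is the free left module H ⊗ x, then M ⊗ H is the free bimodule H ⊗ (x ⊗ H)
(`freeDiagIso`). By the first step, the fixed points of a free bimodule H ⊗ y, with y = x ⊗ H, are
the free left module on the fixed points of y; orbits undo H ⊗ (-), so both sides of κ are the fixed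
points of y (`isIso_kappa_app_freeBL_freeRight`).

The case of a free right module x ⊗ H reduces to the previous one: h ⊗ y ↦ y ⊗ S(h) is a map of left
modules from H ⊗ x to the twist of x ⊗ H by S, and it is a weak equivalence once S is. For this, E
is a Hopf module under (hξ)(k) = ξ(S(h) k). The structure theorem for Hopf modules produces an
identity in which the action, and hence S, comes first; this gives a retraction of S, and the same
argument in the opposite category gives a section (`isIso_antipode`).

All comparison maps are mates of exchange isomorphisms of derived functors. The value of a mate at
an object is invertible exactly if a universal arrow is taken to a universal arrow
(`isIso_mateEquiv_app_iff`, `isIso_mate_leftDerivedCommIso_iff`), so the argument is about universal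
arrows out of trivial modules. -/

namespace HopfNorm

noncomputable section

/-! ### Saturation of the weak equivalences of a model category. -/

section Saturation

variable {C : Type u} [Category.{v} C] [ModelCategory C]

instance isIso_hoQ_map {X Y : C} (f : X ⟶ Y) [WeakEquivalence f] : IsIso ((hoQ C).map f) :=
  Localization.inverts (hoQ C) (weakEquivalences C) _ (mem_weakEquivalences f)

/-- Both ends of a cylinder are weak equivalences. The homotopy restricts to the identity at one
end, so two-out-of-three applies first to the homotopy and then to its restriction to the other end.
-/
lemma weakEquivalence_of_leftHomotopyRel_id {X : C} (f : X ⟶ X)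
    (h : LeftHomotopyRel (𝟙 X) f) : WeakEquivalence f := by
  obtain ⟨P, ⟨h⟩⟩ := h
  have h1 : WeakEquivalence (P.i₀ ≫ h.h) := by rw [h.h₀]; infer_instance
  have h2 : WeakEquivalence h.h := weakEquivalence_of_precomp P.i₀ h.h
  rw [← h.h₁]
  infer_instance

/-- Homotopy lifting along the fibration f corrects a homotopy inverse to a strict section g'. Then
f is a retract of f ≫ g', which is homotopic to the identity. -/
lemma weakEquivalence_of_isIso_aux {X Y : C} [IsCofibrant X] [IsFibrant X] [IsCofibrant Y]
    [IsFibrant Y] (f : X ⟶ Y) [Fibration f] (hf : IsIso ((hoQ C).map f)) :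
    WeakEquivalence f := by
  obtain ⟨g, hg⟩ := map_surjective_of_isLocalization (hoQ C) Y X (inv ((hoQ C).map f))
  have h1 : (hoQ C).map (g ≫ f) = (hoQ C).map (𝟙 Y) := by simp [hg]
  obtain ⟨P, hP, ⟨h⟩⟩ := ((LeftHomotopyRel.iff_map_eq (hoQ C) Y Y).2 h1).exists_good_cylinder
  have sq : CommSq g P.i₀ f h.h := ⟨h.h₀.symm⟩
  let g' := P.i₁ ≫ sq.lift
  have hg' : g' ≫ f = 𝟙 Y := by simp [g', h.h₁]
  have hw : WeakEquivalence (f ≫ g') := by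
    apply weakEquivalence_of_leftHomotopyRel_id
    rw [LeftHomotopyRel.iff_map_eq (hoQ C) X X]
    have h2 : (hoQ C).map g' ≫ (hoQ C).map f = 𝟙 _ := by
      rw [← Functor.map_comp, hg', CategoryTheory.Functor.map_id]
    have h3 : (hoQ C).map g' = inv ((hoQ C).map f) := by
      rw [← cancel_mono ((hoQ C).map f), h2, IsIso.inv_hom_id]
    rw [Functor.map_comp, h3, IsIso.hom_inv_id, CategoryTheory.Functor.map_id]
  have r : RetractArrow f (f ≫ g') :=
    { i := Arrow.homMk (𝟙 X) g' (by simp)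
      r := Arrow.homMk (𝟙 X) f (by simp [hg'])
      retract := by ext <;> simp [hg'] }
  rw [weakEquivalence_iff] at hw ⊢
  exact MorphismProperty.of_retract r hw

/-- The class of weak equivalences is saturated. -/
lemma isIso_hoQ_map_iff {X Y : C} (f : X ⟶ Y) :
    IsIso ((hoQ C).map f) ↔ WeakEquivalence f := by
  refine ⟨fun hf => ?_, fun hf => inferInstance⟩
  -- Replace f by a fibration between bifibrant objects: lift p ≫ f ≫ i through the trivial
  -- fibration q, and factor the lift as a trivial cofibration followed by the fibration h.p.
  obtain ⟨X', _, p, _, _⟩ := CofibrantObject.HoCat.exists_resolution X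
  obtain ⟨Y₁, _, i, _, _⟩ := FibrantObject.HoCat.exists_resolution Y
  obtain ⟨Y₂, _, q, _, _⟩ := CofibrantObject.HoCat.exists_resolution Y₁
  have : IsFibrant Y₂ := isFibrant_of_fibration q
  have sq : CommSq (initial.to Y₂) (initial.to X') q (p ≫ f ≫ i) := ⟨by simp⟩
  let h := MorphismProperty.factorizationData (trivialCofibrations C) (fibrations C) sq.lift
  have : IsCofibrant h.Z := isCofibrant_of_cofibration h.i
  have : IsFibrant h.Z := isFibrant_of_fibration h.p
  have e : h.i ≫ h.p ≫ q = p ≫ f ≫ i := by rw [h.fac_assoc, sq.fac_right]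
  have h1 : IsIso ((hoQ C).map h.p) := by
    have e' := congrArg (hoQ C).map e
    simp only [Functor.map_comp] at e'
    have h2 : (hoQ C).map h.p = inv ((hoQ C).map h.i) ≫ (hoQ C).map p ≫ (hoQ C).map f ≫
        (hoQ C).map i ≫ inv ((hoQ C).map q) := by
      rw [← reassoc_of% e']
      simp
    rw [h2]
    infer_instance
  have := weakEquivalence_of_isIso_aux h.p h1
  have h3 : WeakEquivalence (p ≫ f ≫ i) := by
    rw [← e]
    infer_instance
  rwa [weakEquivalence_precomp_iff, weakEquivalence_postcomp_iff] at h3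

/-- Maps in the homotopy category from a cofibrant to a fibrant object come from the model category,
and every object is isomorphic to one of either kind. -/
lemma exists_hoQ_map_iso {A B : Ho C} (φ : A ⟶ B) : ∃ (X Y : C) (f : X ⟶ Y)
    (_ : IsCofibrant X) (_ : IsFibrant Y) (a : A ≅ (hoQ C).obj X) (b : B ≅ (hoQ C).obj Y),
    φ = a.hom ≫ (hoQ C).map f ≫ b.inv := by
  have := Localization.essSurj (hoQ C) (weakEquivalences C)
  obtain ⟨X, hX, p, _, _⟩ := CofibrantObject.HoCat.exists_resolution ((hoQ C).objPreimage A)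
  obtain ⟨Y, hY, i, _, _⟩ := FibrantObject.HoCat.exists_resolution ((hoQ C).objPreimage B)
  let a : A ≅ (hoQ C).obj X :=
    ((hoQ C).objObjPreimageIso A).symm ≪≫ (asIso ((hoQ C).map p)).symm
  let b : B ≅ (hoQ C).obj Y := ((hoQ C).objObjPreimageIso B).symm ≪≫ asIso ((hoQ C).map i)
  obtain ⟨f, hf⟩ := map_surjective_of_isLocalization (hoQ C) X Y (a.inv ≫ φ ≫ b.hom)
  exact ⟨X, Y, f, hX, hY, a, b, by simp [hf]⟩

lemma exists_cofibrant_iso (A : Ho C) :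
    ∃ (X : C) (_ : IsCofibrant X), Nonempty ((hoQ C).obj X ≅ A) := by
  obtain ⟨X, -, -, hX, -, a, -⟩ := exists_hoQ_map_iso (𝟙 A)
  exact ⟨X, hX, ⟨a.symm⟩⟩

lemma reflectsIsomorphisms_hoMap {D : Type u₁} [Category.{v₁} D] [ModelCategory D] (F : C ⥤ D)
    [PreservesWE F]
    (h : ∀ {X Y : C} (f : X ⟶ Y), WeakEquivalence (F.map f) → WeakEquivalence f) :
    (hoMap F).ReflectsIsomorphisms where
  reflects {A B} φ hφ := by
    obtain ⟨X, Y, f, -, -, a, b, rfl⟩ := exists_hoQ_map_iso φ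
    have h1 : IsIso ((hoMap F).map ((hoQ C).map f)) := by
      have e : (hoMap F).map ((hoQ C).map f) = (hoMap F).map a.inv ≫
          (hoMap F).map (a.hom ≫ (hoQ C).map f ≫ b.inv) ≫ (hoMap F).map b.hom := by
        simp [← Functor.map_comp]
      rw [e]
      infer_instance
    have h2 : IsIso ((hoQ D).map (F.map f)) := by
      have e := (hoMapFac F).hom.naturality f
      dsimp at e
      rw [← Iso.app_hom, ← Iso.app_hom, ← Iso.inv_comp_eq] at e
      rw [← e]
      infer_instance
    have := h f ((isIso_hoQ_map_iff _).1 h2)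
    infer_instance

end Saturation

/-! ### Universal arrows and mates. -/

section Universal

variable {A : Type u₁} [Category.{v₁} A] {B : Type u₂} [Category.{v₂} B]

/-- The arrow `t` is universal from `F` to `w`. -/
def IsUniversal (F : A ⥤ B) {v : A} {w : B} (t : F.obj v ⟶ w) : Prop :=
  ∀ a : A, Function.Bijective (fun f : a ⟶ v => F.map f ≫ t)

lemma IsUniversal.comp_iso {F : A ⥤ B} {v : A} {w w' : B} {t : F.obj v ⟶ w}
    (ht : IsUniversal F t) (i : w ⟶ w') [IsIso i] : IsUniversal F (t ≫ i) := by
  intro a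
  have e : (fun f : a ⟶ v => F.map f ≫ t ≫ i) =
      (fun g => g ≫ i) ∘ (fun f : a ⟶ v => F.map f ≫ t) := by
    ext f
    simp
  rw [e]
  exact (((asIso i).homToEquiv).bijective).comp (ht a)

lemma isUniversal_comp_iso_iff {F : A ⥤ B} {v : A} {w w' : B} (t : F.obj v ⟶ w)
    (i : w ⟶ w') [IsIso i] : IsUniversal F (t ≫ i) ↔ IsUniversal F t :=
  ⟨fun h => by simpa using h.comp_iso (inv i), fun h => h.comp_iso i⟩

lemma IsUniversal.iso_comp {F : A ⥤ B} {v v' : A} {w : B} {t : F.obj v ⟶ w}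
    (ht : IsUniversal F t) (i : v' ⟶ v) [IsIso i] : IsUniversal F (F.map i ≫ t) := by
  intro a
  have e : (fun f : a ⟶ v' => F.map f ≫ F.map i ≫ t) =
      (fun f : a ⟶ v => F.map f ≫ t) ∘ (fun g => g ≫ i) := by
    ext f
    simp
  rw [e]
  exact (ht a).comp ((asIso i).homToEquiv).bijective

lemma isUniversal_iso_comp_iff {F : A ⥤ B} {v v' : A} {w : B} (t : F.obj v ⟶ w)
    (i : v' ⟶ v) [IsIso i] : IsUniversal F (F.map i ≫ t) ↔ IsUniversal F t :=
  ⟨fun h => by simpa [← Functor.map_comp_assoc] using h.iso_comp (inv i),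
    fun h => h.iso_comp i⟩

/-- Under the adjunction, f ↦ F.map f ≫ t becomes postcomposition with the transpose of t, so this
is the Yoneda lemma. -/
lemma isUniversal_iff_isIso_homEquiv {F : A ⥤ B} {G : B ⥤ A} (adj : F ⊣ G) {v : A} {w : B}
    (t : F.obj v ⟶ w) : IsUniversal F t ↔ IsIso (adj.homEquiv _ _ t) := by
  have e : ∀ (a : A) (f : a ⟶ v),
      F.map f ≫ t = (adj.homEquiv _ _).symm (f ≫ adj.homEquiv _ _ t) := by
    intro a f
    rw [Adjunction.homEquiv_naturality_left_symm, Equiv.symm_apply_apply]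
  constructor
  · intro h
    refine isIso_of_yoneda_map_bijective _ (fun a => ?_)
    have h1 := (adj.homEquiv a w).bijective.comp (h a)
    have h2 : (adj.homEquiv a w) ∘ (fun f : a ⟶ v => F.map f ≫ t) =
        fun f => f ≫ adj.homEquiv _ _ t := by
      ext f
      simp only [Function.comp_apply, e, Equiv.apply_symm_apply]
    rwa [h2] at h1
  · intro h a
    have h2 : (fun f : a ⟶ v => F.map f ≫ t) = (adj.homEquiv a w).symm ∘
        (fun f => f ≫ adj.homEquiv _ _ t) := by
      ext f
      simp only [Function.comp_apply, e]
    rw [h2]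
    exact (Equiv.bijective _).comp ((asIso (adj.homEquiv _ _ t)).homToEquiv).bijective

lemma isUniversal_map_counit_iff {F : A ⥤ B} {G : B ⥤ A} (adj : F ⊣ G) {v : A} {w : B}
    (i : v ⟶ G.obj w) : IsUniversal F (F.map i ≫ adj.counit.app w) ↔ IsIso i := by
  rw [isUniversal_iff_isIso_homEquiv adj,
    (adj.homEquiv_counit (X := v) (Y := w) (g := i)).symm]
  exact iff_of_eq (congrArg (fun j => IsIso j) ((adj.homEquiv v w).apply_symm_apply i))

/-- The value at `d` of a mate is invertible if and only if it takes universal arrows to universal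
arrows. -/
lemma isIso_mateEquiv_app_iff {A' : Type u₃} [Category.{v₃} A'] {B' : Type u₄}
    [Category.{v₄} B'] {G : A ⥤ A'} {H : B ⥤ B'} {L₁ : A ⥤ B} {R₁ : B ⥤ A} {L₂ : A' ⥤ B'}
    {R₂ : B' ⥤ A'} (adj₁ : L₁ ⊣ R₁) (adj₂ : L₂ ⊣ R₂) (α : TwoSquare G L₁ L₂ H) {c : A} {d : B}
    (t : L₁.obj c ⟶ d) (ht : IsUniversal L₁ t) :
    IsIso ((mateEquiv adj₁ adj₂ α).natTrans.app d) ↔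
      IsUniversal L₂ (α.natTrans.app c ≫ H.map t) := by
  -- Universality of t means that t is the counit at d up to the isomorphism i. Naturality of α
  -- trades t for the counit, where `mateEquiv_counit` gives the transpose of the mate.
  let i := adj₁.homEquiv _ _ t
  have : IsIso i := (isUniversal_iff_isIso_homEquiv adj₁ t).1 ht
  have e : L₁.map i ≫ adj₁.counit.app d = t :=
    (adj₁.homEquiv_counit (X := c) (Y := d) (g := i)).symm.trans
      ((adj₁.homEquiv _ _).symm_apply_apply t)
  have n := α.natTrans.naturality i
  dsimp at n
  have m := mateEquiv_counit adj₁ adj₂ α d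
  rw [← e, Functor.map_comp, ← reassoc_of% n, isUniversal_iso_comp_iff,
    ← isUniversal_map_counit_iff adj₂]
  exact iff_of_eq (congrArg _ m)

end Universal

/-! ### Universal arrows in homotopy categories and mates of derived functors. -/

section Derived

variable {C : Type u₁} [Category.{v₁} C] {D : Type u₂} [Category.{v₂} D]

section
variable [CategoryWithWeakEquivalences C] [CategoryWithWeakEquivalences D]

/-- The morphism in the homotopy category given by a morphism `F z ⟶ b`. -/
def hoArrow (F : C ⥤ D) [PreservesWE F] {z : C} {b : D} (g : F.obj z ⟶ b) :
    (hoMap F).obj ((hoQ C).obj z) ⟶ (hoQ D).obj b :=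
  (hoMapFac F).hom.app z ≫ (hoQ D).map g

lemma hoMapFac_naturality (F : C ⥤ D) [PreservesWE F] {X Y : C} (f : X ⟶ Y) :
    (hoMap F).map ((hoQ C).map f) ≫ (hoMapFac F).hom.app Y =
      (hoMapFac F).hom.app X ≫ (hoQ D).map (F.map f) :=
  (hoMapFac F).hom.naturality f

lemma hoMapFac_naturality_assoc (F : C ⥤ D) [PreservesWE F] {X Y : C} (f : X ⟶ Y) {Z : Ho D}
    (h : (hoQ D).obj (F.obj Y) ⟶ Z) :
    (hoMap F).map ((hoQ C).map f) ≫ (hoMapFac F).hom.app Y ≫ h =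
      (hoMapFac F).hom.app X ≫ (hoQ D).map (F.map f) ≫ h := by
  have e := hoMapFac_naturality F f
  rw [reassoc_of% e]

lemma hoArrow_comp (F : C ⥤ D) [PreservesWE F] {z : C} {b b' : D} (g : F.obj z ⟶ b)
    (w : b ⟶ b') : hoArrow F (g ≫ w) = hoArrow F g ≫ (hoQ D).map w := by
  simp [hoArrow]

lemma map_hoArrow (F : C ⥤ D) [PreservesWE F] {z z' : C} {b : D} (w : z' ⟶ z)
    (g : F.obj z ⟶ b) :
    hoArrow F (F.map w ≫ g) = (hoMap F).map ((hoQ C).map w) ≫ hoArrow F g := by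
  simp [hoArrow, hoMapFac_naturality_assoc]

end

variable [ModelCategory C] [ModelCategory D]

lemma isUniversal_hoArrow_comp_iff (F : C ⥤ D) [PreservesWE F] {z : C} {b b' : D}
    (g : F.obj z ⟶ b) (w : b ⟶ b') [WeakEquivalence w] :
    IsUniversal (hoMap F) (hoArrow F (g ≫ w)) ↔ IsUniversal (hoMap F) (hoArrow F g) := by
  rw [hoArrow_comp, isUniversal_comp_iso_iff]

lemma isUniversal_map_hoArrow_iff (F : C ⥤ D) [PreservesWE F] {z z' : C} {b : D}
    (g : F.obj z ⟶ b) (w : z' ⟶ z) [WeakEquivalence w] :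
    IsUniversal (hoMap F) (hoArrow F (F.map w ≫ g)) ↔
      IsUniversal (hoMap F) (hoArrow F g) := by
  rw [map_hoArrow, isUniversal_iso_comp_iff]

instance isIso_rightDerivedUnit (G : D ⥤ C) [RightDerivable G] (b : D) [hb : IsFibrant b] :
    IsIso ((rightDerivedUnit G).app b) :=
  (derives_of_rightDerivable G).isIso_of_isRightDerivedFunctor (rightDerivedUnit G)
    (FibrantObject.mk b)

/-- This characterizes the counit of the derived adjunction. The two instances in the proof are
those with which `derivedAdjunction` is built. -/
lemma map_rightDerivedUnit_counit {F : C ⥤ D} {G : D ⥤ C} (adj : F ⊣ G) [PreservesWE F]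
    [RightDerivable G] (b : D) : (hoMap F).map ((rightDerivedUnit G).app b) ≫
        (derivedAdjunction adj).counit.app ((hoQ D).obj b) =
          (hoMapFac F).hom.app (G.obj b) ≫ (hoQ D).map (adj.counit.app b) := by
  have h1 : (hoMap F).IsLeftDerivedFunctor (hoMapFac F).hom (weakEquivalences C) :=
    Functor.isLeftDerivedFunctor_of_inverts _ _ _
  have h3 : (rightDerived G ⋙ hoMap F).IsRightDerivedFunctor
      (Functor.whiskerRight (rightDerivedUnit G) (hoMap F) ≫ (Functor.associator _ _ _).hom)
      (weakEquivalences D) := by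
    have hd : (FibrantObject.localizerMorphism D).Derives ((G ⋙ hoQ C) ⋙ hoMap F) := by
      intro X Y f hf
      have := derives_of_rightDerivable G f hf
      dsimp at this ⊢
      infer_instance
    refine hd.isRightDerivedFunctor_of_isIso _ (fun X => ?_)
    have := (derives_of_rightDerivable G).isIso_of_isRightDerivedFunctor (rightDerivedUnit G) X
    dsimp at this ⊢
    infer_instance
  exact adj.derivedε_fac_app (weakEquivalences D) (hoMapFac F).hom (rightDerivedUnit G) b

/-- At a fibrant b the derived right adjoint is G b, so the transpose in the homotopy category is
the image of the transpose of g up to an isomorphism. Saturation turns its invertibility into a weak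
equivalence. -/
lemma isUniversal_hoArrow_iff {F : C ⥤ D} {G : D ⥤ C} (adj : F ⊣ G) [PreservesWE F]
    [RightDerivable G] {z : C} {b : D} [IsFibrant b] (g : F.obj z ⟶ b) :
    IsUniversal (hoMap F) (hoArrow F g) ↔ WeakEquivalence (adj.homEquiv _ _ g) := by
  have e : hoArrow F g = (hoMap F).map ((hoQ C).map (adj.homEquiv _ _ g) ≫
      (rightDerivedUnit G).app b) ≫ (derivedAdjunction adj).counit.app ((hoQ D).obj b) := by
    have h : F.map (adj.homEquiv _ _ g) ≫ adj.counit.app b = g :=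
      (adj.homEquiv_counit (X := z) (Y := b) (g := adj.homEquiv _ _ g)).symm.trans
        ((adj.homEquiv _ _).symm_apply_apply g)
    rw [Functor.map_comp, Category.assoc, map_rightDerivedUnit_counit, hoMapFac_naturality_assoc,
      ← Functor.map_comp, h]
    rfl
  rw [e, isUniversal_map_counit_iff, isIso_comp_right_iff, isIso_hoQ_map_iff]

/-- A cofibrant replacement of G b does it. -/
lemma exists_isUniversal_hoArrow {F : C ⥤ D} {G : D ⥤ C} (adj : F ⊣ G) [PreservesWE F]
    [RightDerivable G] (b : D) [IsFibrant b] : ∃ (z : C) (_ : IsCofibrant z) (g : F.obj z ⟶ b),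
      IsUniversal (hoMap F) (hoArrow F g) := by
  obtain ⟨z, hz, p, _, hp⟩ := CofibrantObject.HoCat.exists_resolution (G.obj b)
  refine ⟨z, hz, (adj.homEquiv _ _).symm p, ?_⟩
  rw [isUniversal_hoArrow_iff adj, Equiv.apply_symm_apply]
  exact hp

/-- This allows left derived functors to be computed at modules that are not cofibrant themselves
but have cofibrant underlying objects. -/
lemma isIso_leftDerivedCounit_of_weakEquivalence (F : C ⥤ D) [LeftDerivable F] {N' N : C}
    [IsCofibrant N'] (p : N' ⟶ N) [WeakEquivalence p] (hp : WeakEquivalence (F.map p)) :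
    IsIso ((leftDerivedCounit F).app N) := by
  have h := isIso_app_of_isLeftDerivedFunctor (invertsCofibrant_of_leftDerivable F)
    (leftDerived F) (leftDerivedCounit F) N' inferInstance
  have n := (leftDerivedCounit F).naturality p
  dsimp at n
  have e : (leftDerivedCounit F).app N = inv ((leftDerived F).map ((hoQ C).map p)) ≫
      (leftDerivedCounit F).app N' ≫ (hoQ D).map (F.map p) := by
    rw [← n, IsIso.inv_hom_id_assoc]
  rw [e]
  infer_instance

instance isIso_leftDerivedCounit (F : C ⥤ D) [LeftDerivable F] (N : C) [IsCofibrant N] :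
    IsIso ((leftDerivedCounit F).app N) :=
  isIso_app_of_isLeftDerivedFunctor (invertsCofibrant_of_leftDerivable F)
    (leftDerived F) (leftDerivedCounit F) N inferInstance

variable {C' : Type u₃} [Category.{v₃} C'] {D' : Type u₄} [Category.{v₄} D']
  [ModelCategory C'] [ModelCategory D']

section

variable (F : C ⥤ D) (F' : C' ⥤ D') (E : C ⥤ C') (E' : D ⥤ D')
    [LeftDerivable F] [LeftDerivable F'] [PreservesWE E] [hE : PreservesCofibrant E]
    [PreservesWE E'] (e : E ⋙ F' ≅ F ⋙ E')

lemma leftDerivedCommIso_hom_app (X : C) :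
    (leftDerivedCommIso F F' E E' e).hom.app ((hoQ C).obj X) ≫
        (hoMap E').map ((leftDerivedCounit F).app X) ≫ (hoMapFac E').hom.app (F.obj X) =
      (leftDerived F').map ((hoMapFac E).hom.app X) ≫ (leftDerivedCounit F').app (E.obj X) ≫
        (hoQ D').map (e.hom.app X) := by
  let α : hoQ C ⋙ hoMap E ⋙ leftDerived F' ⟶ (E ⋙ F') ⋙ hoQ D' :=
    Functor.whiskerRight (hoMapFac E).hom (leftDerived F') ≫
      Functor.whiskerLeft E (leftDerivedCounit F')
  let β : hoQ C ⋙ leftDerived F ⋙ hoMap E' ⟶ (F ⋙ E') ⋙ hoQ D' :=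
    Functor.whiskerRight (leftDerivedCounit F) (hoMap E') ≫
      Functor.whiskerLeft F (hoMapFac E').hom
  have hα : (hoMap E ⋙ leftDerived F').IsLeftDerivedFunctor α (weakEquivalences C) :=
    isLeftDerivedFunctor_of_isIso _ _ (fun X hX => by
      have := hE.isCofibrant X hX
      dsimp [α]
      infer_instance)
  have hβ : (leftDerived F ⋙ hoMap E').IsLeftDerivedFunctor β (weakEquivalences C) :=
    isLeftDerivedFunctor_of_isIso _ _ (fun X hX => by
      dsimp [β]
      infer_instance)
  have h := Functor.leftDerivedNatTrans_app _ _ α β (weakEquivalences C)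
    (Functor.isoWhiskerRight e (hoQ D')).hom X
  simp only [α, β, NatTrans.comp_app, Functor.whiskerRight_app, Functor.whiskerLeft_app,
    Category.assoc] at h
  exact h

lemma leftDerivedCommIso_inv_app {X : C} {b : C'} (g : E.obj X ⟶ b) :
    (leftDerivedCommIso F F' E E' e).inv.app ((hoQ C).obj X) ≫
        (leftDerived F').map (hoArrow E g) ≫ (leftDerivedCounit F').app b =
      (hoMap E').map ((leftDerivedCounit F).app X) ≫
        hoArrow E' (e.inv.app X ≫ F'.map g) := by
  have h := leftDerivedCommIso_hom_app F F' E E' e X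
  rw [← cancel_epi ((leftDerivedCommIso F F' E E' e).hom.app ((hoQ C).obj X)),
    Iso.hom_inv_id_app_assoc, hoArrow, hoArrow, reassoc_of% h]
  have n := (leftDerivedCounit F').naturality g
  dsimp at n
  rw [(leftDerived F').map_comp, (hoQ D').map_comp, Category.assoc, n,
    ← (hoQ D').map_comp_assoc, Iso.hom_inv_id_app]
  simp

/-- A criterion for the mate of `leftDerivedCommIso` to be invertible. -/
lemma isIso_mate_leftDerivedCommIso_iff {G : C' ⥤ C} {G' : D' ⥤ D} (adj : E ⊣ G)
    (adj' : E' ⊣ G') [RightDerivable G] [RightDerivable G'] {z : C} {b : C'} (g : E.obj z ⟶ b)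
    (hg : IsUniversal (hoMap E) (hoArrow E g)) (hz : IsIso ((leftDerivedCounit F).app z))
    (hb : IsIso ((leftDerivedCounit F').app b)) :
    IsIso ((mateEquiv (derivedAdjunction adj) (derivedAdjunction adj')
      (TwoSquare.mk _ _ _ _ (leftDerivedCommIso F F' E E' e).inv)).natTrans.app
        ((hoQ C').obj b)) ↔
      IsUniversal (hoMap E') (hoArrow E' (e.inv.app z ≫ F'.map g)) := by
  rw [isIso_mateEquiv_app_iff _ _ _ _ hg,
    ← isUniversal_comp_iso_iff _ ((leftDerivedCounit F').app b), Category.assoc]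
  refine (iff_of_eq (congrArg (IsUniversal (hoMap E'))
    (leftDerivedCommIso_inv_app F F' E E' e g))).trans ?_
  exact isUniversal_iso_comp_iff _ _

end

/-- Universality of arrows in homotopy categories is detected by functors that preserve
universality before passing to homotopy categories. -/
lemma isUniversal_hoArrow_iff_map {E : C ⥤ D} {G : D ⥤ C} (adj : E ⊣ G) {E' : C' ⥤ D'}
    {G' : D' ⥤ C'} (adj' : E' ⊣ G') [PreservesWE E] [RightDerivable G] [PreservesWE E']
    [RightDerivable G'] (V₀ : C ⥤ C') (V : D ⥤ D') (e : V₀ ⋙ E' ⟶ E ⋙ V) {z : C} {b : D}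
    [IsFibrant b] [IsFibrant (V.obj b)] (g : E.obj z ⟶ b)
    (hV : ∀ {X Y : C} (f : X ⟶ Y), WeakEquivalence (V₀.map f) ↔ WeakEquivalence f)
    (hb : IsUniversal E' (e.app (G.obj b) ≫ V.map (adj.counit.app b))) :
    IsUniversal (hoMap E) (hoArrow E g) ↔
      IsUniversal (hoMap E') (hoArrow E' (e.app z ≫ V.map g)) := by
  rw [isUniversal_hoArrow_iff adj, isUniversal_hoArrow_iff adj', ← hV]
  have h : E.map (adj.homEquiv _ _ g) ≫ adj.counit.app b = g :=
    (adj.homEquiv_counit (X := z) (Y := b) (g := adj.homEquiv _ _ g)).symm.trans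
      ((adj.homEquiv _ _).symm_apply_apply g)
  have h1 := (isUniversal_iff_isIso_homEquiv adj' _).1 hb
  -- The transpose of V g is V₀ of the transpose of g, followed by the isomorphism V₀ G b ≅ G' V b
  -- that hb provides.
  have h2 : adj'.homEquiv _ _ (e.app z ≫ V.map g) = V₀.map (adj.homEquiv _ _ g) ≫
      adj'.homEquiv _ _ (e.app (G.obj b) ≫ V.map (adj.counit.app b)) := by
    rw [← adj'.homEquiv_naturality_left]
    congr 1
    conv_lhs => rw [← h]
    have n := e.naturality (adj.homEquiv _ _ g)
    dsimp at n
    rw [reassoc_of% n, V.map_comp]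
  rw [h2, weakEquivalence_postcomp_iff]

end Derived

/-! ### The structure theorem for Hopf modules. -/

section HopfModules

open MonObj ComonObj HopfObj

variable {T : Type u} [Category.{v} T] [MonoidalCategory T]

/-- In elements, the diagonal action satisfies h(1 ⊗ n) = h₁ ⊗ h₂ n. -/
lemma whisker_eta_diag [SymmetricCategory T] {H N : T} [BimonObj H] (a : H ⊗ N ⟶ N) :
    H ◁ ((λ_ N).inv ≫ η[H] ▷ N) ≫ Δ[H] ▷ (H ⊗ N) ≫ tensorμ H H H N ≫ (μ[H] ⊗ₘ a) =
      Δ[H] ▷ N ≫ (α_ H H N).hom ≫ H ◁ a := by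
  have h1 : H ◁ (η[H] ▷ N) ≫ Δ[H] ▷ (H ⊗ N) ≫ tensorμ H H H N ≫ (μ[H] ⊗ₘ a) =
      Δ[H] ▷ (𝟙_ T ⊗ N) ≫ tensorμ H H (𝟙_ T) N ≫ ((H ◁ η[H] ≫ μ[H]) ⊗ₘ a) := by
    have h := tensorμ_natural_right (Z₁ := H) (Z₂ := H) η[H] (𝟙 N)
    simp only [tensorHom_id, whiskerLeft_id, tensorHom_id] at h
    rw [whisker_exchange_assoc, reassoc_of% h]
    simp only [MonoidalCategory.tensorHom_def, comp_whiskerRight, Category.assoc]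
  have h2 : H ◁ (λ_ N).inv ≫ Δ[H] ▷ (𝟙_ T ⊗ N) ≫ tensorμ H H (𝟙_ T) N ≫
      ((ρ_ H).hom ⊗ₘ a) = Δ[H] ▷ N ≫ (α_ H H N).hom ≫ H ◁ a := by
    rw [whisker_exchange_assoc]
    congr 1
    simp only [tensorμ, MonoidalCategory.tensorHom_def, braiding_tensorUnit_right]
    monoidal
  rw [MonoidalCategory.whiskerLeft_comp, Category.assoc, h1, MonObj.mul_one, h2]

variable {H : T}

section
variable [MonObj H] [ComonObj H] {N : T} (S : H ⟶ H) (a : H ⊗ N ⟶ N) (r : N ⟶ H ⊗ N)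

/-- The coaction followed by the antipode and the action. -/
def antipodeProj : N ⟶ N := r ≫ S ▷ N ≫ a

variable (c1 : r ≫ ε[H] ▷ N = (λ_ N).inv) (c2 : r ≫ H ◁ r = r ≫ Δ[H] ▷ N ≫ (α_ H H N).hom)
include c1 c2

/-- The passage from F to n ↦ n₋₁ F(n₀) can be undone: S(n₋₁) n₀₋₁ F(n₀₀) = F(n), by coassociativity
and S(h₁) h₂ = ε(h). -/
lemma antipode_coact_cancel (hS : Δ[H] ≫ S ▷ H ≫ μ[H] = ε[H] ≫ η[H]) {Z : T} (b : H ⊗ Z ⟶ Z)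
    (hb : η[H] ▷ Z ≫ b = (λ_ Z).hom)
    (hb' : μ[H] ▷ Z ≫ b = (α_ H H Z).hom ≫ H ◁ b ≫ b) (F : N ⟶ Z) :
    r ≫ S ▷ N ≫ H ◁ (r ≫ H ◁ F ≫ b) ≫ b = F := by
  have e1 : r ≫ S ▷ N ≫ H ◁ (r ≫ H ◁ F ≫ b) ≫ b =
      (r ≫ H ◁ r) ≫ (α_ H H N).inv ≫ S ▷ H ▷ N ≫ (H ⊗ H) ◁ F ≫ (α_ H H Z).hom ≫
        H ◁ b ≫ b := by
    simp only [MonoidalCategory.whiskerLeft_comp, Category.assoc]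
    rw [← whisker_exchange_assoc]
    simp
  rw [e1, c2, ← hb']
  have e2 : (r ≫ Δ[H] ▷ N ≫ (α_ H H N).hom) ≫ (α_ H H N).inv ≫ S ▷ H ▷ N ≫ (H ⊗ H) ◁ F ≫
      μ[H] ▷ Z ≫ b = r ≫ (Δ[H] ≫ S ▷ H ≫ μ[H]) ▷ N ≫ H ◁ F ≫ b := by
    rw [whisker_exchange_assoc]
    simp
  rw [e2, hS, comp_whiskerRight, Category.assoc, reassoc_of% c1, ← whisker_exchange_assoc, hb]
  simp

/-- Identities with antipodes are proved below by this cancellation: after passing to n ↦ n₋₁ F(n₀)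
the antipodes disappear. -/
lemma coact_cancel (hS : Δ[H] ≫ S ▷ H ≫ μ[H] = ε[H] ≫ η[H]) {Z : T} (b : H ⊗ Z ⟶ Z)
    (hb : η[H] ▷ Z ≫ b = (λ_ Z).hom)
    (hb' : μ[H] ▷ Z ≫ b = (α_ H H Z).hom ≫ H ◁ b ≫ b) {F F' : N ⟶ Z}
    (h : r ≫ H ◁ F ≫ b = r ≫ H ◁ F' ≫ b) : F = F' := by
  rw [← antipode_coact_cancel S r c1 c2 hS b hb hb' F, h,
    antipode_coact_cancel S r c1 c2 hS b hb hb' F']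

variable (a1 : η[H] ▷ N ≫ a = (λ_ N).hom) (a2 : μ[H] ▷ N ≫ a = (α_ H H N).hom ≫ H ◁ a ≫ a)
include a1 a2

/-- In elements, n₋₁ S(n₀₋₁) n₀₀ = n, from h₁ S(h₂) = ε(h). So N is generated by the image of the
projection. -/
lemma coact_antipodeProj (hS : Δ[H] ≫ H ◁ S ≫ μ[H] = ε[H] ≫ η[H]) :
    r ≫ H ◁ antipodeProj S a r ≫ a = 𝟙 N := by
  have e1 : r ≫ H ◁ antipodeProj S a r ≫ a =
      (r ≫ H ◁ r) ≫ (α_ H H N).inv ≫ (H ◁ S) ▷ N ≫ (α_ H H N).hom ≫ H ◁ a ≫ a := by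
    simp [antipodeProj]
  rw [e1, c2, ← a2]
  have e2 : (r ≫ Δ[H] ▷ N ≫ (α_ H H N).hom) ≫ (α_ H H N).inv ≫ (H ◁ S) ▷ N ≫
      μ[H] ▷ N ≫ a = r ≫ (Δ[H] ≫ H ◁ S ≫ μ[H]) ▷ N ≫ a := by
    simp
  rw [e2, hS, comp_whiskerRight, Category.assoc, reassoc_of% c1, a1]
  simp

end

variable [SymmetricCategory T] [HopfObj H] {N : T} (a : H ⊗ N ⟶ N) (r : N ⟶ H ⊗ N)
  (c1 : r ≫ ε[H] ▷ N = (λ_ N).inv) (c2 : r ≫ H ◁ r = r ≫ Δ[H] ▷ N ≫ (α_ H H N).hom)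
  (a1 : η[H] ▷ N ≫ a = (λ_ N).hom) (a2 : μ[H] ▷ N ≫ a = (α_ H H N).hom ≫ H ◁ a ≫ a)
  (hc : a ≫ r = H ◁ r ≫ Δ[H] ▷ (H ⊗ N) ≫ tensorμ H H H N ≫ (μ[H] ⊗ₘ a))
include c1 c2 a1 a2 hc

/-- The image of the projection P consists of coinvariants. By `coact_cancel` it is enough to
compare after n ↦ n₋₁ F(n₀). There the compatibility hc turns one side into the coaction of n₋₁
P(n₀) = n, and the other side is n₋₁ ⊗ n₀₋₁ P(n₀₀) = n₋₁ ⊗ n₀. -/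
lemma antipodeProj_coact :
    antipodeProj 𝒮[H] a r ≫ r = ((λ_ N).inv ≫ η[H] ▷ N) ≫ H ◁ antipodeProj 𝒮[H] a r := by
  have F1 := coact_antipodeProj 𝒮[H] a r c1 c2 a1 a2 (HopfObj.antipode_right H)
  refine coact_cancel 𝒮[H] r c1 c2 (HopfObj.antipode_left H)
    (Δ[H] ▷ (H ⊗ N) ≫ tensorμ H H H N ≫ (μ[H] ⊗ₘ a))
    (diag_one μ[H] a (MonObj.one_mul H) a1) (diag_assoc μ[H] a (MonObj.mul_assoc H) a2) ?_
  rw [MonoidalCategory.whiskerLeft_comp, Category.assoc, ← hc, reassoc_of% F1]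
  have e : ((λ_ N).inv ≫ η[H] ▷ N) ≫ H ◁ antipodeProj 𝒮[H] a r =
      antipodeProj 𝒮[H] a r ≫ ((λ_ N).inv ≫ η[H] ▷ N) := by
    rw [Category.assoc, ← whisker_exchange]
    simp
  rw [e, MonoidalCategory.whiskerLeft_comp, Category.assoc, whisker_eta_diag]
  have e2 : r ≫ H ◁ antipodeProj 𝒮[H] a r ≫ Δ[H] ▷ N ≫ (α_ H H N).hom ≫ H ◁ a =
      (r ≫ Δ[H] ▷ N ≫ (α_ H H N).hom) ≫ H ◁ H ◁ antipodeProj 𝒮[H] a r ≫ H ◁ a := by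
    rw [whisker_exchange_assoc]
    simp
  rw [e2, ← c2, Category.assoc, ← MonoidalCategory.whiskerLeft_comp,
    ← MonoidalCategory.whiskerLeft_comp, F1]
  simp

lemma act_antipodeProj_coact :
    H ◁ antipodeProj 𝒮[H] a r ≫ a ≫ r =
      H ◁ antipodeProj 𝒮[H] a r ≫ Δ[H] ▷ N ≫ (α_ H H N).hom ≫ H ◁ a := by
  have e : ((λ_ N).inv ≫ η[H] ▷ N) ≫ H ◁ antipodeProj 𝒮[H] a r =
      antipodeProj 𝒮[H] a r ≫ ((λ_ N).inv ≫ η[H] ▷ N) := by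
    rw [Category.assoc, ← whisker_exchange]
    simp
  rw [hc, ← MonoidalCategory.whiskerLeft_comp_assoc,
    antipodeProj_coact a r c1 c2 a1 a2 hc, e, MonoidalCategory.whiskerLeft_comp_assoc,
    whisker_eta_diag]

/-- Since P(n) is coinvariant, the coaction of h P(n) is h₁ ⊗ h₂ P(n). Hence P(h P(n)) = S(h₁) h₂
P(n) = ε(h) P(n). -/
lemma act_antipodeProj_antipodeProj :
    H ◁ antipodeProj 𝒮[H] a r ≫ a ≫ antipodeProj 𝒮[H] a r =
      H ◁ antipodeProj 𝒮[H] a r ≫ ε[H] ▷ N ≫ (λ_ N).hom := by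
  have h := act_antipodeProj_coact a r c1 c2 a1 a2 hc
  have e : H ◁ antipodeProj 𝒮[H] a r ≫ a ≫ antipodeProj 𝒮[H] a r =
      (H ◁ antipodeProj 𝒮[H] a r ≫ a ≫ r) ≫ 𝒮[H] ▷ N ≫ a := by
    simp only [Category.assoc]
    rfl
  rw [e, h]
  simp only [Category.assoc]
  rw [whisker_exchange_assoc 𝒮[H] a, ← associator_naturality_left_assoc, ← a2]
  simp only [← comp_whiskerRight_assoc]
  rw [HopfObj.antipode_left, comp_whiskerRight_assoc, a1]

/-- A Hopf module is free on the image of `antipodeProj`. -/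
lemma act_coact_antipodeProj :
    H ◁ antipodeProj 𝒮[H] a r ≫ a ≫ r ≫ H ◁ antipodeProj 𝒮[H] a r =
      H ◁ antipodeProj 𝒮[H] a r := by
  have h := act_antipodeProj_coact a r c1 c2 a1 a2 hc
  -- In elements, h P(n) is sent to h₁ ⊗ P(h₂ P(n)) = h₁ ⊗ ε(h₂) P(n) = h ⊗ P(n).
  rw [reassoc_of% h, whisker_exchange_assoc, associator_naturality_right_assoc]
  simp only [← MonoidalCategory.whiskerLeft_comp]
  rw [act_antipodeProj_antipodeProj a r c1 c2 a1 a2 hc]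
  simp only [MonoidalCategory.whiskerLeft_comp]
  rw [← associator_naturality_right_assoc, ← whisker_exchange_assoc,
    ← associator_naturality_middle_assoc, MonoidalCategory.triangle, ← comp_whiskerRight,
    ← comp_whiskerRight]
  simp

end HopfModules

/-! ### The action and the coaction on the dual of H. -/

section Duality

open MonObj ComonObj HopfObj

variable {T : Type u} [Category.{v} T] [MonoidalCategory T] {H E : T} [ExactPairing H E]

/-- The pairing `A ⊗ H ⟶ Z` that corresponds to a morphism `A ⟶ Z ⊗ E`, where `E` is dual to
`H`. -/
def dualPairing {A Z : T} (f : A ⟶ Z ⊗ E) : A ⊗ H ⟶ Z :=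
  f ▷ H ≫ (α_ Z E H).hom ≫ Z ◁ ε_ H E ≫ (ρ_ Z).hom

lemma dualPairing_bijective (A Z : T) :
    Function.Bijective (dualPairing (H := H) (E := E) : (A ⟶ Z ⊗ E) → (A ⊗ H ⟶ Z)) := by
  have e : (dualPairing (H := H) (E := E) : (A ⟶ Z ⊗ E) → (A ⊗ H ⟶ Z)) =
      (tensorRightHomEquiv A H E Z).symm := by
    ext f
    simp [dualPairing, tensorRightHomEquiv]
  rw [e]
  exact Equiv.bijective _

lemma dualPairing_comp_left {A A' Z : T} (g : A' ⟶ A) (f : A ⟶ Z ⊗ E) :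
    dualPairing (H := H) (g ≫ f) = g ▷ H ≫ dualPairing f := by
  simp [dualPairing]

lemma dualPairing_comp_right {A Z Z' : T} (f : A ⟶ Z ⊗ E) (g : Z ⟶ Z') :
    dualPairing (H := H) (f ≫ g ▷ E) = dualPairing f ≫ g := by
  simp only [dualPairing, comp_whiskerRight, Category.assoc]
  rw [associator_naturality_left_assoc, ← whisker_exchange_assoc, rightUnitor_naturality]

lemma dualPairing_whiskerLeft {A Z : T} (B : T) (g : A ⟶ Z ⊗ E) :
    dualPairing (H := H) (B ◁ g ≫ (α_ B Z E).inv) = (α_ B A H).hom ≫ B ◁ dualPairing g := by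
  simp [dualPairing]

lemma dualPairing_comp_whiskerLeft {A Z Z' : T} (f : A ⟶ Z ⊗ E) (g : E ⟶ Z' ⊗ E) :
    dualPairing (H := H) (f ≫ Z ◁ g ≫ (α_ Z Z' E).inv) =
      f ▷ H ≫ (α_ Z E H).hom ≫ Z ◁ dualPairing g := by
  rw [dualPairing_comp_left, dualPairing_whiskerLeft]

lemma dual_hom_ext {A : T} {f g : A ⟶ E} (h : f ▷ H ≫ ε_ H E = g ▷ H ≫ ε_ H E) : f = g := by
  rw [← cancel_mono (λ_ E).inv]
  apply (dualPairing_bijective (H := H) (E := E) A (𝟙_ T)).1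
  have e : ∀ f : A ⟶ E, dualPairing (H := H) (f ≫ (λ_ E).inv) = f ▷ H ≫ ε_ H E := by
    intro f
    simp [dualPairing, ← unitors_equal]
  rw [e, e, h]

lemma dual_hom_exists {A : T} (k : A ⊗ H ⟶ 𝟙_ T) : ∃ f : A ⟶ E, f ▷ H ≫ ε_ H E = k := by
  obtain ⟨f, rfl⟩ := (dualPairing_bijective (H := H) (E := E) A (𝟙_ T)).2 k
  exact ⟨f ≫ (λ_ E).hom, by simp [dualPairing, ← unitors_equal]⟩

variable (H E)

section
variable [MonObj H]

/-- The right action on the dual of a monoid, `(ξ h)(k) = ξ(h k)`. -/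
def dualAct : E ⊗ H ⟶ E := (dual_hom_exists ((α_ E H H).hom ≫ E ◁ μ[H] ≫ ε_ H E)).choose

lemma dualAct_eval : dualAct H E ▷ H ≫ ε_ H E = (α_ E H H).hom ≫ E ◁ μ[H] ≫ ε_ H E :=
  (dual_hom_exists ((α_ E H H).hom ≫ E ◁ μ[H] ≫ ε_ H E)).choose_spec

lemma dualAct_one : E ◁ η[H] ≫ dualAct H E = (ρ_ E).hom := by
  apply dual_hom_ext (H := H)
  rw [comp_whiskerRight_assoc, dualAct_eval, associator_naturality_middle_assoc,
    ← MonoidalCategory.whiskerLeft_comp_assoc, MonObj.one_mul]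
  simp

lemma dualAct_assoc : E ◁ μ[H] ≫ dualAct H E =
    (α_ E H H).inv ≫ dualAct H E ▷ H ≫ dualAct H E := by
  apply dual_hom_ext (H := H)
  simp only [comp_whiskerRight, Category.assoc]
  rw [dualAct_eval, associator_naturality_middle_assoc, associator_naturality_left_assoc,
    ← whisker_exchange_assoc, dualAct_eval, ← MonoidalCategory.whiskerLeft_comp_assoc,
    MonObj.mul_assoc]
  simp

end

section
variable [ComonObj H]

/-- The left coaction on the dual of a comonoid, `ξ₋₁ ξ₀(k) = ξ(k₁) k₂`. -/
def dualCoact : E ⟶ H ⊗ E :=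
  ((dualPairing_bijective E H).2 (E ◁ Δ[H] ≫ (α_ E H H).inv ≫ ε_ H E ▷ H ≫ (λ_ H).hom)).choose

lemma dualPairing_dualCoact : dualPairing (dualCoact H E) =
    E ◁ Δ[H] ≫ (α_ E H H).inv ≫ ε_ H E ▷ H ≫ (λ_ H).hom :=
  ((dualPairing_bijective E H).2
    (E ◁ Δ[H] ≫ (α_ E H H).inv ≫ ε_ H E ▷ H ≫ (λ_ H).hom)).choose_spec

/-- Pairing with k reduces this to ξ(k₁) ε(k₂) = ξ(k). -/
lemma dualCoact_counit : dualCoact H E ≫ ε[H] ▷ E = (λ_ E).inv := by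
  apply (dualPairing_bijective (H := H) (E := E) _ _).1
  rw [dualPairing_comp_right, dualPairing_dualCoact]
  have h : E ◁ Δ[H] ≫ (α_ E H H).inv ≫ ε_ H E ▷ H ≫ (λ_ H).hom ≫ ε[H] =
      E ◁ (Δ[H] ≫ H ◁ ε[H]) ≫ (α_ E H (𝟙_ T)).inv ≫ ε_ H E ▷ (𝟙_ T) ≫ (λ_ _).hom := by
    simp only [MonoidalCategory.whiskerLeft_comp, Category.assoc,
      associator_inv_naturality_right_assoc, whisker_exchange_assoc, leftUnitor_naturality]
  simp only [Category.assoc]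
  rw [h, ComonObj.comul_counit, dualPairing]
  simp [← unitors_equal]
  rw [unitors_equal, Iso.inv_hom_id, Category.comp_id]

/-- Paired with k, both sides become ξ(k₁) k₂ ⊗ k₃. -/
lemma dualCoact_coassoc : dualCoact H E ≫ H ◁ dualCoact H E =
    dualCoact H E ≫ Δ[H] ▷ E ≫ (α_ H H E).hom := by
  rw [← cancel_mono (α_ H H E).inv]
  apply (dualPairing_bijective (H := H) (E := E) _ _).1
  simp only [Category.assoc, Iso.hom_inv_id, Category.comp_id]
  rw [dualPairing_comp_whiskerLeft, dualPairing_comp_right, dualPairing_dualCoact]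
  have h : dualCoact H E ▷ H ≫ (α_ H E H).hom ≫
      H ◁ (E ◁ Δ[H] ≫ (α_ E H H).inv ≫ ε_ H E ▷ H ≫ (λ_ H).hom) =
      E ◁ Δ[H] ≫ (α_ E H H).inv ≫ dualPairing (dualCoact H E) ▷ H := by
    simp only [dualPairing, comp_whiskerRight]
    rw [← associator_inv_naturality_left_assoc, whisker_exchange_assoc]
    simp
  rw [h, dualPairing_dualCoact]
  have h2 : E ◁ Δ[H] ≫ (α_ E H H).inv ≫
      (E ◁ Δ[H] ≫ (α_ E H H).inv ≫ ε_ H E ▷ H ≫ (λ_ H).hom) ▷ H =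
      E ◁ (Δ[H] ≫ Δ[H] ▷ H ≫ (α_ H H H).hom) ≫ (α_ E H (H ⊗ H)).inv ≫
        ε_ H E ▷ (H ⊗ H) ≫ (λ_ _).hom := by
    simp
  rw [h2, ← ComonObj.comul_assoc]
  simp only [MonoidalCategory.whiskerLeft_comp, Category.assoc]
  rw [← leftUnitor_naturality, ← whisker_exchange_assoc]
  simp

end

end Duality

/-! ### Invertibility of the antipode of a dualizable Hopf monoid. -/

section Antipode

open MonObj ComonObj HopfObj

variable {T : Type u} [Category.{v} T] [MonoidalCategory T] [SymmetricCategory T]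

section
variable (H : T)

/-- `h ⊗ (x ⊗ y) ↦ h x ⊗ y`. -/
def actFst [MonObj H] : H ⊗ (H ⊗ H) ⟶ H ⊗ H := (α_ H H H).inv ≫ μ[H] ▷ H

/-- `h ⊗ (x ⊗ y) ↦ x ⊗ h y`. -/
def actSnd [MonObj H] : H ⊗ (H ⊗ H) ⟶ H ⊗ H :=
  (α_ H H H).inv ≫ (β_ H H).hom ▷ H ≫ (α_ H H H).hom ≫ H ◁ μ[H]

/-- `h ⊗ (x ⊗ y) ↦ h₁ x ⊗ h₂ y`. -/
def actDiag [BimonObj H] : H ⊗ (H ⊗ H) ⟶ H ⊗ H :=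
  Δ[H] ▷ (H ⊗ H) ≫ tensorμ H H H H ≫ (μ[H] ⊗ₘ μ[H])

lemma actDiag_eq [BimonObj H] : actDiag H =
    Δ[H] ▷ (H ⊗ H) ≫ (α_ H H (H ⊗ H)).hom ≫ H ◁ actSnd H ≫ actFst H := by
  simp only [actDiag, actSnd, actFst, tensorμ, MonoidalCategory.tensorHom_def',
    MonoidalCategory.whiskerLeft_comp, Category.assoc]
  monoidal

variable [HopfObj H]

/-- `h₁ ·₂ (S(h₂) z) = S(h) ·₁ z`. -/
lemma comul_antipode_actDiag_actSnd :
    Δ[H] ▷ (H ⊗ H) ≫ (α_ H H (H ⊗ H)).hom ≫ H ◁ (𝒮[H] ▷ (H ⊗ H) ≫ actDiag H) ≫ actSnd H =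
      𝒮[H] ▷ (H ⊗ H) ≫ actFst H := by
  have c1 : (Δ[H] ▷ (H ⊗ H) ≫ (α_ H H (H ⊗ H)).hom) ≫ ε[H] ▷ (H ⊗ (H ⊗ H)) =
      (λ_ (H ⊗ (H ⊗ H))).inv := by
    rw [Category.assoc, ← associator_naturality_left, ← comp_whiskerRight_assoc,
      ComonObj.counit_comul]
    monoidal
  have c2 : (Δ[H] ▷ (H ⊗ H) ≫ (α_ H H (H ⊗ H)).hom) ≫
      H ◁ (Δ[H] ▷ (H ⊗ H) ≫ (α_ H H (H ⊗ H)).hom) =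
      (Δ[H] ▷ (H ⊗ H) ≫ (α_ H H (H ⊗ H)).hom) ≫ Δ[H] ▷ (H ⊗ (H ⊗ H)) ≫
        (α_ H H (H ⊗ (H ⊗ H))).hom := by
    have h := congrArg (fun z => z ▷ (H ⊗ H)) (ComonObj.comul_assoc H)
    simp only [comp_whiskerRight] at h
    simp only [MonoidalCategory.whiskerLeft_comp, Category.assoc]
    rw [← associator_naturality_left_assoc, ← associator_naturality_middle_assoc, reassoc_of% h]
    monoidal
  -- Evaluate both sides at h₂ and let h₁ act on the first factor. Each becomes ε(h) z: by
  -- `actDiag_eq` the diagonal action is h₁ ·₁ (h₂ ·₂ z), and h₁ S(h₂) = ε(h) in any action.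
  refine coact_cancel 𝒮[H] _ c1 c2 (HopfObj.antipode_left H) (actFst H)
    (free_left_one H H) (free_left_assoc H H) ?_
  have d1 := diag_one μ[H] μ[H] (MonObj.one_mul H) (MonObj.one_mul H)
  have d2 := diag_assoc μ[H] μ[H] (MonObj.mul_assoc H) (MonObj.mul_assoc H)
  have f1 : η[H] ▷ (H ⊗ H) ≫ actFst H = _ := free_left_one H H
  have f2 : μ[H] ▷ (H ⊗ H) ≫ actFst H = _ ≫ H ◁ actFst H ≫ actFst H := free_left_assoc H H
  change η[H] ▷ (H ⊗ H) ≫ actDiag H = _ at d1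
  change μ[H] ▷ (H ⊗ H) ≫ actDiag H = _ ≫ H ◁ actDiag H ≫ actDiag H at d2
  have gen : ∀ a : H ⊗ (H ⊗ H) ⟶ H ⊗ H, η[H] ▷ (H ⊗ H) ≫ a = (λ_ _).hom →
      μ[H] ▷ (H ⊗ H) ≫ a = (α_ _ _ _).hom ≫ H ◁ a ≫ a →
      Δ[H] ▷ (H ⊗ H) ≫ (α_ H H (H ⊗ H)).hom ≫ H ◁ (𝒮[H] ▷ (H ⊗ H) ≫ a) ≫ a =
        ε[H] ▷ (H ⊗ H) ≫ (λ_ _).hom := by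
    intro a a1 a2
    rw [MonoidalCategory.whiskerLeft_comp, Category.assoc, ← associator_naturality_middle_assoc,
      ← a2, ← comp_whiskerRight_assoc, ← comp_whiskerRight_assoc, Category.assoc,
      HopfObj.antipode_right,
      comp_whiskerRight_assoc, a1]
  have e1 : (Δ[H] ▷ (H ⊗ H) ≫ (α_ H H (H ⊗ H)).hom) ≫ H ◁ (Δ[H] ▷ (H ⊗ H) ≫
      (α_ H H (H ⊗ H)).hom ≫ H ◁ (𝒮[H] ▷ (H ⊗ H) ≫ actDiag H) ≫ actSnd H) ≫ actFst H =
      Δ[H] ▷ (H ⊗ H) ≫ (α_ H H (H ⊗ H)).hom ≫ H ◁ (𝒮[H] ▷ (H ⊗ H) ≫ actDiag H) ≫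
        actDiag H := by
    have c2' := c2
    simp only [MonoidalCategory.whiskerLeft_comp, Category.assoc] at c2'
    generalize 𝒮[H] ▷ (H ⊗ H) ≫ actDiag H = z
    rw [actDiag_eq]
    simp only [MonoidalCategory.whiskerLeft_comp, Category.assoc]
    rw [reassoc_of% c2', whisker_exchange_assoc, associator_naturality_right_assoc]
  have e2 := gen (actFst H) f1 f2
  rw [e1, gen _ d1 d2, Category.assoc, e2]

/-- `(S(h₂) k)₁ ⊗ h₁ (S(h₂) k)₂ = S(h) k₁ ⊗ k₂`. -/
lemma comul_antipode_mul_comul :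
    Δ[H] ▷ H ≫ (α_ H H H).hom ≫ H ◁ (𝒮[H] ▷ H ≫ μ[H] ≫ Δ[H]) ≫ actSnd H =
      H ◁ Δ[H] ≫ (α_ H H H).inv ≫ (𝒮[H] ▷ H ≫ μ[H]) ▷ H := by
  have h := comul_antipode_actDiag_actSnd H
  have e : μ[H] ≫ Δ[H] = H ◁ Δ[H] ≫ actDiag H := by
    rw [BimonObj.mul_comul, MonoidalCategory.tensorHom_def', Category.assoc]
    rfl
  rw [e, ← whisker_exchange_assoc, MonoidalCategory.whiskerLeft_comp, Category.assoc,
    ← associator_naturality_right_assoc, ← whisker_exchange_assoc, h]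
  simp [actFst]

variable {H} {E : T} [ExactPairing H E]

/-- With hξ = ξ S(h), pairing the second factor of ξ₋₁ ⊗ hξ₀ with k gives ξ₋₁ ξ₀(S(h) k), which is
the coaction of ξ paired with S(h) k. -/
lemma dualPairing_dualCoact_swap :
    dualPairing (H := H) (H ◁ dualCoact H E ≫ (α_ H H E).inv ≫ (β_ H H).hom ▷ E ≫
        (α_ H H E).hom ≫ H ◁ ((β_ H E).hom ≫ E ◁ 𝒮[H] ≫ dualAct H E)) =
      (β_ H E).hom ▷ H ≫ (α_ E H H).hom ≫ E ◁ (𝒮[H] ▷ H ≫ μ[H]) ≫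
        dualPairing (dualCoact H E) := by
  have e1 : H ◁ dualCoact H E ≫ (α_ H H E).inv ≫ (β_ H H).hom ▷ E ≫
      (α_ H H E).hom ≫ H ◁ ((β_ H E).hom ≫ E ◁ 𝒮[H] ≫ dualAct H E) =
      (β_ H E).hom ≫ dualCoact H E ▷ H ≫ (α_ H E H).hom ≫
        H ◁ (E ◁ 𝒮[H] ≫ dualAct H E) := by
    rw [← BraidedCategory.braiding_naturality_right_assoc, BraidedCategory.braiding_tensor_right_hom]
    simp
  rw [e1, dualPairing_comp_left]
  congr 1
  simp only [dualPairing, comp_whiskerRight, MonoidalCategory.whiskerLeft_comp, Category.assoc,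
    whisker_assoc, Iso.inv_hom_id_assoc]
  rw [← MonoidalCategory.whiskerLeft_comp_assoc H (dualAct H E ▷ H), dualAct_eval]
  simp only [MonoidalCategory.whiskerLeft_comp, Category.assoc]
  have e2 : E ◁ 𝒮[H] ▷ H ≫ E ◁ μ[H] ≫ dualCoact H E ▷ H ≫ (α_ H E H).hom =
      dualCoact H E ▷ (H ⊗ H) ≫ (α_ H E (H ⊗ H)).hom ≫ H ◁ E ◁ 𝒮[H] ▷ H ≫ H ◁ E ◁ μ[H] := by
    rw [whisker_exchange_assoc, whisker_exchange_assoc]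
    simp
  rw [reassoc_of% e2]
  monoidal

/-- Multiplying the second factor by h₁ commutes with evaluating ξ on the first one, so h₁ can be
pulled out to the left. In the application V is h ⊗ k ↦ Δ(S(h) k). -/
lemma braiding_actSnd_eval (V : H ⊗ H ⟶ H ⊗ H) :
    (β_ H E).hom ▷ H ≫ (α_ E H H).hom ≫ E ◁ (Δ[H] ▷ H ≫ (α_ H H H).hom ≫ H ◁ V ≫ actSnd H) ≫
        (α_ E H H).inv ≫ ε_ H E ▷ H ≫ (λ_ H).hom =
      (Δ[H] ▷ E ≫ (α_ H H E).hom) ▷ H ≫ (α_ H (H ⊗ E) H).hom ≫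
        H ◁ ((β_ H E).hom ▷ H ≫ (α_ E H H).hom ≫ E ◁ V ≫ (α_ E H H).inv ≫ ε_ H E ▷ H ≫
          (λ_ H).hom) ≫ μ[H] := by
  have e1 : (β_ H E).hom ▷ H ≫ (α_ E H H).hom ≫ E ◁ Δ[H] ▷ H =
      Δ[H] ▷ E ▷ H ≫ (β_ (H ⊗ H) E).hom ▷ H ≫ (α_ E (H ⊗ H) H).hom := by
    rw [← associator_naturality_middle, ← comp_whiskerRight_assoc, ← comp_whiskerRight_assoc,
      BraidedCategory.braiding_naturality_left]
  have e2 : (β_ (H ⊗ H) E).hom ▷ H ≫ (α_ E (H ⊗ H) H).hom ≫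
      E ◁ ((α_ H H H).hom ≫ H ◁ V ≫ actSnd H) ≫ (α_ E H H).inv =
      (α_ H H E).hom ▷ H ≫ (H ◁ (β_ H E).hom) ▷ H ≫ (α_ H (E ⊗ H) H).hom ≫
        H ◁ (α_ E H H).hom ≫ H ◁ E ◁ V ≫ H ◁ (α_ E H H).inv ≫ (α_ H (E ⊗ H) H).inv ≫
          (β_ H (E ⊗ H)).hom ▷ H ≫ (α_ (E ⊗ H) H H).hom ≫ (E ⊗ H) ◁ μ[H] := by
    rw [BraidedCategory.braiding_tensor_left_hom, BraidedCategory.braiding_tensor_right_hom]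
    have e3 : (β_ H E).hom ▷ H ▷ H ≫ (α_ E H H).hom ▷ H ≫ (α_ E (H ⊗ H) H).hom ≫
        E ◁ (α_ H H H).hom ≫ E ◁ H ◁ V =
        (α_ (H ⊗ E) H H).hom ≫ (α_ H E (H ⊗ H)).hom ≫ H ◁ E ◁ V ≫
          (α_ H E (H ⊗ H)).inv ≫ (β_ H E).hom ▷ (H ⊗ H) ≫ (α_ E H (H ⊗ H)).hom := by
      rw [associator_inv_naturality_right_assoc, whisker_exchange_assoc]
      monoidal
    simp only [actSnd, comp_whiskerRight, MonoidalCategory.whiskerLeft_comp, Category.assoc]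
    rw [reassoc_of% e3]
    monoidal
  have e4 : (β_ H (E ⊗ H)).hom ▷ H ≫ (α_ (E ⊗ H) H H).hom ≫ (E ⊗ H) ◁ μ[H] ≫ ε_ H E ▷ H ≫
      (λ_ H).hom = (H ◁ ε_ H E) ▷ H ≫ (ρ_ H).hom ▷ H ≫ μ[H] := by
    rw [whisker_exchange_assoc, ← associator_naturality_left_assoc, ← comp_whiskerRight_assoc,
      ← BraidedCategory.braiding_naturality_right, comp_whiskerRight_assoc]
    simp
  simp only [MonoidalCategory.whiskerLeft_comp, Category.assoc] at e2 ⊢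
  rw [reassoc_of% e1, reassoc_of% e2, e4]
  monoidal

/-- The dual of a Hopf monoid is a Hopf module. -/
lemma dualAct_dualCoact :
    ((β_ H E).hom ≫ E ◁ 𝒮[H] ≫ dualAct H E) ≫ dualCoact H E =
      H ◁ dualCoact H E ≫ Δ[H] ▷ (H ⊗ E) ≫ tensorμ H H H E ≫
        (μ[H] ⊗ₘ ((β_ H E).hom ≫ E ◁ 𝒮[H] ≫ dualAct H E)) := by
  apply (dualPairing_bijective (H := H) (E := E) _ _).1
  set a : H ⊗ E ⟶ E := (β_ H E).hom ≫ E ◁ 𝒮[H] ≫ dualAct H E with ha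
  have hae : a ▷ H ≫ ε_ H E = (β_ H E).hom ▷ H ≫ (α_ E H H).hom ≫
      E ◁ (𝒮[H] ▷ H ≫ μ[H]) ≫ ε_ H E := by
    simp only [ha, comp_whiskerRight, Category.assoc, dualAct_eval]
    simp
  have e1 : Δ[H] ▷ (H ⊗ E) ≫ tensorμ H H H E ≫ (μ[H] ⊗ₘ a) =
      Δ[H] ▷ (H ⊗ E) ≫ (α_ H H (H ⊗ E)).hom ≫ H ◁ ((α_ H H E).inv ≫ (β_ H H).hom ▷ E ≫
        (α_ H H E).hom ≫ H ◁ a) ≫ (α_ H H E).inv ≫ μ[H] ▷ E := by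
    simp only [tensorμ, MonoidalCategory.tensorHom_def', MonoidalCategory.whiskerLeft_comp,
      Category.assoc]
    monoidal
  have e2 : H ◁ dualCoact H E ≫ Δ[H] ▷ (H ⊗ E) ≫ tensorμ H H H E ≫ (μ[H] ⊗ₘ a) =
      ((Δ[H] ▷ E ≫ (α_ H H E).hom) ≫ (H ◁ (H ◁ dualCoact H E ≫ (α_ H H E).inv ≫
        (β_ H H).hom ▷ E ≫ (α_ H H E).hom ≫ H ◁ a) ≫ (α_ H H E).inv)) ≫ μ[H] ▷ E := by
    rw [e1, whisker_exchange_assoc]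
    simp only [MonoidalCategory.whiskerLeft_comp, Category.assoc]
    rw [associator_naturality_right_assoc]
  rw [e2, dualPairing_comp_right, dualPairing_comp_left, dualPairing_comp_left,
    dualPairing_whiskerLeft, dualPairing_dualCoact_swap, dualPairing_dualCoact]
  have e3 : a ▷ H ≫ E ◁ Δ[H] ≫ (α_ E H H).inv ≫ ε_ H E ▷ H ≫ (λ_ H).hom =
      (β_ H E).hom ▷ H ≫ (α_ E H H).hom ≫ E ◁ (H ◁ Δ[H] ≫ (α_ H H H).inv ≫
        (𝒮[H] ▷ H ≫ μ[H]) ▷ H) ≫ (α_ E H H).inv ≫ ε_ H E ▷ H ≫ (λ_ H).hom := by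
    rw [← whisker_exchange_assoc, associator_inv_naturality_left_assoc,
      ← comp_whiskerRight_assoc, hae]
    simp only [comp_whiskerRight, Category.assoc, MonoidalCategory.whiskerLeft_comp]
    rw [← associator_inv_naturality_left_assoc, whisker_exchange_assoc]
    monoidal
  -- Paired with k, the two sides are ξ(S(h) k₁) k₂ and h₁ ξ((S(h₂) k)₁) (S(h₂) k)₂.
  rw [e3, ← comul_antipode_mul_comul]
  rw [braiding_actSnd_eval]
  simp only [MonoidalCategory.whiskerLeft_comp, Category.assoc]


/-- The antipode of a dualizable Hopf monoid is a split monomorphism. -/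
lemma exists_retraction_antipode (H E : T) [HopfObj H] [ExactPairing H E] : ∃ R : H ⟶ H, 𝒮[H] ≫ R = 𝟙 H := by
  let a : H ⊗ E ⟶ E := (β_ H E).hom ≫ E ◁ 𝒮[H] ≫ dualAct H E
  let r := dualCoact H E
  have a1 : η[H] ▷ E ≫ a = (λ_ E).hom := antipode_one (dualAct H E) (dualAct_one H E)
  have a2 : μ[H] ▷ E ≫ a = (α_ H H E).hom ≫ H ◁ a ≫ a :=
    antipode_assoc (dualAct H E) (dualAct_assoc H E)
  have c1 := dualCoact_counit H E
  have c2 := dualCoact_coassoc H E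
  have hc : a ≫ r = H ◁ r ≫ Δ[H] ▷ (H ⊗ E) ≫ tensorμ H H H E ≫ (μ[H] ⊗ₘ a) :=
    dualAct_dualCoact
  let P := antipodeProj 𝒮[H] a r
  have F1 : r ≫ H ◁ P ≫ a = 𝟙 E :=
    coact_antipodeProj 𝒮[H] a r c1 c2 a1 a2 (HopfObj.antipode_right H)
  have F2 : H ◁ P ≫ a ≫ r ≫ H ◁ P = H ◁ P := act_coact_antipodeProj a r c1 c2 a1 a2 hc
  -- The morphism i is the counit of H as an element of E, and e is evaluation at 1, so i ≫ e is
  -- ε(1) = 1.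
  obtain ⟨i, hi⟩ := dual_hom_exists (H := H) (E := E) ((λ_ H).hom ≫ ε[H])
  let e : E ⟶ 𝟙_ T := (ρ_ E).inv ≫ E ◁ η[H] ≫ ε_ H E
  have hie : i ≫ e = 𝟙 _ := by
    have h : i ≫ e = (ρ_ _).inv ≫ 𝟙_ T ◁ η[H] ≫ i ▷ H ≫ ε_ H E := by
      rw [whisker_exchange_assoc]
      simp [e]
    rw [h, hi]
    simp only [id_whiskerLeft, Category.assoc, Iso.inv_hom_id_assoc, BimonObj.one_counit]
    rw [Category.comp_id, unitors_equal, Iso.inv_hom_id]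
  -- H acts on E through S, so F2 exhibits h ⊗ ξ ↦ h ⊗ P(ξ) as a map that factors through S on the
  -- first factor.
  have hΛ : 𝒮[H] ▷ E ≫ H ◁ P ≫ (β_ H E).hom ≫ dualAct H E ≫ r ≫ H ◁ P = H ◁ P := by
    rw [← whisker_exchange_assoc, BraidedCategory.braiding_naturality_left_assoc]
    simpa [a] using F2
  generalize hL : H ◁ P ≫ (β_ H E).hom ≫ dualAct H E ≫ r ≫ H ◁ P = L at hΛ
  -- The factor E is removed as follows: take the coaction i₋₁ ⊗ i₀ of i, apply L to h ⊗ i₀, let i₋₁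
  -- act on the E-factor of the result, and apply e. On S(h) this yields h ⊗ e(i₋₁ P(i₀)), which is
  -- h ⊗ e(i) = h by F1.
  refine ⟨(ρ_ H).inv ≫ H ◁ (i ≫ r ≫ (β_ H E).hom) ≫ (α_ H E H).inv ≫ L ▷ H ≫ (α_ H E H).hom ≫
    H ◁ ((β_ E H).hom ≫ a ≫ e) ≫ (ρ_ H).hom, ?_⟩
  have h1 : 𝒮[H] ≫ (ρ_ H).inv ≫ H ◁ (i ≫ r ≫ (β_ H E).hom) ≫ (α_ H E H).inv ≫ L ▷ H ≫
      (α_ H E H).hom ≫ H ◁ ((β_ E H).hom ≫ a ≫ e) ≫ (ρ_ H).hom =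
      (ρ_ H).inv ≫ H ◁ (i ≫ r ≫ (β_ H E).hom) ≫ (α_ H E H).inv ≫ (𝒮[H] ▷ E ≫ L) ▷ H ≫
        (α_ H E H).hom ≫ H ◁ ((β_ E H).hom ≫ a ≫ e) ≫ (ρ_ H).hom := by
    rw [rightUnitor_inv_naturality_assoc, ← whisker_exchange_assoc, comp_whiskerRight_assoc,
      associator_inv_naturality_left_assoc]
  rw [h1, hΛ]
  have h2 : (ρ_ H).inv ≫ H ◁ (i ≫ r ≫ (β_ H E).hom) ≫ (α_ H E H).inv ≫ (H ◁ P) ▷ H ≫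
      (α_ H E H).hom ≫ H ◁ ((β_ E H).hom ≫ a ≫ e) ≫ (ρ_ H).hom =
      (ρ_ H).inv ≫ H ◁ (i ≫ r ≫ ((β_ H E).hom ≫ P ▷ H ≫ (β_ E H).hom) ≫ a ≫ e) ≫
        (ρ_ H).hom := by
    simp only [whisker_assoc, Iso.inv_hom_id_assoc, MonoidalCategory.whiskerLeft_comp,
      Category.assoc]
  have h3 : (β_ H E).hom ≫ P ▷ H ≫ (β_ E H).hom = H ◁ P := by
    rw [← BraidedCategory.braiding_naturality_right_assoc, SymmetricCategory.symmetry,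
      Category.comp_id]
  rw [h2, h3, reassoc_of% F1, hie]
  simp

end

section Opposite

open Opposite

variable (H : T) [HopfObj H]

/-- A Hopf monoid is a Hopf monoid in the opposite category. -/
abbrev hopfObjOp : HopfObj (op H) where
  one := ε[H].op
  mul := Δ[H].op
  one_mul := Quiver.Hom.unop_inj (by simp)
  mul_one := Quiver.Hom.unop_inj (by simp)
  mul_assoc := Quiver.Hom.unop_inj (by simp)
  counit := η[H].op
  comul := μ[H].op
  counit_comul := Quiver.Hom.unop_inj (by simp)
  comul_counit := Quiver.Hom.unop_inj (by simp)
  comul_assoc := Quiver.Hom.unop_inj (by simp)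
  mul_comul := Quiver.Hom.unop_inj (by simp [BimonObj.mul_comul])
  one_comul := Quiver.Hom.unop_inj (by
    simp [MonObj.tensorObj.one_def, unitors_equal]
    rfl)
  mul_counit := Quiver.Hom.unop_inj (by
    simp
    rfl)
  one_counit := Quiver.Hom.unop_inj (by simp)
  antipode := 𝒮[H].op
  antipode_left := Quiver.Hom.unop_inj (by simp)
  antipode_right := Quiver.Hom.unop_inj (by simp)

/-- Duality in the opposite category. -/
abbrev exactPairingOp (X Y : T) [ExactPairing X Y] : ExactPairing (op Y) (op X) where
  coevaluation' := (ε_ X Y).op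
  evaluation' := (η_ X Y).op
  coevaluation_evaluation' := Quiver.Hom.unop_inj (by simp)
  evaluation_coevaluation' := Quiver.Hom.unop_inj (by simp)

/-- The antipode of a dualizable Hopf monoid is invertible. -/
lemma isIso_antipode (E : T) [ExactPairing H E] : IsIso 𝒮[H] := by
  obtain ⟨R, hR⟩ := exists_retraction_antipode H E
  let : SymmetricCategory Tᵒᵖ :=
    { toBraidedCategory := inferInstance
      symmetry := fun X Y => Quiver.Hom.unop_inj (by simp) }
  let := hopfObjOp H
  let : ExactPairing E H := BraidedCategory.exactPairing_swap H E
  let := exactPairingOp E H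
  -- A retraction in the opposite category is a section of the original antipode.
  obtain ⟨R', hR'⟩ := exists_retraction_antipode (op H) (op E)
  have h : R'.unop ≫ 𝒮[H] = 𝟙 H := congrArg Quiver.Hom.unop hR'
  have e : R = R'.unop := by
    rw [← Category.id_comp R, ← h, Category.assoc, hR, Category.comp_id]
  exact ⟨R, hR, by rw [e, h]⟩

end Opposite

end Antipode

/-! ### Shear maps and convolution. -/

section Shear

open MonObj ComonObj HopfObj

variable {T : Type u} [Category.{v} T] [MonoidalCategory T] {H X N : T}

section
variable [MonObj H] [ComonObj H] (act : X ⊗ H ⟶ X) (r : N ⟶ H ⊗ N)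

/-- `x ⊗ n ↦ x f(n₋₁) ⊗ n₀`. -/
def shear (f : H ⟶ H) : X ⊗ N ⟶ X ⊗ N := X ◁ r ≫ (α_ X H N).inv ≫ (X ◁ f ≫ act) ▷ N

/-- In elements, x f(n₋₁) g(n₀₋₁) ⊗ n₀₀: shears compose by convolution, which makes the shears by
the identity and by the antipode mutually inverse. -/
lemma shear_comp (h2 : X ◁ μ[H] ≫ act = (α_ X H H).inv ≫ act ▷ H ≫ act)
    (c2 : r ≫ H ◁ r = r ≫ Δ[H] ▷ N ≫ (α_ H H N).hom) (f g : H ⟶ H) :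
    shear act r f ≫ shear act r g = shear act r (Δ[H] ≫ f ▷ H ≫ H ◁ g ≫ μ[H]) := by
  have e1 : (α_ X H H).inv ≫ (X ◁ f ≫ act) ▷ H ≫ X ◁ g ≫ act =
      X ◁ (f ▷ H ≫ H ◁ g ≫ μ[H]) ≫ act := by
    rw [comp_whiskerRight_assoc, ← whisker_exchange_assoc, ← associator_inv_naturality_middle_assoc,
      ← associator_inv_naturality_right_assoc, ← h2]
    simp
  have e2 : X ◁ (α_ H H N).hom ≫ (α_ X H (H ⊗ N)).inv ≫ (α_ (X ⊗ H) H N).inv =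
      (α_ X (H ⊗ H) N).inv ≫ (α_ X H H).inv ▷ N := by
    simp
  simp only [shear, Category.assoc]
  rw [← whisker_exchange_assoc, ← associator_inv_naturality_right_assoc,
    associator_inv_naturality_left_assoc, ← MonoidalCategory.whiskerLeft_comp_assoc, c2]
  simp only [MonoidalCategory.whiskerLeft_comp_assoc]
  rw [reassoc_of% e2, associator_inv_naturality_middle_assoc, ← comp_whiskerRight,
    ← comp_whiskerRight, e1]
  simp only [MonoidalCategory.whiskerLeft_comp, comp_whiskerRight, Category.assoc]

lemma shear_one (h1 : X ◁ η[H] ≫ act = (ρ_ X).hom) (c1 : r ≫ ε[H] ▷ N = (λ_ N).inv) :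
    shear act r (ε[H] ≫ η[H]) = 𝟙 _ := by
  rw [shear, MonoidalCategory.whiskerLeft_comp, Category.assoc, h1, comp_whiskerRight,
    ← associator_inv_naturality_middle_assoc, ← MonoidalCategory.whiskerLeft_comp_assoc, c1]
  simp

end

lemma isIso_shear [BraidedCategory T] [HopfObj H] (act : X ⊗ H ⟶ X) (r : N ⟶ H ⊗ N)
    (h1 : X ◁ η[H] ≫ act = (ρ_ X).hom)
    (h2 : X ◁ μ[H] ≫ act = (α_ X H H).inv ≫ act ▷ H ≫ act)
    (c1 : r ≫ ε[H] ▷ N = (λ_ N).inv) (c2 : r ≫ H ◁ r = r ≫ Δ[H] ▷ N ≫ (α_ H H N).hom) :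
    IsIso (X ◁ r ≫ (α_ X H N).inv ≫ act ▷ N) := by
  have e : X ◁ r ≫ (α_ X H N).inv ≫ act ▷ N = shear act r (𝟙 H) := by simp [shear]
  rw [e]
  refine ⟨shear act r 𝒮[H], ?_, ?_⟩
  · rw [shear_comp act r h2 c2, id_whiskerRight, Category.id_comp, HopfObj.antipode_right,
      shear_one act r h1 c1]
  · rw [shear_comp act r h2 c2, MonoidalCategory.whiskerLeft_id, Category.id_comp,
      HopfObj.antipode_left, shear_one act r h1 c1]

end Shear

/-! ### Cofreeness of E ⊗ H, where E is the dual of H. -/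

section Cofree

open MonObj ComonObj HopfObj

variable {T : Type u} [Category.{v} T] [MonoidalCategory T]

/-- A pairing `X ⊗ H ⟶ Z` that exhibits `X` as an internal hom object, also after tensoring. -/
def IsPerfect {H E : T} [ExactPairing H E] {X Z : T} (K : X ⊗ H ⟶ Z) : Prop :=
  ∃ k : X ⟶ Z ⊗ E, IsIso k ∧ dualPairing k = K

section
variable {H E : T} [ExactPairing H E] {X Z : T} {K : X ⊗ H ⟶ Z}

lemma IsPerfect.bijective (hK : IsPerfect (E := E) K) (A : T) :
    Function.Bijective (fun f : A ⟶ X => f ▷ H ≫ K) := by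
  obtain ⟨k, hk, rfl⟩ := hK
  have e : (fun f : A ⟶ X => f ▷ H ≫ dualPairing k) =
      dualPairing ∘ (fun f : A ⟶ X => f ≫ k) := by
    ext f
    simp [dualPairing_comp_left]
  rw [e]
  exact (dualPairing_bijective A Z).comp ((asIso k).homToEquiv).bijective

lemma IsPerfect.whiskerLeft (hK : IsPerfect (E := E) K) (B : T) :
    IsPerfect (E := E) ((α_ B X H).hom ≫ B ◁ K) := by
  obtain ⟨k, hk, rfl⟩ := hK
  exact ⟨B ◁ k ≫ (α_ B Z E).inv, inferInstance, dualPairing_whiskerLeft B k⟩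

end

variable [SymmetricCategory T] {H E : T} [HopfObj H] [ExactPairing H E]

/-- In elements, ξ₋₁ (ξ₀ h)(k) = ξ₋₁ ξ₀(h k). So the pairing whose perfectness is at stake
corresponds to ξ ⊗ h ↦ ξ₋₁ ⊗ ξ₀ h. -/
lemma dualPairing_dualCoact_act :
    dualPairing (H := H) (dualCoact H E ▷ H ≫ (α_ H E H).hom ≫ H ◁ dualAct H E) =
      (α_ E H H).hom ≫ E ◁ μ[H] ≫ dualPairing (dualCoact H E) := by
  simp only [dualPairing, comp_whiskerRight, Category.assoc, whisker_assoc, Iso.inv_hom_id_assoc]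
  rw [← MonoidalCategory.whiskerLeft_comp_assoc H (dualAct H E ▷ H), dualAct_eval,
    whisker_exchange_assoc]
  simp

/-- `ξ₋₁ ⊗ ξ₀ h = h₂ (ξ h₁)₋₁ ⊗ (ξ h₁)₀`. -/
lemma dualCoact_act_eq :
    dualCoact H E ▷ H ≫ (α_ H E H).hom ≫ H ◁ dualAct H E =
      (E ◁ Δ[H] ≫ (α_ E H H).inv ≫ dualAct H E ▷ H) ≫ (β_ E H).hom ≫
        (H ◁ dualCoact H E ≫ (α_ H H E).inv ≫ μ[H] ▷ E) := by
  -- Paired with k, both sides are ξ(h₁ k₁) h₂ k₂; on the left this is the multiplicativity of Δ.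
  apply (dualPairing_bijective (H := H) (E := E) _ _).1
  rw [dualPairing_dualCoact_act, dualPairing_comp_left, dualPairing_comp_left,
    ← Category.assoc (H ◁ dualCoact H E), dualPairing_comp_right, dualPairing_whiskerLeft,
    dualPairing_dualCoact]
  let w' : (E ⊗ H) ⊗ H ⟶ 𝟙_ T := (α_ E H H).hom ≫ E ◁ μ[H] ≫ ε_ H E
  have l1 : (α_ E H H).hom ≫ E ◁ μ[H] ≫ E ◁ Δ[H] ≫ (α_ E H H).inv ≫ ε_ H E ▷ H ≫ (λ_ H).hom =
      (E ◁ Δ[H]) ▷ H ≫ (E ⊗ (H ⊗ H)) ◁ Δ[H] ≫ (α_ E (H ⊗ H) (H ⊗ H)).hom ≫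
        E ◁ tensorμ H H H H ≫ (α_ E (H ⊗ H) (H ⊗ H)).inv ≫ (E ◁ μ[H] ≫ ε_ H E) ▷ (H ⊗ H) ≫
          𝟙_ T ◁ μ[H] ≫ (λ_ H).hom := by
    rw [← MonoidalCategory.whiskerLeft_comp_assoc E μ[H], BimonObj.mul_comul,
      MonoidalCategory.tensorHom_def, MonoidalCategory.tensorHom_def]
    simp only [MonoidalCategory.whiskerLeft_comp, Category.assoc]
    rw [← associator_naturality_middle_assoc, ← associator_naturality_right_assoc,
      associator_inv_naturality_right_assoc, whisker_exchange_assoc,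
      associator_inv_naturality_middle_assoc, comp_whiskerRight_assoc]
  have r1 : (E ◁ Δ[H] ≫ (α_ E H H).inv ≫ dualAct H E ▷ H) ▷ H ≫ (β_ E H).hom ▷ H ≫
      ((α_ H E H).hom ≫ H ◁ (E ◁ Δ[H] ≫ (α_ E H H).inv ≫ ε_ H E ▷ H ≫ (λ_ H).hom)) ≫ μ[H] =
      (E ◁ Δ[H]) ▷ H ≫ (E ⊗ (H ⊗ H)) ◁ Δ[H] ≫ (α_ E H H).inv ▷ (H ⊗ H) ≫
        (β_ (E ⊗ H) H).hom ▷ (H ⊗ H) ≫ (α_ H (E ⊗ H) (H ⊗ H)).hom ≫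
          H ◁ ((α_ (E ⊗ H) H H).inv ≫ w' ▷ H ≫ (λ_ H).hom) ≫ μ[H] := by
    have e1 : dualAct H E ▷ H ▷ H ≫ (β_ E H).hom ▷ H =
        (β_ (E ⊗ H) H).hom ▷ H ≫ (H ◁ dualAct H E) ▷ H := by
      rw [← comp_whiskerRight, BraidedCategory.braiding_naturality_left, comp_whiskerRight]
    have e2 : H ◁ dualAct H E ▷ H ≫ H ◁ E ◁ Δ[H] ≫ H ◁ (α_ E H H).inv ≫ H ◁ ε_ H E ▷ H =
        H ◁ (E ⊗ H) ◁ Δ[H] ≫ H ◁ (α_ (E ⊗ H) H H).inv ≫ H ◁ w' ▷ H := by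
      simp only [← MonoidalCategory.whiskerLeft_comp]
      rw [← whisker_exchange_assoc, associator_inv_naturality_left_assoc, ← comp_whiskerRight,
        dualAct_eval]
    have e3 : (α_ E H H).inv ▷ H ≫ (β_ (E ⊗ H) H).hom ▷ H ≫ (α_ H (E ⊗ H) H).hom ≫
        H ◁ (E ⊗ H) ◁ Δ[H] = (E ⊗ (H ⊗ H)) ◁ Δ[H] ≫ (α_ E H H).inv ▷ (H ⊗ H) ≫
        (β_ (E ⊗ H) H).hom ▷ (H ⊗ H) ≫ (α_ H (E ⊗ H) (H ⊗ H)).hom := by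
      rw [whisker_exchange_assoc, whisker_exchange_assoc, ← associator_naturality_right]
    simp only [comp_whiskerRight, MonoidalCategory.whiskerLeft_comp, Category.assoc]
    rw [reassoc_of% e1, associator_naturality_middle_assoc, reassoc_of% e2, reassoc_of% e3]
  have e4 : H ◁ w' ≫ (ρ_ H).hom = (β_ H ((E ⊗ H) ⊗ H)).hom ≫ w' ▷ H ≫ (λ_ H).hom := by
    rw [← BraidedCategory.braiding_naturality_right_assoc]
    simp
  have e5 : (β_ (E ⊗ H) H).hom ▷ (H ⊗ H) ≫ (α_ H (E ⊗ H) (H ⊗ H)).hom ≫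
      H ◁ ((α_ (E ⊗ H) H H).inv ≫ w' ▷ H ≫ (λ_ H).hom) =
      (α_ (E ⊗ H) H (H ⊗ H)).hom ≫ (E ⊗ H) ◁ ((α_ H H H).inv ≫ (β_ H H).hom ▷ H) ⊗≫
        w' ▷ (H ⊗ H) ≫ (λ_ _).hom := by
    have e6 : (β_ (E ⊗ H) H).hom ▷ (H ⊗ H) ≫ (α_ H (E ⊗ H) (H ⊗ H)).hom ≫
        H ◁ ((α_ (E ⊗ H) H H).inv ≫ w' ▷ H ≫ (λ_ H).hom) =
        (β_ (E ⊗ H) H).hom ▷ (H ⊗ H) ⊗≫ (H ◁ w' ≫ (ρ_ H).hom) ▷ H := by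
      monoidal
    have e7 : (β_ (E ⊗ H) H).hom ▷ (H ⊗ H) ≫ (β_ H (E ⊗ H)).hom ▷ (H ⊗ H) = 𝟙 _ := by
      rw [← comp_whiskerRight, SymmetricCategory.symmetry, id_whiskerRight]
    have e8 : (β_ (E ⊗ H) H).hom ▷ (H ⊗ H) ⊗≫ ((β_ H ((E ⊗ H) ⊗ H)).hom ≫ w' ▷ H ≫ (λ_ H).hom) ▷ H =
        ((β_ (E ⊗ H) H).hom ▷ (H ⊗ H) ≫ (β_ H (E ⊗ H)).hom ▷ (H ⊗ H)) ⊗≫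
          (E ⊗ H) ◁ (β_ H H).hom ▷ H ⊗≫ w' ▷ (H ⊗ H) ≫ (λ_ _).hom := by
      rw [BraidedCategory.braiding_tensor_right_hom H (E ⊗ H) H]
      monoidal
    rw [e6, e4, e8, e7]
    monoidal
  have key : (α_ E (H ⊗ H) (H ⊗ H)).hom ≫
        E ◁ tensorμ H H H H ≫ (α_ E (H ⊗ H) (H ⊗ H)).inv ≫ (E ◁ μ[H] ≫ ε_ H E) ▷ (H ⊗ H) ≫
          (λ_ _).hom = (α_ E H H).inv ▷ (H ⊗ H) ≫
        (β_ (E ⊗ H) H).hom ▷ (H ⊗ H) ≫ (α_ H (E ⊗ H) (H ⊗ H)).hom ≫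
          H ◁ ((α_ (E ⊗ H) H H).inv ≫ w' ▷ H ≫ (λ_ H).hom) := by
    rw [e5]
    simp only [w', tensorμ]
    monoidal
  rw [l1, r1, leftUnitor_naturality, reassoc_of% key]

/-- This is the cofreeness of E ⊗ H on H along ξ ⊗ h ↦ ξ(h₁) h₂. The map that has to be inverted is
a composite of two shears and a braiding by `dualCoact_act_eq`. -/
lemma isPerfect_mul_dualPairing : IsPerfect (E := E)
    ((α_ E H H).hom ≫ E ◁ μ[H] ≫ dualPairing (dualCoact H E)) := by
  refine ⟨_, ?_, dualPairing_dualCoact_act⟩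
  rw [dualCoact_act_eq]
  have h1 : IsIso (E ◁ Δ[H] ≫ (α_ E H H).inv ≫ dualAct H E ▷ H) :=
    isIso_shear _ _ (dualAct_one H E) (dualAct_assoc H E) (ComonObj.counit_comul H)
      (ComonObj.comul_assoc H)
  have h2 : IsIso (H ◁ dualCoact H E ≫ (α_ H H E).inv ≫ μ[H] ▷ E) :=
    isIso_shear _ _ (MonObj.mul_one H) (MonObj.mul_assoc_flip H) (dualCoact_counit H E)
      (dualCoact_coassoc H E)
  infer_instance

end Cofree

/-! ### From dualizability by internal homs to exact pairings. -/

section Duality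

variable {T : Type u} [Category.{v} T] [MonoidalCategory T]

/-- The hypothesis says that the canonical map from D ⊗ X to the internal endomorphisms sends j to
the identity of X. By symmetry this is a triangle identity. -/
lemma ev_coev_of_whiskerRight {X D : T} [SymmetricCategory T] (ev : D ⊗ X ⟶ 𝟙_ T)
    (j : 𝟙_ T ⟶ D ⊗ X)
    (hj : j ▷ X ≫ (α_ D X X).hom ≫ D ◁ (β_ X X).hom ≫ (α_ D X X).inv ≫ ev ▷ X ≫ (λ_ X).hom =
      (λ_ X).hom) :
    (j ≫ (β_ D X).hom) ▷ X ≫ (α_ X D X).hom ≫ X ◁ ev = (λ_ X).hom ≫ (ρ_ X).inv := by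
  have h1 : ev ▷ X ≫ (λ_ X).hom = (β_ (D ⊗ X) X).hom ≫ X ◁ ev ≫ (ρ_ X).hom := by
    rw [← BraidedCategory.braiding_naturality_left_assoc, braiding_rightUnitor]
  rw [h1, BraidedCategory.braiding_tensor_left_hom] at hj
  simp only [Category.assoc, Iso.inv_hom_id_assoc,
    ← MonoidalCategory.whiskerLeft_comp_assoc, SymmetricCategory.symmetry,
    MonoidalCategory.whiskerLeft_id, Category.id_comp, Iso.hom_inv_id_assoc] at hj
  rw [← cancel_mono (ρ_ X).hom]
  simpa using hj

/-- Maps into D are determined by their evaluation on X, where the interchange law reduces the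
second triangle identity to the first. -/
lemma coev_ev_of_isInternalHom {X D : T} (ev : D ⊗ X ⟶ 𝟙_ T) (hev : IsInternalHom ev)
    (j : 𝟙_ T ⟶ X ⊗ D) (hj : j ▷ X ≫ (α_ X D X).hom ≫ X ◁ ev = (λ_ X).hom ≫ (ρ_ X).inv) :
    D ◁ j ≫ (α_ D X D).inv ≫ ev ▷ D = (ρ_ D).hom ≫ (λ_ D).inv := by
  rw [← cancel_mono (λ_ D).hom]
  apply (hev _).1
  simp only [Category.assoc, Iso.inv_hom_id, Category.comp_id, comp_whiskerRight]
  calc _ = 𝟙 _ ⊗≫ D ◁ j ▷ X ⊗≫ (ev ▷ (D ⊗ X) ≫ 𝟙_ T ◁ ev) ⊗≫ 𝟙 _ := by monoidal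
    _ = 𝟙 _ ⊗≫ D ◁ (j ▷ X ≫ (α_ X D X).hom ≫ X ◁ ev) ⊗≫ ev ⊗≫ 𝟙 _ := by
      rw [← whisker_exchange]; monoidal
    _ = _ := by rw [hj]; monoidal

/-- The coevaluation is the element of D ⊗ X that the canonical isomorphism sends to the identity of
X. -/
theorem IsDualizable.exists_exactPairing [SymmetricCategory T] {X : T} (h : IsDualizable X) :
    ∃ D : T, Nonempty (ExactPairing X D) := by
  obtain ⟨D, E, ev, ev', hev, hev', ν, hν, h⟩ := h
  obtain ⟨i, hi⟩ := (hev' (𝟙_ T)).2 (λ_ X).hom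
  dsimp only at hi
  have hj := ev_coev_of_whiskerRight ev (i ≫ inv ν) (by
    rw [← h, ← comp_whiskerRight_assoc, Category.assoc, IsIso.inv_hom_id, Category.comp_id, hi])
  exact ⟨D, ⟨{
    coevaluation' := (i ≫ inv ν) ≫ (β_ D X).hom
    evaluation' := ev
    coevaluation_evaluation' := coev_ev_of_isInternalHom ev hev _ hj
    evaluation_coevaluation' := hj }⟩⟩

end Duality

/-! ### Hopf objects and duals in the derived monoidal category. -/

section HopfImage

variable {A : Type u₁} [Category.{v₁} A] [MonoidalCategory A] [BraidedCategory A]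
  {B : Type u₂} [Category.{v₂} B] [MonoidalCategory B] [BraidedCategory B]
  (F : A ⥤ B) [F.Braided]

open MonObj ComonObj HopfObj Functor.Monoidal Functor.LaxMonoidal Functor.OplaxMonoidal

open scoped CategoryTheory.Obj in
/-- A braided monoidal functor preserves Hopf objects. -/
@[reducible]
def hopfObjObj (H : A) [HopfObj H] : HopfObj (F.obj H) where
  toMonObj := F.monObjObj H
  toComonObj := Functor.obj.instComonObj H F
  mul_comul := by
    rw [← cancel_mono (Functor.LaxMonoidal.μ F _ _)]
    change ((Functor.LaxMonoidal.μ F H H ≫ F.map μ) ≫ F.map Δ ≫ δ F H H) ≫ _ =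
      (((F.map Δ ≫ δ F H H) ⊗ₘ (F.map Δ ≫ δ F H H)) ≫ tensorμ _ _ _ _ ≫
        ((Functor.LaxMonoidal.μ F H H ≫ F.map μ) ⊗ₘ (Functor.LaxMonoidal.μ F H H ≫ F.map μ))) ≫ _
    simp only [Category.assoc, δ_μ, Category.comp_id, ← tensorHom_comp_tensorHom,
      Functor.LaxMonoidal.μ_natural]
    rw [tensorμ_comp_μ_tensorHom_μ_comp_μ_assoc, tensorHom_comp_tensorHom_assoc,
      tensorHom_comp_tensorHom_assoc, Category.assoc, δ_μ, Category.comp_id, Functor.LaxMonoidal.μ_natural_assoc,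
      ← F.map_comp, BimonObj.mul_comul, F.map_comp, F.map_comp]
  one_comul := by
    change (Functor.LaxMonoidal.ε F ≫ F.map η) ≫ F.map Δ ≫ δ F H H =
      (λ_ (𝟙_ B)).inv ≫ ((Functor.LaxMonoidal.ε F ≫ F.map η) ⊗ₘ
        (Functor.LaxMonoidal.ε F ≫ F.map η))
    rw [← cancel_mono (Functor.LaxMonoidal.μ F _ _)]
    simp only [Category.assoc, δ_μ, Category.comp_id, ← tensorHom_comp_tensorHom,
      Functor.LaxMonoidal.μ_natural]
    rw [← F.map_comp, BimonObj.one_comul, MonObj.tensorObj.one_def, F.map_comp,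
      MonoidalCategory.tensorHom_def' (Functor.LaxMonoidal.ε F), Category.assoc,
      ← leftUnitor_inv_naturality_assoc,
      Functor.LaxMonoidal.left_unitality_inv_assoc]
  mul_counit := by
    change (Functor.LaxMonoidal.μ F H H ≫ F.map μ) ≫ F.map ε ≫ Functor.OplaxMonoidal.η F =
      ((F.map ε ≫ Functor.OplaxMonoidal.η F) ⊗ₘ (F.map ε ≫ Functor.OplaxMonoidal.η F)) ≫
        (λ_ (𝟙_ B)).hom
    rw [Category.assoc, ← F.map_comp_assoc, BimonObj.mul_counit]
    change _ ≫ F.map ((ε ⊗ₘ ε) ≫ (λ_ _).hom) ≫ _ = _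
    simp only [← tensorHom_comp_tensorHom, F.map_comp, Category.assoc]
    rw [← Functor.LaxMonoidal.μ_natural_assoc, ← Functor.OplaxMonoidal.left_unitality_hom,
      MonoidalCategory.tensorHom_def (Functor.OplaxMonoidal.η F)]
    simp only [Category.assoc, μ_δ_assoc, leftUnitor_naturality]
  one_counit := by
    change (Functor.LaxMonoidal.ε F ≫ F.map η) ≫ F.map ε ≫ Functor.OplaxMonoidal.η F = _
    rw [Category.assoc, ← F.map_comp_assoc, BimonObj.one_counit, F.map_id, Category.id_comp, ε_η]
  antipode := F.map 𝒮
  antipode_left := by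
    change (F.map Δ ≫ δ F H H) ≫ F.map 𝒮 ▷ F.obj H ≫ Functor.LaxMonoidal.μ F H H ≫ F.map μ =
      (F.map ε ≫ Functor.OplaxMonoidal.η F) ≫ Functor.LaxMonoidal.ε F ≫ F.map η
    rw [Functor.LaxMonoidal.μ_natural_left_assoc, Category.assoc, δ_μ_assoc, Category.assoc,
      η_ε_assoc, ← F.map_comp, ← F.map_comp, ← F.map_comp, antipode_left]
  antipode_right := by
    change (F.map Δ ≫ δ F H H) ≫ F.obj H ◁ F.map 𝒮 ≫ Functor.LaxMonoidal.μ F H H ≫ F.map μ =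
      (F.map ε ≫ Functor.OplaxMonoidal.η F) ≫ Functor.LaxMonoidal.ε F ≫ F.map η
    rw [Functor.LaxMonoidal.μ_natural_right_assoc, Category.assoc, δ_μ_assoc, Category.assoc,
      η_ε_assoc, ← F.map_comp, ← F.map_comp, ← F.map_comp, antipode_right]

end HopfImage
section
variable {C : Type u} [Category.{v} C] [MonoidalCategory C] [SymmetricCategory C]
  [MonoidalClosed C] [ModelCategory C] [MonoidalModelCategory C]

open MonObj ComonObj HopfObj in
/-- A cofibrant Hopf object is a Hopf object in the category of cofibrant objects. -/
@[reducible]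
def hopfObjCofibrant (H : C) [HopfObj H] [IsCofibrant H] : HopfObj (CofibrantObject.mk H) where
  one := ObjectProperty.homMk η[H]
  mul := ObjectProperty.homMk μ[H]
  counit := ObjectProperty.homMk ε[H]
  comul := ObjectProperty.homMk Δ[H]
  antipode := ObjectProperty.homMk 𝒮[H]
  one_mul := ObjectProperty.hom_ext _ (MonObj.one_mul H)
  mul_one := ObjectProperty.hom_ext _ (MonObj.mul_one H)
  mul_assoc := ObjectProperty.hom_ext _ (MonObj.mul_assoc H)
  counit_comul := ObjectProperty.hom_ext _ (ComonObj.counit_comul H)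
  comul_counit := ObjectProperty.hom_ext _ (ComonObj.comul_counit H)
  comul_assoc := ObjectProperty.hom_ext _ (ComonObj.comul_assoc H)
  mul_comul := ObjectProperty.hom_ext _ (BimonObj.mul_comul H)
  one_comul := ObjectProperty.hom_ext _ (BimonObj.one_comul H)
  mul_counit := ObjectProperty.hom_ext _ (BimonObj.mul_counit H)
  one_counit := ObjectProperty.hom_ext _ (BimonObj.one_counit H)
  antipode_left := ObjectProperty.hom_ext _ (HopfObj.antipode_left H)
  antipode_right := ObjectProperty.hom_ext _ (HopfObj.antipode_right H)

variable (C) in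
/-- The homotopy category with its derived symmetric monoidal structure. -/
abbrev TensorHo : Type u :=
  LocalizedMonoidal (CofibrantObject.ι ⋙ hoQ C) (weakEquivalences (CofibrantObject C))
    (Iso.refl _)

variable (C) in
/-- The localization functor to the tensor triangulated category. -/
abbrev tensorQ : CofibrantObject C ⥤ TensorHo C :=
  Localization.Monoidal.toMonoidalCategory (CofibrantObject.ι ⋙ hoQ C)
    (weakEquivalences (CofibrantObject C)) (Iso.refl _)

variable (C) in
abbrev monoidalQ : CofibrantObject C ⥤ MonoidalHo C :=
  Localization.Monoidal.toMonoidalCategory (hoQ (CofibrantObject C))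
    (weakEquivalences (CofibrantObject C)) (Iso.refl _)

/-- `TensorHo` and `MonoidalHo` localize the same monoidal category, so they are monoidally
equivalent and duals can be transported. The former is used from here on because its underlying
category is Ho C itself. -/
lemma exists_exactPairing_tensorQ (H : C) [IsCofibrant H]
    (h : IsDualizable (toMonoidalHo H)) :
    ∃ E : TensorHo C, Nonempty (ExactPairing ((tensorQ C).obj (CofibrantObject.mk H)) E) := by
  obtain ⟨D, ⟨hD⟩⟩ := h.exists_exactPairing
  let F : TensorHo C ⥤ MonoidalHo C := (Localization.uniq (tensorQ C) (monoidalQ C) (weakEquivalences (CofibrantObject C))).functor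
  let : Localization.Lifting (tensorQ C) (weakEquivalences (CofibrantObject C)) (monoidalQ C) F :=
    ⟨Localization.compUniqFunctor _ _ _⟩
  let : F.Monoidal := Localization.Monoidal.functorMonoidalOfComp (tensorQ C)
    (weakEquivalences (CofibrantObject C)) F (monoidalQ C)
  let e := (Localization.compUniqFunctor (tensorQ C) (monoidalQ C)
    (weakEquivalences (CofibrantObject C))).app (CofibrantObject.mk H)
  let := hD
  let : ExactPairing (F.obj ((tensorQ C).obj (CofibrantObject.mk H)))
      (F.obj (F.objPreimage D)) := exactPairingCongr (X' := toMonoidalHo H) (Y' := D) e (F.objObjPreimageIso D)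
  exact ⟨F.objPreimage D, ⟨ExactPairing.ofFullyFaithful F _ _⟩⟩

end

section UnitRetract

open MonObj ComonObj

/-- The unit is a retract of the dual of a bialgebra. -/
lemma exists_unit_retract {T : Type u} [Category.{v} T] [MonoidalCategory T] [BraidedCategory T]
    (H E : T) [BimonObj H] [ExactPairing H E] : ∃ (i : 𝟙_ T ⟶ E) (e : E ⟶ 𝟙_ T), i ≫ e = 𝟙 _ := by
  -- The section i is the counit of H as an element of E; the retraction is evaluation at 1.
  obtain ⟨i, hi⟩ := dual_hom_exists (H := H) (E := E) ((λ_ H).hom ≫ ε[H])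
  refine ⟨i, (ρ_ E).inv ≫ E ◁ η[H] ≫ ε_ H E, ?_⟩
  have h : i ≫ (ρ_ E).inv ≫ E ◁ η[H] ≫ ε_ H E =
      (ρ_ _).inv ≫ 𝟙_ T ◁ η[H] ≫ i ▷ H ≫ ε_ H E := by
    rw [whisker_exchange_assoc]
    simp
  rw [h, hi]
  simp only [id_whiskerLeft, Category.assoc, Iso.inv_hom_id_assoc, BimonObj.one_counit]
  rw [Category.comp_id, unitors_equal, Iso.inv_hom_id]

end UnitRetract

/-! ### The derived tensor product on cofibrant objects, and cofreeness in Ho C. -/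

section TensorHo

variable {C : Type u} [Category.{v} C] [MonoidalCategory C] [SymmetricCategory C]
  [MonoidalClosed C] [ModelCategory C] [MonoidalModelCategory C]

open Functor.Monoidal

/-- The image of a cofibrant object in the derived monoidal category. -/
abbrev tensorQObj (a : C) [IsCofibrant a] : TensorHo C := (tensorQ C).obj (CofibrantObject.mk a)

instance (a b : C) [IsCofibrant a] [IsCofibrant b] : IsCofibrant (a ⊗ b) := isCofibrant_tensor a b

/-- A map of the homotopy category between cofibrant objects, in the derived monoidal category. -/
def toTensorHo {a b : C} [IsCofibrant a] [IsCofibrant b] (φ : (hoQ C).obj a ⟶ (hoQ C).obj b) :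
    tensorQObj a ⟶ tensorQObj b := φ

/-- A map of the derived monoidal category between cofibrant objects, in the homotopy category. -/
def ofTensorHo {a b : C} [IsCofibrant a] [IsCofibrant b] (φ : tensorQObj a ⟶ tensorQObj b) :
    (hoQ C).obj a ⟶ (hoQ C).obj b := φ

section
variable {a b c : C} [IsCofibrant a] [IsCofibrant b] [IsCofibrant c]

lemma toTensorHo_bijective :
    Function.Bijective (toTensorHo : ((hoQ C).obj a ⟶ (hoQ C).obj b) → _) :=
  Function.bijective_id

lemma ofTensorHo_bijective :
    Function.Bijective (ofTensorHo : (tensorQObj a ⟶ tensorQObj b) → _) :=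
  Function.bijective_id

@[simp]
lemma toTensorHo_ofTensorHo (φ : tensorQObj a ⟶ tensorQObj b) : toTensorHo (ofTensorHo φ) = φ := rfl

lemma toTensorHo_comp (φ : (hoQ C).obj a ⟶ (hoQ C).obj b) (ψ : (hoQ C).obj b ⟶ (hoQ C).obj c) :
    toTensorHo (φ ≫ ψ) = toTensorHo φ ≫ toTensorHo ψ := rfl

/-- The tensorator. -/
abbrev tensorQμ (a b : C) [IsCofibrant a] [IsCofibrant b] :
    tensorQObj a ⊗ tensorQObj b ≅ tensorQObj (a ⊗ b) :=
  μIso (tensorQ C) (CofibrantObject.mk a) (CofibrantObject.mk b)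

lemma tensorQμ_naturality_left (f : a ⟶ b) (c : C) [IsCofibrant c] :
    toTensorHo ((hoQ C).map f) ▷ tensorQObj c ≫ (tensorQμ b c).hom =
      (tensorQμ a c).hom ≫ toTensorHo ((hoQ C).map (f ▷ c)) :=
  Functor.LaxMonoidal.μ_natural_left (tensorQ C)
    (ObjectProperty.homMk f : CofibrantObject.mk a ⟶ CofibrantObject.mk b) _

lemma tensorQμ_naturality_right (f : a ⟶ b) (c : C) [IsCofibrant c] :
    tensorQObj c ◁ toTensorHo ((hoQ C).map f) ≫ (tensorQμ c b).hom =
      (tensorQμ c a).hom ≫ toTensorHo ((hoQ C).map (c ◁ f)) :=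
  Functor.LaxMonoidal.μ_natural_right (tensorQ C) _
    (ObjectProperty.homMk f : CofibrantObject.mk a ⟶ CofibrantObject.mk b)

lemma tensorQμ_associativity (a b c : C) [IsCofibrant a] [IsCofibrant b] [IsCofibrant c] :
    (tensorQμ a b).hom ▷ tensorQObj c ≫ (tensorQμ (a ⊗ b) c).hom ≫
        toTensorHo ((hoQ C).map (α_ a b c).hom) =
      (α_ (tensorQObj a) (tensorQObj b) (tensorQObj c)).hom ≫
        tensorQObj a ◁ (tensorQμ b c).hom ≫ (tensorQμ a (b ⊗ c)).hom :=
  Functor.LaxMonoidal.associativity (tensorQ C) (CofibrantObject.mk a) (CofibrantObject.mk b)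
    (CofibrantObject.mk c)

/-- The derived tensor product of a map with an object on the right. -/
def hoWhiskerRight (φ : (hoQ C).obj a ⟶ (hoQ C).obj b) (c : C) [IsCofibrant c] :
    (hoQ C).obj (a ⊗ c) ⟶ (hoQ C).obj (b ⊗ c) :=
  ofTensorHo ((tensorQμ a c).inv ≫ toTensorHo φ ▷ tensorQObj c ≫ (tensorQμ b c).hom)

/-- The derived tensor product of a map with an object on the left. -/
def hoWhiskerLeft (c : C) [IsCofibrant c] (φ : (hoQ C).obj a ⟶ (hoQ C).obj b) :
    (hoQ C).obj (c ⊗ a) ⟶ (hoQ C).obj (c ⊗ b) :=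
  ofTensorHo ((tensorQμ c a).inv ≫ tensorQObj c ◁ toTensorHo φ ≫ (tensorQμ c b).hom)

@[simp]
lemma hoWhiskerRight_map (f : a ⟶ b) (c : C) [IsCofibrant c] :
    hoWhiskerRight ((hoQ C).map f) c = (hoQ C).map (f ▷ c) := by
  apply toTensorHo_bijective.1
  simp only [hoWhiskerRight, toTensorHo_ofTensorHo]
  rw [tensorQμ_naturality_left, Iso.inv_hom_id_assoc]

@[simp]
lemma hoWhiskerLeft_map (c : C) [IsCofibrant c] (f : a ⟶ b) :
    hoWhiskerLeft c ((hoQ C).map f) = (hoQ C).map (c ◁ f) := by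
  apply toTensorHo_bijective.1
  simp only [hoWhiskerLeft, toTensorHo_ofTensorHo]
  rw [tensorQμ_naturality_right, Iso.inv_hom_id_assoc]

lemma hoWhiskerRight_comp (φ : (hoQ C).obj a ⟶ (hoQ C).obj b) (ψ : (hoQ C).obj b ⟶ (hoQ C).obj c)
    (d : C) [IsCofibrant d] :
    hoWhiskerRight (φ ≫ ψ) d = hoWhiskerRight φ d ≫ hoWhiskerRight ψ d := by
  apply toTensorHo_bijective.1
  simp [hoWhiskerRight, toTensorHo_comp]

lemma hoWhiskerRight_comp_assoc (φ : (hoQ C).obj a ⟶ (hoQ C).obj b)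
    (ψ : (hoQ C).obj b ⟶ (hoQ C).obj c) (d : C) [IsCofibrant d] {Z : Ho C}
    (h : (hoQ C).obj (c ⊗ d) ⟶ Z) :
    hoWhiskerRight (φ ≫ ψ) d ≫ h = hoWhiskerRight φ d ≫ hoWhiskerRight ψ d ≫ h := by
  rw [hoWhiskerRight_comp, Category.assoc]

lemma hoWhiskerLeft_comp (d : C) [IsCofibrant d] (φ : (hoQ C).obj a ⟶ (hoQ C).obj b)
    (ψ : (hoQ C).obj b ⟶ (hoQ C).obj c) :
    hoWhiskerLeft d (φ ≫ ψ) = hoWhiskerLeft d φ ≫ hoWhiskerLeft d ψ := by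
  apply toTensorHo_bijective.1
  simp [hoWhiskerLeft, toTensorHo_comp]

lemma hoWhiskerRight_id (d : C) [IsCofibrant d] :
    hoWhiskerRight (𝟙 ((hoQ C).obj a)) d = 𝟙 _ := by
  rw [← CategoryTheory.Functor.map_id, hoWhiskerRight_map, id_whiskerRight,
    CategoryTheory.Functor.map_id]

lemma hoWhiskerLeft_id (d : C) [IsCofibrant d] :
    hoWhiskerLeft d (𝟙 ((hoQ C).obj a)) = 𝟙 _ := by
  rw [← CategoryTheory.Functor.map_id, hoWhiskerLeft_map, MonoidalCategory.whiskerLeft_id,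
    CategoryTheory.Functor.map_id]

instance (φ : (hoQ C).obj a ⟶ (hoQ C).obj b) [IsIso φ] (d : C) [IsCofibrant d] :
    IsIso (hoWhiskerRight φ d) :=
  ⟨hoWhiskerRight (inv φ) d, by rw [← hoWhiskerRight_comp, IsIso.hom_inv_id, hoWhiskerRight_id],
    by rw [← hoWhiskerRight_comp, IsIso.inv_hom_id, hoWhiskerRight_id]⟩

instance (φ : (hoQ C).obj a ⟶ (hoQ C).obj b) [IsIso φ] (d : C) [IsCofibrant d] :
    IsIso (hoWhiskerLeft d φ) :=
  ⟨hoWhiskerLeft d (inv φ), by rw [← hoWhiskerLeft_comp, IsIso.hom_inv_id, hoWhiskerLeft_id],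
    by rw [← hoWhiskerLeft_comp, IsIso.inv_hom_id, hoWhiskerLeft_id]⟩

end

lemma exists_tensorQObj_iso (E : TensorHo C) :
    ∃ (x : C) (_ : IsCofibrant x), Nonempty (tensorQObj x ≅ E) := by
  let := Localization.essSurj (tensorQ C) (weakEquivalences (CofibrantObject C))
  let X := (tensorQ C).objPreimage E
  have : IsCofibrant X.obj := X.2
  exact ⟨X.obj, this, ⟨(tensorQ C).objObjPreimageIso E⟩⟩

/-- The tensorators identify the action on p ⊗ y through y with its counterpart in the derived
monoidal category, where perfect pairings are available. -/
lemma tensorQμ_act (H p y : C) [IsCofibrant H] [IsCofibrant p] [IsCofibrant y] (r : y ⊗ H ⟶ y) :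
    (tensorQμ (p ⊗ y) H).hom ≫ toTensorHo ((hoQ C).map ((α_ p y H).hom ≫ p ◁ r)) ≫
        (tensorQμ p y).inv =
      (tensorQμ p y).inv ▷ tensorQObj H ≫ (α_ _ _ _).hom ≫
        tensorQObj p ◁ ((tensorQμ y H).hom ≫ toTensorHo ((hoQ C).map r)) := by
  have h := tensorQμ_associativity p y H
  rw [← cancel_epi ((tensorQμ p y).hom ▷ tensorQObj H), hom_inv_whiskerRight_assoc,
    CategoryTheory.Functor.map_comp, toTensorHo_comp, Category.assoc,
    reassoc_of% h, ← cancel_mono (tensorQμ p y).hom]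
  simp only [Category.assoc, Iso.inv_hom_id, Category.comp_id, MonoidalCategory.whiskerLeft_comp,
    tensorQμ_naturality_right]

variable (H : C) [HopfObj H] [IsCofibrant H]

/-- The Hopf algebra, in the derived monoidal category. -/
instance hopfObjTensorQ : HopfObj (tensorQObj H) :=
  let := hopfObjCofibrant H
  hopfObjObj (tensorQ C) (CofibrantObject.mk H)

open MonObj ComonObj HopfObj

lemma tensorQ_mul : μ[tensorQObj H] = (tensorQμ H H).hom ≫ toTensorHo ((hoQ C).map μ[H]) := rfl

/-- The antipode of the image of H in Ho C is the image of the antipode. It is invertible there, and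
saturation brings this back to C. -/
theorem weakEquivalence_antipode (hH : IsDualizable (toMonoidalHo H)) :
    WeakEquivalence 𝒮[H] := by
  obtain ⟨E, ⟨_⟩⟩ := exists_exactPairing_tensorQ H hH
  have h : IsIso (𝒮[tensorQObj H]) := isIso_antipode (tensorQObj H) E
  exact (isIso_hoQ_map_iff 𝒮[H]).1 h

/-- If `H` is dualizable, then tensor products with the free module on the dual of `H` are
cofree. -/
theorem exists_cofree (hH : IsDualizable (toMonoidalHo H)) :
    ∃ (x : C) (_ : IsCofibrant x) (c : (hoQ C).obj (x ⊗ H) ⟶ (hoQ C).obj H)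
      (i : (hoQ C).obj (𝟙_ C) ⟶ (hoQ C).obj x) (e : (hoQ C).obj x ⟶ (hoQ C).obj (𝟙_ C)),
      i ≫ e = 𝟙 _ ∧
      (∀ (a : C) [IsCofibrant a],
        Function.Bijective (fun φ : (hoQ C).obj a ⟶ (hoQ C).obj (x ⊗ H) =>
          hoWhiskerRight φ H ≫ (hoQ C).map ((α_ x H H).hom ≫ x ◁ μ[H]) ≫ c)) ∧
      ∀ (p a : C) [IsCofibrant p] [IsCofibrant a],
        Function.Bijective (fun φ : (hoQ C).obj a ⟶ (hoQ C).obj (p ⊗ (x ⊗ H)) =>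
          hoWhiskerRight φ H ≫ (hoQ C).map ((α_ p (x ⊗ H) H).hom ≫
            p ◁ ((α_ x H H).hom ≫ x ◁ μ[H])) ≫ hoWhiskerLeft p c) := by
  obtain ⟨E, ⟨_⟩⟩ := exists_exactPairing_tensorQ H hH
  obtain ⟨x, hx, ⟨w⟩⟩ := exists_tensorQObj_iso E
  obtain ⟨i, e, hie⟩ := exists_unit_retract (tensorQObj H) E
  have : IsCofibrant (𝟙_ C) := MonoidalModelCategory.isCofibrant_unit
  have hK := isPerfect_mul_dualPairing (H := tensorQObj H) (E := E)
  have h2 := tensorQμ_act H x H μ[H]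
  rw [← tensorQ_mul] at h2
  -- The object x represents the dual E, and c is ξ ⊗ h ↦ ξ(h₁) h₂. The two bijections are those of
  -- the perfect pairing on E ⊗ H, without and with p in front, conjugated by tensorators.
  refine ⟨x, hx, ofTensorHo ((tensorQμ x H).inv ≫ w.hom ▷ _ ≫
    dualPairing (dualCoact (tensorQObj H) E)), ofTensorHo (i ≫ w.inv), ofTensorHo (w.hom ≫ e),
    ?_, ?_, ?_⟩
  · have h : (i ≫ w.inv) ≫ w.hom ≫ e = 𝟙 _ := by
      rw [Category.assoc, Iso.inv_hom_id_assoc, hie]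
    exact h
  · intro a _
    let ζ : tensorQObj (x ⊗ H) ≅ E ⊗ tensorQObj H := (tensorQμ x H).symm ≪≫ whiskerRightIso w _
    rw [show (fun φ : (hoQ C).obj a ⟶ (hoQ C).obj (x ⊗ H) => hoWhiskerRight φ H ≫
          (hoQ C).map ((α_ x H H).hom ≫ x ◁ μ[H]) ≫ ofTensorHo ((tensorQμ x H).inv ≫
            w.hom ▷ _ ≫ dualPairing (dualCoact (tensorQObj H) E))) =
        ofTensorHo ∘ (fun ψ => (tensorQμ a H).inv ≫ ψ) ∘
          (fun f => f ▷ tensorQObj H ≫ (α_ _ _ _).hom ≫ E ◁ μ[tensorQObj H] ≫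
            dualPairing (dualCoact (tensorQObj H) E)) ∘ (fun ψ => ψ ≫ ζ.hom) ∘ toTensorHo from ?_]
    · exact ofTensorHo_bijective.comp ((asIso (tensorQμ a H).inv).homFromEquiv.symm.bijective.comp
        ((hK.bijective _).comp (ζ.homToEquiv.bijective.comp toTensorHo_bijective)))
    · funext φ
      apply toTensorHo_bijective.1
      simp only [toTensorHo_comp, hoWhiskerRight, toTensorHo_ofTensorHo, Function.comp_apply,
        Category.assoc, comp_whiskerRight, ζ]
      rw [reassoc_of% h2]
      simp [whisker_exchange_assoc]
  · intro p a _ _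
    let ζ : tensorQObj (p ⊗ (x ⊗ H)) ≅ tensorQObj p ⊗ (E ⊗ tensorQObj H) :=
      (tensorQμ p (x ⊗ H)).symm ≪≫
        whiskerLeftIso _ ((tensorQμ x H).symm ≪≫ whiskerRightIso w _)
    rw [show (fun φ : (hoQ C).obj a ⟶ (hoQ C).obj (p ⊗ (x ⊗ H)) => hoWhiskerRight φ H ≫
          (hoQ C).map ((α_ p (x ⊗ H) H).hom ≫ p ◁ ((α_ x H H).hom ≫ x ◁ μ[H])) ≫
            hoWhiskerLeft p (ofTensorHo ((tensorQμ x H).inv ≫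
              w.hom ▷ _ ≫ dualPairing (dualCoact (tensorQObj H) E)))) =
        ofTensorHo ∘ (fun ψ => ψ ≫ (tensorQμ p H).hom) ∘ (fun ψ => (tensorQμ a H).inv ≫ ψ) ∘
          (fun f => f ▷ tensorQObj H ≫ (α_ _ _ _).hom ≫ tensorQObj p ◁ ((α_ _ _ _).hom ≫
            E ◁ μ[tensorQObj H] ≫ dualPairing (dualCoact (tensorQObj H) E))) ∘
          (fun ψ => ψ ≫ ζ.hom) ∘ toTensorHo from ?_]
    · exact ofTensorHo_bijective.comp ((tensorQμ p H).homToEquiv.bijective.comp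
        ((asIso (tensorQμ a H).inv).homFromEquiv.symm.bijective.comp
        (((hK.whiskerLeft (tensorQObj p)).bijective _).comp
          (ζ.homToEquiv.bijective.comp toTensorHo_bijective))))
    · funext φ
      apply toTensorHo_bijective.1
      have h1 := tensorQμ_act H p (x ⊗ H) ((α_ x H H).hom ≫ x ◁ μ[H])
      simp only [toTensorHo_comp, hoWhiskerRight, hoWhiskerLeft, toTensorHo_ofTensorHo,
        Category.assoc, comp_whiskerRight, ζ, Function.comp_apply]
      rw [reassoc_of% h1, ← MonoidalCategory.whiskerLeft_comp_assoc]
      simp only [Category.assoc]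
      rw [reassoc_of% h2]
      simp [whisker_exchange_assoc]

end TensorHo

/-! ### Free modules, free bimodules and tensor products with right modules. -/

section Adjunctions

open MonObj

variable {C : Type u} [Category.{v} C] [MonoidalCategory C] [SymmetricCategory C] (H : C)
  [MonObj H]

/-- The adjunction between free left modules and the forgetful functor. -/
def adjFreeLeft : freeLeft H ⊣ forgetL H :=
    { unit :=
        { app X := (λ_ X).inv ≫ η[H] ▷ X
          naturality X Y f := by
            change f ≫ (λ_ Y).inv ≫ η[H] ▷ Y = ((λ_ X).inv ≫ η[H] ▷ X) ≫ H ◁ f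
            rw [Category.assoc, ← whisker_exchange, leftUnitor_inv_naturality_assoc] }
      counit :=
        { app N :=
            { hom := N.actLeft
              left_act_hom := by
                change ((α_ H H N.X).inv ≫ μ[H] ▷ N.X) ≫ N.actLeft = H ◁ N.actLeft ≫ N.actLeft
                rw [Category.assoc, N.left_assoc, Iso.inv_hom_id_assoc]
              right_act_hom := by
                change (ρ_ (H ⊗ N.X)).hom ≫ N.actLeft = N.actLeft ▷ 𝟙_ C ≫ N.actRight
                rw [actRight_eq, rightUnitor_naturality] }
          naturality N N' f := by
            ext
            exact f.left_act_hom.symm }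
      left_triangle_components X := by
        ext
        change H ◁ ((λ_ X).inv ≫ η[H] ▷ X) ≫ (α_ H H X).inv ≫ μ[H] ▷ X = 𝟙 _
        rw [MonoidalCategory.whiskerLeft_comp_assoc, associator_inv_naturality_middle_assoc,
          ← comp_whiskerRight, MonObj.mul_one]
        monoidal
      right_triangle_components N := by
        change ((λ_ N.X).inv ≫ η[H] ▷ N.X) ≫ N.actLeft = 𝟙 _
        have := N.one_actLeft
        dsimp at this
        rw [Category.assoc, this, Iso.inv_hom_id] }

/-- The adjunction between free right modules and the forgetful functor. -/
def adjFreeRight : freeRight H ⊣ forgetR H :=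
    { unit :=
        { app X := (ρ_ X).inv ≫ X ◁ η[H]
          naturality X Y f := by
            change f ≫ (ρ_ Y).inv ≫ Y ◁ η[H] = ((ρ_ X).inv ≫ X ◁ η[H]) ≫ f ▷ H
            rw [Category.assoc, whisker_exchange, rightUnitor_inv_naturality_assoc] }
      counit :=
        { app N :=
            { hom := N.actRight
              left_act_hom := by
                change (λ_ (N.X ⊗ H)).hom ≫ N.actRight = 𝟙_ C ◁ N.actRight ≫ N.actLeft
                rw [actLeft_eq, leftUnitor_naturality]
              right_act_hom := by
                change ((α_ N.X H H).hom ≫ N.X ◁ μ[H]) ≫ N.actRight = N.actRight ▷ H ≫ N.actRight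
                rw [Category.assoc, N.right_assoc, Iso.hom_inv_id_assoc] }
          naturality N N' f := by
            ext
            exact f.right_act_hom.symm }
      left_triangle_components X := by
        ext
        change ((ρ_ X).inv ≫ X ◁ η[H]) ▷ H ≫ (α_ X H H).hom ≫ X ◁ μ[H] = 𝟙 _
        rw [comp_whiskerRight_assoc, associator_naturality_middle_assoc,
          ← MonoidalCategory.whiskerLeft_comp, MonObj.one_mul]
        monoidal
      right_triangle_components N := by
        change ((ρ_ N.X).inv ≫ N.X ◁ η[H]) ≫ N.actRight = 𝟙 _
        have := N.actRight_one
        dsimp at this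
        rw [Category.assoc, this, Iso.inv_hom_id] }

/-- The free bimodule `H ⊗ Y` on a right module `Y`. -/
def freeBL : RMod H ⥤ BMod H where
  obj Y :=
    { X := H ⊗ Y.X
      actLeft := (α_ H H Y.X).inv ≫ μ[H] ▷ Y.X
      actRight := (α_ H Y.X H).hom ≫ H ◁ Y.actRight
      one_actLeft := free_left_one H Y.X
      left_assoc := free_left_assoc H Y.X
      actRight_one := by
        have := Y.actRight_one
        dsimp at this ⊢
        rw [associator_naturality_right_assoc, ← MonoidalCategory.whiskerLeft_comp, this]
        simp
      right_assoc := by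
        have := Y.right_assoc
        dsimp at this ⊢
        simp [← MonoidalCategory.whiskerLeft_comp, this]
      middle_assoc := by
        dsimp
        simp only [comp_whiskerRight, Category.assoc]
        rw [associator_naturality_left_assoc, ← whisker_exchange]
        simp }
  map {Y Y'} f :=
    { hom := H ◁ f.hom
      left_act_hom := by
        dsimp
        rw [Category.assoc, ← whisker_exchange, associator_inv_naturality_right_assoc]
      right_act_hom := by
        have := f.right_act_hom
        dsimp at this ⊢
        simp only [Category.assoc, ← MonoidalCategory.whiskerLeft_comp, this]
        simp }

/-- The adjunction between free bimodules on right modules and the forgetful functor. -/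
def adjFreeBL : freeBL H ⊣ forgetBR H :=
    { unit :=
        { app Y :=
            { hom := (λ_ Y.X).inv ≫ η[H] ▷ Y.X
              left_act_hom := by
                rw [actLeft_eq, actLeft_eq]
                exact (leftUnitor_naturality _).symm
              right_act_hom := by
                change Y.actRight ≫ (λ_ Y.X).inv ≫ η[H] ▷ Y.X =
                  ((λ_ Y.X).inv ≫ η[H] ▷ Y.X) ▷ H ≫ (α_ H Y.X H).hom ≫ H ◁ Y.actRight
                rw [comp_whiskerRight_assoc, associator_naturality_left_assoc,
                  ← whisker_exchange]
                simp }
          naturality Y Y' f := by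
            ext
            change f.hom ≫ (λ_ Y'.X).inv ≫ η[H] ▷ Y'.X =
              ((λ_ Y.X).inv ≫ η[H] ▷ Y.X) ≫ H ◁ f.hom
            rw [Category.assoc, ← whisker_exchange, leftUnitor_inv_naturality_assoc] }
      counit :=
        { app N :=
            { hom := N.actLeft
              left_act_hom := by
                change ((α_ H H N.X).inv ≫ μ[H] ▷ N.X) ≫ N.actLeft = H ◁ N.actLeft ≫ N.actLeft
                rw [Category.assoc, N.left_assoc, Iso.inv_hom_id_assoc]
              right_act_hom := by
                change ((α_ H N.X H).hom ≫ H ◁ N.actRight) ≫ N.actLeft =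
                  N.actLeft ▷ H ≫ N.actRight
                rw [Category.assoc, N.middle_assoc] }
          naturality N N' f := by
            ext
            exact f.left_act_hom.symm }
      left_triangle_components Y := by
        ext
        change H ◁ ((λ_ Y.X).inv ≫ η[H] ▷ Y.X) ≫ (α_ H H Y.X).inv ≫ μ[H] ▷ Y.X = 𝟙 _
        rw [MonoidalCategory.whiskerLeft_comp_assoc, associator_inv_naturality_middle_assoc,
          ← comp_whiskerRight, MonObj.mul_one]
        monoidal
      right_triangle_components N := by
        ext
        change ((λ_ N.X).inv ≫ η[H] ▷ N.X) ≫ N.actLeft = 𝟙 _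
        have := N.one_actLeft
        dsimp at this
        rw [Category.assoc, this, Iso.inv_hom_id] }

/-- The tensor product of an object and a right module. -/
def tensR (p : C) : RMod H ⥤ RMod H where
  obj N :=
    { X := p ⊗ N.X
      actLeft := (λ_ (p ⊗ N.X)).hom
      actRight := (α_ p N.X H).hom ≫ p ◁ N.actRight
      one_actLeft := by simp
      left_assoc := by simp
      actRight_one := by
        have := N.actRight_one
        dsimp at this ⊢
        rw [associator_naturality_right_assoc, ← MonoidalCategory.whiskerLeft_comp, this]
        simp
      right_assoc := by
        have := N.right_assoc
        dsimp at this ⊢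
        simp [← MonoidalCategory.whiskerLeft_comp, this]
      middle_assoc := by simp }
  map {N N'} f :=
    { hom := p ◁ f.hom
      left_act_hom := by simp
      right_act_hom := by
        have := f.right_act_hom
        dsimp at this ⊢
        simp only [Category.assoc, ← MonoidalCategory.whiskerLeft_comp, this]
        simp }

end Adjunctions

section TensTriv

variable {C : Type u} [Category.{v} C] [MonoidalCategory C] [SymmetricCategory C] (H : C)
  [BimonObj H]

open ComonObj

/-- Tensoring with an object is compatible with the trivial right action. -/
def tensTrivIso (p : C) : trivR H ⋙ tensR H p ≅ tensorLeft p ⋙ trivR H :=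
  NatIso.ofComponents (fun z => Bimod.isoOfIso (Iso.refl (p ⊗ z))
    (by
      rw [actLeft_eq, actLeft_eq]
      exact (leftUnitor_naturality _).symm)
    (by
      change ((α_ p z H).hom ≫ p ◁ (z ◁ ε[H] ≫ (ρ_ z).hom)) ≫ 𝟙 _ =
        𝟙 (p ⊗ z) ▷ H ≫ (p ⊗ z) ◁ ε[H] ≫ (ρ_ (p ⊗ z)).hom
      simp))
    (fun f => by
      ext
      exact (Category.comp_id (p ◁ f)).trans (Category.id_comp (p ◁ f)).symm)

end TensTriv

/-! ### Weak equivalences and cofibrancy in the module categories. -/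

section Homotopical

variable {C : Type u} [Category.{v} C] [MonoidalCategory C] [SymmetricCategory C]
  [ModelCategory C] (H : C) [BimonObj H] [ModelCategory (LMod H)] [ModelCategory (RMod H)]
  [ModelCategory (BMod H)] [CompatibleModuleModelStructures H]

open CompatibleModuleModelStructures

instance : PreservesWE (forgetR H) where
  map_we f hf := (weakEquivalence_R_iff H f).1 hf

instance : PreservesWE (forgetBL H) where
  map_we f hf := (weakEquivalence_L_iff H _).2 ((weakEquivalence_B_iff H f).1 hf)

instance : PreservesWE (forgetBR H) where
  map_we f hf := (weakEquivalence_R_iff H _).2 ((weakEquivalence_B_iff H f).1 hf)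

instance isCofibrant_L (N : LMod H) [h : IsCofibrant N] : IsCofibrant N.X :=
  (isLeftQuillen_forgetL (H := H)).preservesCofibrant.isCofibrant N h

instance isCofibrant_R (N : RMod H) [h : IsCofibrant N] : IsCofibrant N.X :=
  (isLeftQuillen_forgetR (H := H)).preservesCofibrant.isCofibrant N h

instance isCofibrant_B (N : BMod H) [h : IsCofibrant N] : IsCofibrant N.X :=
  isCofibrant_L H ((forgetBL H).obj N)
    (h := (isLeftQuillen_forgetBL (H := H)).preservesCofibrant.isCofibrant N h)

lemma isLeftQuillen_freeLeft : IsLeftQuillen (freeLeft H) :=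
  isLeftQuillen_of_adj (adjFreeLeft H) isRightQuillen_forgetL

lemma isLeftQuillen_freeBL : IsLeftQuillen (freeBL H) :=
  isLeftQuillen_of_adj (adjFreeBL H) isRightQuillen_forgetBR

end Homotopical

/-! ### Testing universality on free objects and through sections. -/

section DerivedAdjunction

variable {C : Type u₁} [Category.{v₁} C] {D : Type u₂} [Category.{v₂} D] [ModelCategory C]
  [ModelCategory D]

/-- If `F ⊣ G`, where `F` is left derivable and `G` preserves weak equivalences, then maps out of
`F a` in the homotopy category, where `a` is cofibrant, correspond to maps out of `a`. -/
lemma bijective_unit_comp_hoMap {F : C ⥤ D} {G : D ⥤ C} (adj : F ⊣ G) [LeftDerivable F]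
    [PreservesWE G] (a : C) [IsCofibrant a] (Y : Ho D) :
    Function.Bijective (fun φ : (hoQ D).obj (F.obj a) ⟶ Y => (hoQ C).map (adj.unit.app a) ≫
      (hoMapFac G).inv.app (F.obj a) ≫ (hoMap G).map φ) := by
  have h1 : (hoMap G).IsRightDerivedFunctor (hoMapFac G).inv (weakEquivalences D) :=
    Functor.isRightDerivedFunctor_of_inverts _ _ _
  have h2 : (hoMap G ⋙ leftDerived F).IsRightDerivedFunctor
      (Functor.whiskerRight (hoMapFac G).inv (leftDerived F) ≫ (Functor.associator _ _ _).hom)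
      (weakEquivalences D) :=
    Functor.isRightDerivedFunctor_of_inverts _ _
      ((Functor.associator _ _ _).symm ≪≫
        Functor.isoWhiskerRight (hoMapFac G) (leftDerived F))
  have h3 : (leftDerived F ⋙ hoMap G).IsLeftDerivedFunctor
      ((Functor.associator _ _ _).inv ≫ Functor.whiskerRight (leftDerivedCounit F) (hoMap G))
      (weakEquivalences C) := by
    refine isLeftDerivedFunctor_of_isIso _ _ (fun X hX => ?_)
    dsimp
    infer_instance
  let A := adj.derived (weakEquivalences C) (weakEquivalences D) (leftDerivedCounit F)
    (hoMapFac G).inv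
  have hA : A.unit.app ((hoQ C).obj a) ≫ (hoMap G).map ((leftDerivedCounit F).app a) =
      (hoQ C).map (adj.unit.app a) ≫ (hoMapFac G).inv.app (F.obj a) :=
    adj.derivedη_fac_app (weakEquivalences C) (leftDerivedCounit F) (hoMapFac G).inv a
  have e : (fun φ : (hoQ D).obj (F.obj a) ⟶ Y => (hoQ C).map (adj.unit.app a) ≫
      (hoMapFac G).inv.app (F.obj a) ≫ (hoMap G).map φ) =
      (A.homEquiv _ Y) ∘ (fun φ => (leftDerivedCounit F).app a ≫ φ) := by
    funext φ
    rw [Function.comp_apply, A.homEquiv_unit, Functor.map_comp, reassoc_of% hA]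
  rw [e]
  exact (A.homEquiv _ Y).bijective.comp
    (asIso ((leftDerivedCounit F).app a)).homFromEquiv.symm.bijective

/-- Universality of an arrow out of a functor that reflects weak equivalences can be tested on
free objects. -/
lemma isUniversal_of_forall_free {F : C ⥤ D} {G : D ⥤ C} {R : C ⥤ D} (adj : F ⊣ G)
    (adj' : G ⊣ R) [LeftDerivable F] [PreservesWE G] [RightDerivable R]
    (hG : ∀ {X Y : D} (f : X ⟶ Y), WeakEquivalence (G.map f) → WeakEquivalence f)
    {W : Ho D} {Z : Ho C} (t : (hoMap G).obj W ⟶ Z)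
    (h : ∀ (a : C) [IsCofibrant a], Function.Bijective
      (fun φ : (hoQ D).obj (F.obj a) ⟶ W => (hoMap G).map φ ≫ t)) :
    IsUniversal (hoMap G) t := by
  let A := derivedAdjunction adj'
  rw [isUniversal_iff_isIso_homEquiv A]
  have := reflectsIsomorphisms_hoMap G hG
  -- The functor induced by G reflects isomorphisms, so the transpose of t may be tested after G.
  -- There maps out of a cofibrant a are maps out of F a before G, and h applies.
  suffices IsIso ((hoMap G).map (A.homEquiv _ _ t)) from isIso_of_reflects_iso _ (hoMap G)
  refine isIso_of_yoneda_map_bijective _ (fun B => ?_)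
  obtain ⟨a, ha, ⟨i⟩⟩ := exists_cofibrant_iso B
  have h1 := bijective_unit_comp_hoMap adj a W
  have h2 := bijective_unit_comp_hoMap adj a ((rightDerived R).obj Z)
  have h3 : Function.Bijective (fun φ : (hoQ D).obj (F.obj a) ⟶ W => φ ≫ A.homEquiv _ _ t) := by
    have e : (fun φ : (hoQ D).obj (F.obj a) ⟶ W => φ ≫ A.homEquiv _ _ t) =
        (A.homEquiv _ _) ∘ (fun φ => (hoMap G).map φ ≫ t) := by
      funext φ
      rw [Function.comp_apply, A.homEquiv_naturality_left]
    rw [e]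
    exact (A.homEquiv _ _).bijective.comp (h a)
  have h4 : Function.Bijective (fun ψ : (hoQ C).obj a ⟶ (hoMap G).obj W =>
      ψ ≫ (hoMap G).map (A.homEquiv _ _ t)) := by
    refine (Function.Bijective.of_comp_iff _ h1).1 ?_
    have e := h2.comp h3
    simpa [Function.comp_def] using e
  have e : (fun ψ : B ⟶ (hoMap G).obj W => ψ ≫ (hoMap G).map (A.homEquiv _ _ t)) =
      (fun ψ => i.inv ≫ ψ) ∘ (fun ψ => ψ ≫ (hoMap G).map (A.homEquiv _ _ t)) ∘
        (fun ψ => i.hom ≫ ψ) := by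
    funext ψ
    simp
  rw [e]
  exact i.homFromEquiv.bijective.comp (h4.comp i.homFromEquiv.symm.bijective)

variable {A : Type u₁} [Category.{v₁} A] {B : Type u₂} [Category.{v₂} B] in
/-- Let `E` be a section of `U`, and let `t : U w ⟶ z` be universal. Then `s : E v ⟶ w` is
universal if and only if the induced map `v ⟶ z` is invertible. -/
lemma isUniversal_iff_of_section {E : A ⥤ B} {U : B ⥤ A} (κ : E ⋙ U ≅ 𝟭 A) {v z : A} {w : B}
    (t : U.obj w ⟶ z) (ht : IsUniversal U t) (s : E.obj v ⟶ w) (m : v ⟶ z)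
    (hm : κ.hom.app v ≫ m = U.map s ≫ t) : IsUniversal E s ↔ IsIso m := by
  -- Up to κ, postcomposition with m is f ↦ E.map f ≫ s followed by the bijection g ↦ U.map g ≫ t.
  have e (a : A) : (fun f : a ⟶ v => f ≫ m) =
      (fun g => κ.inv.app a ≫ g) ∘ (fun g => U.map g ≫ t) ∘ (fun f => E.map f ≫ s) := by
    funext f
    have n := κ.hom.naturality f
    dsimp at n ⊢
    rw [Functor.map_comp, Category.assoc, ← hm, reassoc_of% n, Iso.inv_hom_id_app_assoc]
  have h1 (a : A) : Function.Bijective (fun g : U.obj (E.obj a) ⟶ z => κ.inv.app a ≫ g) :=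
    (κ.app a).homFromEquiv.bijective
  constructor
  · intro hs
    refine isIso_of_yoneda_map_bijective _ (fun a => ?_)
    exact (congrArg Function.Bijective (e a)).mpr ((h1 a).comp ((ht _).comp (hs a)))
  · intro hs a
    have h3 : Function.Bijective (fun f : a ⟶ v => f ≫ m) := (asIso m).homToEquiv.bijective
    replace h3 := (congrArg Function.Bijective (e a)).mp h3
    exact (Function.Bijective.of_comp_iff' (ht _) _).1
      ((Function.Bijective.of_comp_iff' (h1 a) _).1 h3)

/-- A functor with a retraction has one on homotopy categories. -/
lemma exists_hoMap_comp_iso {F : C ⥤ D} {G : D ⥤ C} [PreservesWE F] [PreservesWE G]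
    (e : F ⋙ G ≅ 𝟭 C) : ∃ κ : hoMap F ⋙ hoMap G ≅ 𝟭 (Ho C), ∀ X : C,
      κ.hom.app ((hoQ C).obj X) = (hoMap G).map ((hoMapFac F).hom.app X) ≫
        (hoMapFac G).hom.app (F.obj X) ≫ (hoQ C).map (e.hom.app X) := by
  let i : hoQ C ⋙ hoMap F ⋙ hoMap G ≅ F ⋙ G ⋙ hoQ C :=
    (Functor.associator _ _ _).symm ≪≫ Functor.isoWhiskerRight (hoMapFac F) (hoMap G) ≪≫
      Functor.associator _ _ _ ≪≫ Functor.isoWhiskerLeft F (hoMapFac G)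
  let : Localization.Lifting (hoQ C) (weakEquivalences C) (F ⋙ G ⋙ hoQ C) (hoMap F ⋙ hoMap G) :=
    ⟨i⟩
  refine ⟨Localization.liftNatIso (hoQ C) (weakEquivalences C) (F ⋙ G ⋙ hoQ C) (hoQ C) _ _
    ((Functor.associator _ _ _).symm ≪≫ Functor.isoWhiskerRight e _ ≪≫ Functor.leftUnitor _),
    fun X => ?_⟩
  have h : (Localization.Lifting.iso (hoQ C) (weakEquivalences C) (F ⋙ G ⋙ hoQ C)
      (hoMap F ⋙ hoMap G)).hom.app X = (hoMap G).map ((hoMapFac F).hom.app X) ≫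
        (hoMapFac G).hom.app (F.obj X) := by
    change i.hom.app X = _
    simp [i]
  simp [Localization.liftNatIso, h]

end DerivedAdjunction

section Retract

variable {A : Type u₁} [Category.{v₁} A] {B : Type u₂} [Category.{v₂} B]

lemma isIso_app_of_retract {F G : A ⥤ B} (θ : F ⟶ G) {X Y : A} (i : X ⟶ Y) (r : Y ⟶ X)
    (h : i ≫ r = 𝟙 X) [IsIso (θ.app Y)] : IsIso (θ.app X) := by
  refine ⟨G.map i ≫ inv (θ.app Y) ≫ F.map r, ?_, ?_⟩
  · rw [← θ.naturality_assoc, IsIso.hom_inv_id_assoc, ← F.map_comp, h, F.map_id]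
  · rw [Category.assoc, Category.assoc, θ.naturality, IsIso.inv_hom_id_assoc, ← G.map_comp, h,
      G.map_id]

lemma isIso_app_of_iso {F G : A ⥤ B} (θ : F ⟶ G) {X Y : A} (i : X ≅ Y) [IsIso (θ.app Y)] :
    IsIso (θ.app X) :=
  isIso_app_of_retract θ i.hom i.inv i.hom_inv_id

end Retract

section FreeUnit

variable {C : Type u} [Category.{v} C] [MonoidalCategory C] (H : C) [MonObj H]

/-- The unit of a free module. -/
def freeUnit (a : C) : a ⟶ ((freeRight H).obj a).X := (adjFreeRight H).unit.app a

lemma map_freeUnit_act [ModelCategory C] (a : C) {Y : Ho C}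
    (f : (hoQ C).obj ((freeRight H).obj a).X ⟶ Y) :
    (hoQ C).map (freeUnit H a ▷ H) ≫ (hoQ C).map ((freeRight H).obj a).actRight ≫ f = f := by
  have h : freeUnit H a ▷ H ≫ ((freeRight H).obj a).actRight = 𝟙 ((freeRight H).obj a).X :=
    congrArg Bimod.Hom.hom ((adjFreeRight H).left_triangle_components a)
  refine ((Category.assoc _ _ _).symm.trans (congrArg (fun k => k ≫ f)
    (((hoQ C).map_comp _ _).symm.trans ((congrArg (hoQ C).map h).trans
      ((hoQ C).map_id _))))).trans ?_
  exact Category.id_comp _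

end FreeUnit

/-! ### Cofree right modules up to homotopy. -/

section Cofree

variable {C : Type u} [Category.{v} C] [MonoidalCategory C] [SymmetricCategory C]
  [ModelCategory C] {H : C} [HopfObj H]
  [ModelCategory (LMod H)] [ModelCategory (RMod H)]
  [ModelCategory (BMod H)] [CompatibleModuleModelStructures H]

open CompatibleModuleModelStructures MonObj

instance : (forgetR H).IsLeftAdjoint := (isLeftQuillen_forgetR (H := H)).isLeftAdjoint

instance : RightDerivable (forgetR H).rightAdjoint :=
  (isRightQuillen_of_adj (Adjunction.ofIsLeftAdjoint (forgetR H))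
    isLeftQuillen_forgetR).rightDerivable

instance : PreservesCofibrant (trivR H) := (isLeftQuillen_trivR (H := H)).preservesCofibrant

/-- The underlying object in the homotopy category of a module. -/
def underIso (m : RMod H) :
    (hoMap (forgetR H)).obj ((hoQ (RMod H)).obj m) ≅ (hoQ C).obj m.X :=
  (hoMapFac (forgetR H)).app m

lemma underIso_naturality {m n : RMod H} (f : m ⟶ n) :
    (hoMap (forgetR H)).map ((hoQ (RMod H)).map f) ≫ (underIso n).hom =
      (underIso m).hom ≫ (hoQ C).map f.hom :=
  hoMapFac_naturality (forgetR H) f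

lemma underIso_naturality_assoc {m n : RMod H} (f : m ⟶ n) {Z : Ho C}
    (h : (hoQ C).obj n.X ⟶ Z) :
    (hoMap (forgetR H)).map ((hoQ (RMod H)).map f) ≫ (underIso n).hom ≫ h =
      (underIso m).hom ≫ (hoQ C).map f.hom ≫ h :=
  hoMapFac_naturality_assoc (forgetR H) f h

/-- The underlying map in the homotopy category of a map in the homotopy category of modules. -/
def hoUnder {m n : RMod H} (ψ : (hoQ (RMod H)).obj m ⟶ (hoQ (RMod H)).obj n) :
    (hoQ C).obj m.X ⟶ (hoQ C).obj n.X :=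
  (underIso m).inv ≫ (hoMap (forgetR H)).map ψ ≫ (underIso n).hom

lemma hoUnder_map {m n : RMod H} (f : m ⟶ n) :
    hoUnder ((hoQ (RMod H)).map f) = (hoQ C).map f.hom := by
  rw [hoUnder, underIso_naturality, Iso.inv_hom_id_assoc]

lemma hoUnder_comp {m n k : RMod H} (φ : (hoQ (RMod H)).obj m ⟶ (hoQ (RMod H)).obj n)
    (ψ : (hoQ (RMod H)).obj n ⟶ (hoQ (RMod H)).obj k) :
    hoUnder (φ ≫ ψ) = hoUnder φ ≫ hoUnder ψ := by
  simp [hoUnder]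

lemma weakEquivalence_hom_R {m n : RMod H} (f : m ⟶ n) [WeakEquivalence f] :
    WeakEquivalence f.hom := (weakEquivalence_R_iff H f).1 inferInstance

lemma isCofibrant_of_cofibration_R {m n : RMod H} (f : m ⟶ n) [Cofibration f]
    [hm : IsCofibrant m.X] : IsCofibrant n.X :=
  have : IsCofibrant ((forgetR H).obj m) := hm
  have : Cofibration ((forgetR H).map f) := (isLeftQuillen_forgetR (H := H)).cofibration f
  show IsCofibrant ((forgetR H).obj n) from isCofibrant_of_cofibration ((forgetR H).map f)

/-- An arrow from a trivial module to a cofree module is universal if and only if the induced map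
is invertible. -/
lemma isUniversal_hoArrow_trivR_iff {z : C} {b : RMod H} {Z : Ho C}
    (c : (hoQ C).obj b.X ⟶ Z) (hc : IsUniversal (hoMap (forgetR H)) ((underIso b).hom ≫ c))
    (g : (trivR H).obj z ⟶ b) :
    IsUniversal (hoMap (trivR H)) (hoArrow (trivR H) g) ↔ IsIso ((hoQ C).map g.hom ≫ c) := by
  -- The trivial action is a section of the forgetful functor, so maps from a trivial module on z to
  -- a cofree module on Z are maps from z to Z.
  obtain ⟨κ, hκ⟩ := exists_hoMap_comp_iso (F := trivR H) (G := forgetR H)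
    (NatIso.ofComponents (fun X => Iso.refl X) (fun f =>
      (Category.comp_id f).trans (Category.id_comp f).symm))
  refine isUniversal_iff_of_section κ _ hc _ _ ?_
  have h : κ.hom.app ((hoQ C).obj z) = (hoMap (forgetR H)).map ((hoMapFac (trivR H)).hom.app z) ≫
      (underIso ((trivR H).obj z)).hom := by
    rw [hκ]
    exact congrArg _ ((congrArg _ ((hoQ C).map_id z)).trans (Category.comp_id _))
  rw [hoArrow, Functor.map_comp, Category.assoc, underIso_naturality_assoc]
  refine (congrArg (fun k => k ≫ (hoQ C).map g.hom ≫ c) h).trans ?_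
  exact Category.assoc _ _ _

variable [MonoidalClosed C] [MonoidalModelCategory C] [IsCofibrant H]

instance isCofibrant_freeRight_X (a : C) [IsCofibrant a] :
    IsCofibrant ((freeRight H).obj a).X := isCofibrant_tensor a H

instance isCofibrant_tensR_X (p : C) [IsCofibrant p] (N : RMod H) [IsCofibrant N.X] :
    IsCofibrant ((tensR H p).obj N).X := isCofibrant_tensor p N.X

/-- Maps in the homotopy category of modules are equivariant. -/
lemma hoUnder_act {m n : RMod H} [IsCofibrant m.X] [IsCofibrant n.X]
    (ψ : (hoQ (RMod H)).obj m ⟶ (hoQ (RMod H)).obj n) :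
    hoWhiskerRight (hoUnder ψ) H ≫ (hoQ C).map n.actRight =
      (hoQ C).map m.actRight ≫ hoUnder ψ := by
  have h0 {k l : RMod H} [IsCofibrant k.X] [IsCofibrant l.X] (f : k ⟶ l) :
      hoWhiskerRight ((hoQ C).map f.hom) H ≫ (hoQ C).map l.actRight =
        (hoQ C).map k.actRight ≫ (hoQ C).map f.hom := by
    rw [hoWhiskerRight_map, ← Functor.map_comp, ← Functor.map_comp]
    exact congrArg _ f.right_act_hom.symm
  -- Equivariance is evident for morphisms of modules, so ψ is replaced by a morphism f from a
  -- cofibrant to a fibrant module.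
  obtain ⟨m', _, p, _, _⟩ := CofibrantObject.HoCat.exists_resolution m
  obtain ⟨n', _, i, _, _⟩ := FibrantObject.HoCat.exists_resolution n
  have := isCofibrant_of_cofibration_R i
  have := weakEquivalence_hom_R p
  have := weakEquivalence_hom_R i
  obtain ⟨f, hf⟩ := map_surjective_of_isLocalization (hoQ (RMod H)) m' n'
    ((hoQ _).map p ≫ ψ ≫ (hoQ _).map i)
  replace hf := congrArg hoUnder hf
  rw [hoUnder_comp, hoUnder_comp, hoUnder_map, hoUnder_map, hoUnder_map] at hf
  rw [← cancel_epi (hoWhiskerRight ((hoQ C).map p.hom) H), reassoc_of% (h0 p),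
    ← hoWhiskerRight_comp_assoc, ← cancel_mono ((hoQ C).map i.hom)]
  simp only [Category.assoc]
  rw [← h0 i, ← hoWhiskerRight_comp_assoc, Category.assoc, ← hf, h0 f]

lemma bijective_freeUnit (a : C) [IsCofibrant a] (Y : Ho (RMod H)) :
    Function.Bijective (fun φ : (hoQ (RMod H)).obj ((freeRight H).obj a) ⟶ Y =>
      (hoQ C).map (freeUnit H a) ≫ (underIso ((freeRight H).obj a)).inv ≫
        (hoMap (forgetR H)).map φ) :=
  bijective_unit_comp_hoMap (adjFreeRight H) a Y

/-- A map out of a module is cofree if it is so in the derived monoidal category. -/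
lemma isUniversal_hoMap_forgetR (N : RMod H) [IsCofibrant N.X] {Z : Ho C}
    (d : (hoQ C).obj N.X ⟶ Z)
    (h : ∀ (a : C) [IsCofibrant a], Function.Bijective
      (fun φ : (hoQ C).obj a ⟶ (hoQ C).obj N.X =>
        hoWhiskerRight φ H ≫ (hoQ C).map N.actRight ≫ d)) :
    IsUniversal (hoMap (forgetR H)) ((underIso N).hom ≫ d) := by
  refine isUniversal_of_forall_free (adjFreeRight H) (Adjunction.ofIsLeftAdjoint (forgetR H))
    (fun f hf => (weakEquivalence_R_iff H f).2 hf) _ (fun a _ => ?_)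
  have e : (fun φ : (hoQ (RMod H)).obj ((freeRight H).obj a) ⟶ (hoQ (RMod H)).obj N =>
      (hoMap (forgetR H)).map φ ≫ (underIso N).hom ≫ d) =
      (fun f => (underIso ((freeRight H).obj a)).hom ≫ f) ∘
      (fun φ : (hoQ C).obj a ⟶ (hoQ C).obj N.X =>
        hoWhiskerRight φ H ≫ (hoQ C).map N.actRight ≫ d) ∘
      (fun φ => φ ≫ (underIso N).hom) ∘
      (fun φ => (hoQ C).map (freeUnit H a) ≫
        (underIso ((freeRight H).obj a)).inv ≫ (hoMap (forgetR H)).map φ) := by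
    funext φ
    -- By equivariance, a map out of the free module a ⊗ H is recovered from its restriction to a.
    have h2 : hoUnder φ = hoWhiskerRight ((hoQ C).map (freeUnit H a) ≫ hoUnder φ) H ≫
        (hoQ C).map N.actRight := by
      rw [hoWhiskerRight_comp, Category.assoc, hoUnder_act, hoWhiskerRight_map,
        map_freeUnit_act]
    have h3 : (hoMap (forgetR H)).map φ ≫ (underIso N).hom ≫ d =
      (underIso ((freeRight H).obj a)).hom ≫ hoUnder φ ≫ d := by
      simp [hoUnder]
    rw [h3, h2]
    simp only [hoUnder, Function.comp_apply, Category.assoc]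
    exact congrArg (fun k => (underIso ((freeRight H).obj a)).hom ≫ k) (Category.assoc _ _ _)
  rw [e]
  exact (underIso ((freeRight H).obj a)).homFromEquiv.symm.bijective.comp
    ((h a).comp (((underIso N).homToEquiv.bijective).comp (bijective_freeUnit a _)))

end Cofree

/-! ### Tensor products and fixed points of right modules. -/

section TensFix

variable {C : Type u} [Category.{v} C] [MonoidalCategory C] [SymmetricCategory C]
  [ModelCategory C] {H : C} [HopfObj H]
  [ModelCategory (LMod H)] [ModelCategory (RMod H)]
  [ModelCategory (BMod H)] [CompatibleModuleModelStructures H]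

open CompatibleModuleModelStructures MonObj

/-- Universality of arrows out of underlying objects can be transported along weak equivalences. -/
lemma isUniversal_underIso_comp_iff {m n : RMod H} (j : m ⟶ n) [WeakEquivalence j] {Z : Ho C}
    (c : (hoQ C).obj m.X ⟶ Z) (c' : (hoQ C).obj n.X ⟶ Z) (h : (hoQ C).map j.hom ≫ c' = c) :
    IsUniversal (hoMap (forgetR H)) ((underIso n).hom ≫ c') ↔
      IsUniversal (hoMap (forgetR H)) ((underIso m).hom ≫ c) := by
  rw [← h, ← underIso_naturality_assoc, isUniversal_iso_comp_iff]

variable [MonoidalClosed C] [MonoidalModelCategory C]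

lemma weakEquivalence_tensR_map (p : C) [IsCofibrant p] {m n : RMod H} [IsCofibrant m.X]
    [IsCofibrant n.X] (f : m ⟶ n) [WeakEquivalence f] : WeakEquivalence ((tensR H p).map f) :=
  have := weakEquivalence_hom_R f
  (weakEquivalence_R_iff H _).2 (weakEquivalence_whiskerLeft p f.hom)

instance (p : C) [IsCofibrant p] : LeftDerivable (tensR H p) where
  map_we {m n} f _ _ _ :=
    have := isCofibrant_R H m
    have := isCofibrant_R H n
    weakEquivalence_tensR_map p f

instance isIso_leftDerivedCounit_tensR (p : C) [IsCofibrant p] (N : RMod H) [IsCofibrant N.X] :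
    IsIso ((leftDerivedCounit (tensR H p)).app N) := by
  obtain ⟨N', _, q, _, _⟩ := CofibrantObject.HoCat.exists_resolution N
  exact isIso_leftDerivedCounit_of_weakEquivalence _ q (weakEquivalence_tensR_map p q)

variable (H) in
/-- The canonical map `p ⊗ N^{hH} ⟶ (p ⊗ N)^{hH}`. -/
def tensFix (p : C) [IsCofibrant p] : hfixR H ⋙ leftDerived (tensorLeft p) ⟶
    leftDerived (tensR H p) ⋙ hfixR H :=
  (mateEquiv (derivedAdjunction (adjFixR H)) (derivedAdjunction (adjFixR H))
    (TwoSquare.mk _ _ _ _ (leftDerivedCommIso (tensorLeft p) (tensR H p) (trivR H) (trivR H)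
      (tensTrivIso H p)).inv)).natTrans

lemma isIso_tensFix_app_iff (p : C) [IsCofibrant p] {z : C} [IsCofibrant z] {b : RMod H}
    [IsCofibrant b.X] (g : (trivR H).obj z ⟶ b)
    (hg : IsUniversal (hoMap (trivR H)) (hoArrow (trivR H) g)) :
    IsIso ((tensFix H p).app ((hoQ (RMod H)).obj b)) ↔
      IsUniversal (hoMap (trivR H)) (hoArrow (trivR H)
        ((tensTrivIso H p).inv.app z ≫ (tensR H p).map g)) :=
  isIso_mate_leftDerivedCommIso_iff (tensorLeft p) (tensR H p) (trivR H) (trivR H)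
    (tensTrivIso H p) (adjFixR H) (adjFixR H) g hg inferInstance inferInstance

/-- If N is cofree on q, an arrow triv z ⟶ N is universal when the induced map z ⟶ q is invertible.
Tensoring with p preserves the latter condition, and p ⊗ N is cofree on p ⊗ q. -/
lemma isIso_tensFix_app_of_cofree (p : C) [IsCofibrant p] (N : RMod H) [IsCofibrant N.X] {q : C}
    [IsCofibrant q] (c : (hoQ C).obj N.X ⟶ (hoQ C).obj q)
    (h₁ : IsUniversal (hoMap (forgetR H)) ((underIso N).hom ≫ c))
    (h₂ : IsUniversal (hoMap (forgetR H)) ((underIso ((tensR H p).obj N)).hom ≫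
      hoWhiskerLeft p c)) : IsIso ((tensFix H p).app ((hoQ (RMod H)).obj N)) := by
  -- Fixed points are computed at a fibrant replacement. Its underlying object stays cofibrant
  -- because the forgetful functor preserves cofibrations.
  obtain ⟨b, _, j, _, _⟩ := FibrantObject.HoCat.exists_resolution N
  have := isCofibrant_of_cofibration_R j
  have := weakEquivalence_hom_R j
  have := weakEquivalence_tensR_map p j
  have hc : (hoQ C).map j.hom ≫ inv ((hoQ C).map j.hom) ≫ c = c := IsIso.hom_inv_id_assoc _ _
  rw [← isUniversal_underIso_comp_iff j _ _ hc] at h₁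
  have hd : (hoQ C).map (p ◁ j.hom) ≫ hoWhiskerLeft p (inv ((hoQ C).map j.hom) ≫ c) =
      hoWhiskerLeft p c := by
    rw [← hoWhiskerLeft_map, ← hoWhiskerLeft_comp, hc]
  replace h₂ := (isUniversal_underIso_comp_iff (n := (tensR H p).obj b) ((tensR H p).map j)
    (hoWhiskerLeft p c) (hoWhiskerLeft p (inv ((hoQ C).map j.hom) ≫ c)) hd).2 h₂
  obtain ⟨z, hz, g, hg⟩ := exists_isUniversal_hoArrow (adjFixR H) b
  suffices IsIso ((tensFix H p).app ((hoQ (RMod H)).obj b)) from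
    isIso_app_of_iso _ (asIso ((hoQ (RMod H)).map j))
  rw [isIso_tensFix_app_iff p g hg, isUniversal_hoArrow_trivR_iff _ h₂]
  rw [isUniversal_hoArrow_trivR_iff _ h₁] at hg
  have : IsCofibrant ((trivR H).obj z).X := hz
  have e : (hoQ C).map ((tensTrivIso H p).inv.app z ≫ (tensR H p).map g).hom =
      hoWhiskerLeft p ((hoQ C).map g.hom) := by
    rw [hoWhiskerLeft_map]
    exact congrArg (hoQ C).map (Category.id_comp (p ◁ g.hom))
  have e' := hoWhiskerLeft_comp p ((hoQ C).map g.hom) (inv ((hoQ C).map j.hom) ≫ c)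
  have hi : IsIso (hoWhiskerLeft p ((hoQ C).map g.hom ≫ inv ((hoQ C).map j.hom) ≫ c)) :=
    have := hg
    inferInstanceAs (IsIso (hoWhiskerLeft p
      (asIso ((hoQ C).map g.hom ≫ inv ((hoQ C).map j.hom) ≫ c)).hom))
  exact cast (congrArg IsIso (e'.trans (congrArg (fun k => k ≫ _) e.symm))) hi

variable [IsCofibrant H]

variable (H) in
-- With x the dual of H, the module x ⊗ H is cofree and remains so after tensoring with p. The unit
-- is a retract of x, so the free module on the unit is a retract of x ⊗ H.
theorem isIso_tensFix_app_free (hH : IsDualizable (toMonoidalHo H)) (p : C) [IsCofibrant p] :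
    IsIso ((tensFix H p).app ((hoQ (RMod H)).obj ((freeRight H).obj (𝟙_ C)))) := by
  obtain ⟨x, hx, c, i, e, hie, h1, h2⟩ := exists_cofree H hH
  have : IsCofibrant (𝟙_ C) := MonoidalModelCategory.isCofibrant_unit
  have u : IsUniversal (hoMap (forgetR H)) ((underIso ((freeRight H).obj x)).hom ≫ c) :=
    isUniversal_hoMap_forgetR ((freeRight H).obj x) c (fun a _ => h1 a)
  have u' : IsUniversal (hoMap (forgetR H))
      ((underIso ((tensR H p).obj ((freeRight H).obj x))).hom ≫ hoWhiskerLeft p c) :=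
    isUniversal_hoMap_forgetR ((tensR H p).obj ((freeRight H).obj x)) (hoWhiskerLeft p c)
      (fun a _ => h2 p a)
  have h := isIso_tensFix_app_of_cofree p ((freeRight H).obj x) c u u'
  let k (a : C) [IsCofibrant a] : (leftDerived (freeRight H)).obj ((hoQ C).obj a) ≅
      (hoQ (RMod H)).obj ((freeRight H).obj a) := asIso ((leftDerivedCounit (freeRight H)).app a)
  refine isIso_app_of_retract (tensFix H p) ((k _).inv ≫ (leftDerived (freeRight H)).map i ≫
    (k x).hom) ((k x).inv ≫ (leftDerived (freeRight H)).map e ≫ (k _).hom) ?_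
  simp [← Functor.map_comp_assoc, hie]

/-- The canonical map `p ⊗ H^{hH} ⟶ (p ⊗ H)^{hH}` is an isomorphism. -/
theorem isUniversal_tensR_of_iso (hH : IsDualizable (toMonoidalHo H)) (p : C) [IsCofibrant p]
    {z : C} [IsCofibrant z] {b : RMod H} [IsCofibrant b.X] (g : (trivR H).obj z ⟶ b)
    (hg : IsUniversal (hoMap (trivR H)) (hoArrow (trivR H) g))
    (i : (hoQ (RMod H)).obj b ≅ (hoQ (RMod H)).obj ((freeRight H).obj (𝟙_ C))) :
    IsUniversal (hoMap (trivR H)) (hoArrow (trivR H)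
      ((tensTrivIso H p).inv.app z ≫ (tensR H p).map g)) := by
  have := isIso_tensFix_app_free H hH p
  rw [← isIso_tensFix_app_iff p g hg]
  exact isIso_app_of_iso _ i

end TensFix

/-! ### Comparison isomorphisms between modules. -/

section ModuleMaps

variable {C : Type u} [Category.{v} C] [MonoidalCategory C] [SymmetricCategory C] {H : C}
  [MonObj H]

/-- A morphism of right modules is a morphism that commutes with the right action. -/
def rModHom {N N' : RMod H} (f : N.X ⟶ N'.X) (h : N.actRight ≫ f = f ▷ H ≫ N'.actRight) :
    N ⟶ N' where
  hom := f
  left_act_hom := by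
    rw [actLeft_eq, actLeft_eq]
    exact (leftUnitor_naturality _).symm
  right_act_hom := h

/-- A morphism of left modules is a morphism that commutes with the left action. -/
def lModHom {N N' : LMod H} (f : N.X ⟶ N'.X) (h : N.actLeft ≫ f = H ◁ f ≫ N'.actLeft) :
    N ⟶ N' where
  hom := f
  left_act_hom := h
  right_act_hom := by
    rw [actRight_eq, actRight_eq]
    exact (rightUnitor_naturality _).symm

/-- An isomorphism of right modules is an isomorphism that commutes with the right action. -/
def rModIso {N N' : RMod H} (i : N.X ≅ N'.X)
    (h : N.actRight ≫ i.hom = i.hom ▷ H ≫ N'.actRight) : N ≅ N' :=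
  Bimod.isoOfIso i (rModHom i.hom h).left_act_hom h

/-- An isomorphism of left modules is an isomorphism that commutes with the left action. -/
def lModIso {N N' : LMod H} (i : N.X ≅ N'.X)
    (h : N.actLeft ≫ i.hom = H ◁ i.hom ≫ N'.actLeft) : N ≅ N' :=
  Bimod.isoOfIso i h (lModHom i.hom h).right_act_hom

end ModuleMaps

section TrivFree

variable {C : Type u} [Category.{v} C] [MonoidalCategory C] [SymmetricCategory C] (H : C)
  [BimonObj H]

open ComonObj

/-- Forgetting left actions is compatible with trivial right actions. -/
def trivForgetIso : forgetL H ⋙ trivR H ≅ trivBR H ⋙ forgetBR H :=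
  NatIso.ofComponents (fun Y => rModIso (Iso.refl Y.X) (by
      change (Y.X ◁ ε[H] ≫ (ρ_ Y.X).hom) ≫ 𝟙 Y.X = 𝟙 Y.X ▷ H ≫ Y.X ◁ ε[H] ≫ Y.actRight
      rw [actRight_eq]
      simp))
    (fun f => by
      ext
      exact (Category.comp_id f.hom).trans (Category.id_comp f.hom).symm)

/-- Free left modules are compatible with trivial right actions. -/
def trivFreeIso : trivR H ⋙ freeBL H ≅ freeLeft H ⋙ trivBR H :=
  NatIso.ofComponents (fun a => Bimod.isoOfIso (Iso.refl (H ⊗ a)) (refl_left _) (by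
      change ((α_ H a H).hom ≫ H ◁ (a ◁ ε[H] ≫ (ρ_ a).hom)) ≫ 𝟙 (H ⊗ a) =
        𝟙 (H ⊗ a) ▷ H ≫ (H ⊗ a) ◁ ε[H] ≫ (ρ_ (H ⊗ a)).hom
      simp))
    (fun f => by
      ext
      exact (Category.comp_id (H ◁ f)).trans (Category.id_comp (H ◁ f)).symm)

variable {H} in
/-- The underlying right module of `P ⊗ B`. -/
def diagForgetIso (P : LMod H) (B : BMod H) :
    (tensR H P.X).obj ((forgetBR H).obj B) ≅
      (forgetBR H).obj ((diagTensor P (Mon.mk H)).obj B) :=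
  rModIso (Iso.refl (P.X ⊗ B.X)) (refl_right _)

/-- The underlying right module of `H` is free. -/
def regularForgetIso : (forgetBR H).obj (regularB H) ≅ (freeRight H).obj (𝟙_ C) :=
  rModIso (λ_ H).symm (by
    change MonObj.mul ≫ (λ_ H).inv =
      (λ_ H).inv ▷ H ≫ (α_ (𝟙_ C) H H).hom ≫ 𝟙_ C ◁ MonObj.mul
    simp)

end TrivFree

/-! ### Right fixed points of bimodules on underlying right modules. -/

section FixUnderlying

variable {C : Type u} [Category.{v} C] [MonoidalCategory C] [SymmetricCategory C]
  [ModelCategory C] {H : C} [BimonObj H]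
  [ModelCategory (LMod H)] [ModelCategory (RMod H)]
  [ModelCategory (BMod H)] [CompatibleModuleModelStructures H]

open CompatibleModuleModelStructures MonObj

/-- Fixed points are computed on underlying objects. -/
lemma isUniversal_forgetBR_counit (b : BMod H) :
    IsUniversal (trivR H) ((trivForgetIso H).hom.app ((fixBR H).obj b) ≫
      (forgetBR H).map ((adjFixBR H).counit.app b)) := by
  intro a
  refine (Function.Bijective.of_comp_iff _ ((adjFreeLeft H).homEquiv a _).bijective).1 ?_
  have h1 (F : (freeLeft H).obj a ⟶ (fixBR H).obj b) :
      (adjFreeLeft H).homEquiv a _ F = ((λ_ a).inv ≫ η[H] ▷ a) ≫ F.hom :=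
    (adjFreeLeft H).homEquiv_unit _ _ F
  have h2 (G : (freeBL H).obj ((trivR H).obj a) ⟶ b) :
      ((adjFreeBL H).homEquiv _ b G).hom = ((λ_ a).inv ≫ η[H] ▷ a) ≫ G.hom :=
    congrArg Bimod.Hom.hom ((adjFreeBL H).homEquiv_unit _ _ G)
  have h3 (F : (freeLeft H).obj a ⟶ (fixBR H).obj b) :
      (((adjFixBR H).homEquiv _ b).symm F).hom = F.hom ≫ ((adjFixBR H).counit.app b).hom :=
    congrArg Bimod.Hom.hom ((adjFixBR H).homEquiv_counit _ _ F)
  -- Maps from a to the fixed points of b correspond to left module maps from H ⊗ a to them, then to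
  -- bimodule maps triv (H ⊗ a) ≅ H ⊗ triv a ⟶ b, and then to right module maps triv a ⟶ b.
  refine Eq.mp (congrArg Function.Bijective (Eq.symm (b := (adjFreeBL H).homEquiv _ b ∘
    (fun φ => (trivFreeIso H).hom.app a ≫ φ) ∘ ((adjFixBR H).homEquiv _ b).symm) ?_))
    ((Equiv.bijective _).comp
      (((trivFreeIso H).app a).homFromEquiv.symm.bijective.comp (Equiv.bijective _)))
  funext F
  apply Bimod.hom_ext
  refine Eq.trans ?_ (h2 _).symm
  change (adjFreeLeft H).homEquiv a _ F ≫ 𝟙 _ ≫ ((adjFixBR H).counit.app b).hom =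
    ((λ_ a).inv ≫ η[H] ▷ a) ≫ 𝟙 (H ⊗ a) ≫ (((adjFixBR H).homEquiv _ b).symm F).hom
  have h4 {w x y z : C} (u : w ⟶ x) (f : x ⟶ y) (k : y ⟶ z) :
      (u ≫ f) ≫ 𝟙 y ≫ k = u ≫ 𝟙 x ≫ f ≫ k := by simp
  rw [h1, h3]
  exact h4 _ _ _

lemma isFibrant_forgetBR (b : BMod H) [IsFibrant b] : IsFibrant ((forgetBR H).obj b) := by
  have h := isRightQuillen_forgetBR (H := H)
  have : (forgetBR H).IsRightAdjoint := h.isRightAdjoint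
  have : Fibration ((forgetBR H).map (terminal.from b)) := h.fibration _
  rw [isFibrant_iff_of_isTerminal ((forgetBR H).map (terminal.from b))
    (IsTerminal.isTerminalObj _ _ terminalIsTerminal)]
  infer_instance

/-- Universality of arrows out of trivial modules is detected on underlying right modules. -/
lemma isUniversal_hoArrow_forgetBR_iff {Y : LMod H} {b : BMod H} (g : (trivBR H).obj Y ⟶ b) :
    IsUniversal (hoMap (trivBR H)) (hoArrow (trivBR H) g) ↔
      IsUniversal (hoMap (trivR H))
        (hoArrow (trivR H) ((trivForgetIso H).hom.app Y ≫ (forgetBR H).map g)) := by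
  obtain ⟨b', _, j, _, _⟩ := FibrantObject.HoCat.exists_resolution b
  have := isFibrant_forgetBR b'
  have : WeakEquivalence ((forgetBR H).map j) := PreservesWE.map_we j inferInstance
  rw [← isUniversal_hoArrow_comp_iff (trivBR H) g j,
    ← isUniversal_hoArrow_comp_iff (trivR H) _ ((forgetBR H).map j), Category.assoc,
    ← Functor.map_comp]
  exact isUniversal_hoArrow_iff_map (adjFixBR H) (adjFixR H) (forgetL H) (forgetBR H)
    (trivForgetIso H).hom (g ≫ j) (fun f => (weakEquivalence_L_iff H f).symm)
    (isUniversal_forgetBR_counit b')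

end FixUnderlying

/-! ### The first map of the norm. -/

section TensorFix

variable {C : Type u} [Category.{v} C] [MonoidalCategory C] [SymmetricCategory C]
  [ModelCategory C] {H : C} [HopfObj H]
  [ModelCategory (LMod H)] [ModelCategory (RMod H)]
  [ModelCategory (BMod H)] [CompatibleModuleModelStructures H]

open CompatibleModuleModelStructures

lemma isCofibrant_of_cofibration_B {m n : BMod H} (f : m ⟶ n) [Cofibration f]
    [hm : IsCofibrant m.X] : IsCofibrant n.X :=
  have : Cofibration ((forgetBL H).map f) := (isLeftQuillen_forgetBL (H := H)).cofibration f
  have : IsCofibrant ((forgetL H).obj ((forgetBL H).obj m)) := hm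
  have : Cofibration ((forgetL H).map ((forgetBL H).map f)) :=
    (isLeftQuillen_forgetL (H := H)).cofibration _
  show IsCofibrant ((forgetL H).obj ((forgetBL H).obj n)) from
    isCofibrant_of_cofibration ((forgetL H).map ((forgetBL H).map f))

variable [MonoidalClosed C] [MonoidalModelCategory C]

lemma weakEquivalence_diagTensor_map (P : LMod H) [IsCofibrant P.X] {m n : BMod H}
    [IsCofibrant m.X] [IsCofibrant n.X] (f : m ⟶ n) [hf : WeakEquivalence f] :
    WeakEquivalence ((diagTensor P (Mon.mk H)).map f) :=
  have := (weakEquivalence_B_iff H f).1 hf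
  (weakEquivalence_B_iff H _).2 (weakEquivalence_whiskerLeft P.X f.hom)

instance isIso_leftDerivedCounit_diagTensor (P : LMod H) [IsCofibrant P.X] (B : BMod H)
    [IsCofibrant B.X] : IsIso ((leftDerivedCounit (diagTensor P (Mon.mk H))).app B) := by
  obtain ⟨B', _, q, _, _⟩ := CofibrantObject.HoCat.exists_resolution B
  have := isCofibrant_B H B'
  exact isIso_leftDerivedCounit_of_weakEquivalence _ q (weakEquivalence_diagTensor_map P q)

variable [IsCofibrant H]

instance : IsCofibrant (regularB H).X := inferInstanceAs (IsCofibrant H)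

/-- The underlying map of a universal arrow to `H` is universal after tensoring with an object. -/
lemma exists_isUniversal_regularB (hH : IsDualizable (toMonoidalHo H)) :
    ∃ (b : BMod H) (_ : IsFibrant b) (_ : IsCofibrant b.X) (j : regularB H ⟶ b)
      (_ : WeakEquivalence j) (z : LMod H) (_ : IsCofibrant z) (g : (trivBR H).obj z ⟶ b),
      IsUniversal (hoMap (trivBR H)) (hoArrow (trivBR H) g) ∧
      ∀ (p : C) [IsCofibrant p], IsUniversal (hoMap (trivR H)) (hoArrow (trivR H)
        ((tensTrivIso H p).inv.app z.X ≫ (tensR H p).map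
          ((trivForgetIso H).hom.app z ≫ (forgetBR H).map g))) := by
  obtain ⟨b, hb, j, _, hj⟩ := FibrantObject.HoCat.exists_resolution (regularB H)
  have hb' := isCofibrant_of_cofibration_B j
  obtain ⟨z, hz, g, hg⟩ := exists_isUniversal_hoArrow (adjFixBR H) b
  refine ⟨b, hb, hb', j, hj, z, hz, g, hg, fun p _ => ?_⟩
  have hz' : IsCofibrant z.X := isCofibrant_L H z
  have : IsCofibrant ((forgetBR H).obj b).X := hb'
  have : WeakEquivalence ((forgetBR H).map j) := PreservesWE.map_we j inferInstance
  exact isUniversal_tensR_of_iso (z := z.X) (b := (forgetBR H).obj b) hH p _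
    ((isUniversal_hoArrow_forgetBR_iff g).1 hg)
    ((asIso ((hoQ (RMod H)).map ((forgetBR H).map j))).symm ≪≫
      (hoQ (RMod H)).mapIso (regularForgetIso H))

/-- The canonical map `P ⊗ H^{hH} ⟶ (P ⊗ H)^{hH}` is an isomorphism. -/
theorem isIso_tensorFix_app (hH : IsDualizable (toMonoidalHo H)) (P : LMod H) [IsCofibrant P.X] :
    IsIso ((tensorFix P).app ((hoQ (BMod H)).obj (regularB H))) := by
  obtain ⟨b, _, _, j, _, z, _, g, hg, h⟩ := exists_isUniversal_regularB hH
  suffices IsIso ((tensorFix P).app ((hoQ (BMod H)).obj b)) from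
    isIso_app_of_iso _ (asIso ((hoQ (BMod H)).map j))
  refine (isIso_mate_leftDerivedCommIso_iff (diagTensor P (unitMon C))
    (diagTensor P (Mon.mk H)) (trivBR H) (trivBR H) (diagTrivIso P) (adjFixBR H) (adjFixBR H) g
    hg inferInstance inferInstance).2 ?_
  rw [isUniversal_hoArrow_forgetBR_iff]
  -- Once left actions are forgotten, the diagonal tensor product with P is the tensor product with
  -- the object underlying P.
  have e : (trivForgetIso H).hom.app ((diagTensor P (unitMon C)).obj z) ≫
      (forgetBR H).map ((diagTrivIso P).inv.app z ≫ (diagTensor P (Mon.mk H)).map g) =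
      ((tensTrivIso H P.X).inv.app z.X ≫ (tensR H P.X).map
          ((trivForgetIso H).hom.app z ≫ (forgetBR H).map g)) ≫ (diagForgetIso P b).hom := by
    ext
    change 𝟙 _ ≫ 𝟙 _ ≫ P.X ◁ g.hom = (𝟙 _ ≫ P.X ◁ (𝟙 _ ≫ g.hom)) ≫ 𝟙 _
    simp only [Category.id_comp, Category.comp_id]
  rw [e]
  exact (isUniversal_hoArrow_comp_iff (trivR H) _ _).2 (h P.X)

end TensorFix

/-! ### Shear maps that trivialize diagonal actions. -/

section FreeShear

open MonObj ComonObj HopfObj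

section
variable {T : Type u} [Category.{v} T] [MonoidalCategory T] [BraidedCategory T] (H : T) [HopfObj H]

/-- `g ⊗ h ↦ g₁ ⊗ f(g₂) h`. -/
def mulShear (f : H ⟶ H) : H ⊗ H ⟶ H ⊗ H := Δ[H] ▷ H ≫ (α_ H H H).hom ≫ H ◁ (f ▷ H ≫ μ[H])

/-- In elements, h ⊗ k ↦ h₁ ⊗ g(h₂) f(h₃) k. The convolution is in the reverse order because the
shear multiplies on the left. -/
lemma mulShear_comp (f g : H ⟶ H) :
    mulShear H f ≫ mulShear H g = mulShear H (Δ[H] ≫ g ▷ H ≫ H ◁ f ≫ μ[H]) := by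
  have e1 : (α_ H H H).hom ≫ H ◁ (f ▷ H ≫ μ[H]) ≫ g ▷ H ≫ μ[H] =
      (g ▷ H ≫ H ◁ f ≫ μ[H]) ▷ H ≫ μ[H] := by
    rw [whisker_exchange_assoc]
    simp [MonObj.mul_assoc]
  have e2 : (α_ H H H).inv ▷ H ≫ (α_ (H ⊗ H) H H).hom ≫ (α_ H H (H ⊗ H)).hom =
      (α_ H (H ⊗ H) H).hom ≫ H ◁ (α_ H H H).hom := by
    simp
  have c := ComonObj.comul_assoc_flip H
  simp only [mulShear, Category.assoc]
  rw [whisker_exchange_assoc, ← associator_naturality_left_assoc,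
    associator_naturality_right_assoc, ← comp_whiskerRight_assoc, c]
  simp only [comp_whiskerRight_assoc]
  rw [reassoc_of% e2, associator_naturality_middle_assoc, ← MonoidalCategory.whiskerLeft_comp,
    ← MonoidalCategory.whiskerLeft_comp, e1]
  simp only [MonoidalCategory.whiskerLeft_comp, comp_whiskerRight, Category.assoc]

lemma mulShear_one : mulShear H (ε[H] ≫ η[H]) = 𝟙 _ := by
  rw [mulShear, comp_whiskerRight, Category.assoc, MonObj.one_mul,
    MonoidalCategory.whiskerLeft_comp, ← associator_naturality_middle_assoc,
    ← comp_whiskerRight_assoc, ComonObj.comul_counit]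
  simp

instance isIso_mulShear : IsIso (mulShear H (𝟙 H)) := by
  refine ⟨mulShear H 𝒮[H], ?_, ?_⟩
  · rw [mulShear_comp, MonoidalCategory.whiskerLeft_id, Category.id_comp,
      HopfObj.antipode_left, mulShear_one]
  · rw [mulShear_comp, id_whiskerRight, Category.id_comp, HopfObj.antipode_right, mulShear_one]

lemma isIso_shear_antipode {X N : T} (act : X ⊗ H ⟶ X) (r : N ⟶ H ⊗ N)
    (h1 : X ◁ η[H] ≫ act = (ρ_ X).hom)
    (h2 : X ◁ μ[H] ≫ act = (α_ X H H).inv ≫ act ▷ H ≫ act)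
    (c1 : r ≫ ε[H] ▷ N = (λ_ N).inv) (c2 : r ≫ H ◁ r = r ≫ Δ[H] ▷ N ≫ (α_ H H N).hom) :
    IsIso (shear act r 𝒮[H]) := by
  refine ⟨shear act r (𝟙 H), ?_, ?_⟩
  · rw [shear_comp act r h2 c2, MonoidalCategory.whiskerLeft_id, Category.id_comp,
      HopfObj.antipode_left, shear_one act r h1 c1]
  · rw [shear_comp act r h2 c2, id_whiskerRight, Category.id_comp, HopfObj.antipode_right,
      shear_one act r h1 c1]

end

variable {C : Type u} [Category.{v} C] [MonoidalCategory C] [SymmetricCategory C] {H : C}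
  [HopfObj H]

/-- In elements, h(m ⊗ 1) = m S(h₁) ⊗ h₂. So the map from the free module on M that extends m ↦ m ⊗
1 is a shear by the antipode. -/
lemma diag_unit_right {M : C} (r : M ⊗ H ⟶ M) :
    H ◁ ((ρ_ M).inv ≫ M ◁ η[H]) ≫ Δ[H] ▷ (M ⊗ H) ≫ tensorμ H H M H ≫
        (((β_ H M).hom ≫ M ◁ 𝒮[H] ≫ r) ⊗ₘ μ[H]) =
      (β_ H M).hom ≫ shear r Δ[H] 𝒮[H] := by
  have k : tensorμ H H M H ≫ (β_ H M).hom ▷ (H ⊗ H) =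
      (α_ (H ⊗ H) M H).inv ≫ (β_ (H ⊗ H) M).hom ▷ H ≫ (α_ M H H).inv ▷ H ≫
        (α_ (M ⊗ H) H H).hom := by
    rw [BraidedCategory.braiding_tensor_left_hom]
    simp only [tensorμ]
    monoidal
  have h : (ρ_ (M ⊗ (H ⊗ H))).inv ≫ (M ⊗ (H ⊗ H)) ◁ η[H] ≫ (α_ M H H).inv ▷ H ≫
      (α_ (M ⊗ H) H H).hom ≫ (M ⊗ H) ◁ μ[H] = (α_ M H H).inv := by
    rw [whisker_exchange_assoc, associator_naturality_right_assoc,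
      ← MonoidalCategory.whiskerLeft_comp, MonObj.mul_one]
    simp
  have h' : (H ⊗ H) ◁ ((ρ_ M).inv ≫ M ◁ η[H]) ≫ (α_ (H ⊗ H) M H).inv ≫
      (β_ (H ⊗ H) M).hom ▷ H = (β_ (H ⊗ H) M).hom ≫ (ρ_ (M ⊗ (H ⊗ H))).inv ≫
        (M ⊗ (H ⊗ H)) ◁ η[H] := by
    rw [MonoidalCategory.whiskerLeft_comp_assoc, associator_inv_naturality_right_assoc,
      whisker_exchange, rightUnitor_inv_naturality_assoc]
    simp
  rw [MonoidalCategory.tensorHom_def, comp_whiskerRight_assoc, reassoc_of% k,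
    ← whisker_exchange, whisker_exchange_assoc, reassoc_of% h', reassoc_of% h,
    BraidedCategory.braiding_naturality_left_assoc, shear]

/-- In elements, h((1 ⊗ y) ⊗ k) = (h₁ ⊗ y) ⊗ h₂ k. So the map from the free bimodule on x ⊗ H is a
shear once x is moved out of the way. -/
lemma diag_unit_left (x : C) :
    H ◁ (((λ_ x).inv ≫ η[H] ▷ x) ▷ H) ≫ Δ[H] ▷ ((H ⊗ x) ⊗ H) ≫ tensorμ H H (H ⊗ x) H ≫
        (((α_ H H x).inv ≫ μ[H] ▷ x) ⊗ₘ μ[H]) =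
      (α_ H x H).inv ≫ (β_ H x).hom ▷ H ≫ (α_ x H H).hom ≫ x ◁ mulShear H (𝟙 H) ≫
        (α_ x H H).inv ≫ (β_ x H).hom ▷ H := by
  have k : tensorμ H H x H = (α_ (H ⊗ H) x H).inv ≫ (β_ (H ⊗ H) x).hom ▷ H ≫
      (α_ x (H ⊗ H) H).hom ≫ x ◁ (α_ H H H).hom ≫ (α_ x H (H ⊗ H)).inv ≫
        (β_ x H).hom ▷ (H ⊗ H) := by
    have k' : tensorμ H H x H ≫ (β_ H x).hom ▷ (H ⊗ H) = (α_ (H ⊗ H) x H).inv ≫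
        (β_ (H ⊗ H) x).hom ▷ H ≫ (α_ x (H ⊗ H) H).hom ≫ x ◁ (α_ H H H).hom ≫
          (α_ x H (H ⊗ H)).inv := by
      rw [BraidedCategory.braiding_tensor_left_hom]
      simp only [tensorμ]
      monoidal
    rw [← reassoc_of% k', ← comp_whiskerRight, SymmetricCategory.symmetry]
    simp
  have n := tensorμ_natural_right (Z₁ := H) (Z₂ := H) ((λ_ x).inv ≫ η[H] ▷ x) (𝟙 H)
  rw [tensorHom_id] at n
  have u : H ◁ ((λ_ x).inv ≫ η[H] ▷ x) ≫ (α_ H H x).inv ≫ μ[H] ▷ x = 𝟙 _ := by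
    rw [MonoidalCategory.whiskerLeft_comp_assoc, associator_inv_naturality_middle_assoc,
      ← comp_whiskerRight, MonObj.mul_one]
    monoidal
  rw [whisker_exchange_assoc, reassoc_of% n, tensorHom_comp_tensorHom, u]
  simp only [mulShear, MonoidalCategory.whiskerLeft_id, Category.id_comp, id_whiskerRight,
    id_tensorHom, MonoidalCategory.whiskerLeft_comp, Category.assoc]
  rw [← associator_naturality_middle_assoc, ← comp_whiskerRight_assoc,
    ← BraidedCategory.braiding_naturality_left, comp_whiskerRight_assoc,
    ← associator_inv_naturality_left_assoc, k]
  simp only [Category.assoc]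
  rw [← whisker_exchange, associator_inv_naturality_right_assoc]

end FreeShear

section LeftDerivedCounit

variable {C : Type u₁} [Category.{v₁} C] {D : Type u₂} [Category.{v₂} D] [ModelCategory C]
  [ModelCategory D]

lemma isIso_leftDerivedCounit_comp_iff (F : C ⥤ D) [LeftDerivable F] {N' N : C}
    [IsCofibrant N'] (q : N' ⟶ N) [WeakEquivalence q] {Y : D} (t : F.obj N ⟶ Y) :
    IsIso ((leftDerivedCounit F).app N ≫ (hoQ D).map t) ↔ WeakEquivalence (F.map q ≫ t) := by
  have n := (leftDerivedCounit F).naturality q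
  dsimp at n
  rw [← isIso_hoQ_map_iff, ← isIso_comp_left_iff ((leftDerived F).map ((hoQ C).map q)),
    reassoc_of% n, isIso_comp_left_iff, ← Functor.map_comp]

end LeftDerivedCounit

/-! ### Orbits of bimodules and of free modules. -/

section Orbits

variable {C : Type u} [Category.{v} C] [MonoidalCategory C] [SymmetricCategory C]
  (H : C) [BimonObj H]

open MonObj ComonObj

/-- N is the value at Z of the right adjoint of the forgetful functor. The universal property is
phrased for an object with an action, so that it also applies to H ⊗ K. -/
lemma exists_cofreeR [(forgetR H).IsLeftAdjoint] (Z : C) :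
    ∃ (N : RMod H) (c : N.X ⟶ Z), ∀ {X : C} (r : X ⊗ H ⟶ X) (_ : X ◁ η[H] ≫ r = (ρ_ X).hom)
      (_ : X ◁ μ[H] ≫ r = (α_ X H H).inv ≫ r ▷ H ≫ r),
      (∀ k : X ⟶ Z, ∃ f : X ⟶ N.X, f ≫ c = k ∧ r ≫ f = f ▷ H ≫ N.actRight) ∧
      ∀ f f' : X ⟶ N.X, r ≫ f = f ▷ H ≫ N.actRight → r ≫ f' = f' ▷ H ≫ N.actRight →
        f ≫ c = f' ≫ c → f = f' := by
  let A := Adjunction.ofIsLeftAdjoint (forgetR H)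
  refine ⟨(forgetR H).rightAdjoint.obj Z, A.counit.app Z, fun {X} r h1 h2 => ?_⟩
  let Y : RMod H :=
    { X := X
      actLeft := (λ_ X).hom
      actRight := r
      one_actLeft := by simp
      left_assoc := by simp
      actRight_one := h1
      right_assoc := h2
      middle_assoc := by simp }
  constructor
  · intro k
    exact ⟨(A.homEquiv Y Z k).hom, (A.homEquiv_counit Y Z _).symm.trans
      ((A.homEquiv Y Z).symm_apply_apply k), (A.homEquiv Y Z k).right_act_hom⟩
  · intro f f' hf hf' h
    have e (g : Y ⟶ (forgetR H).rightAdjoint.obj Z) :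
        (A.homEquiv Y Z).symm g = g.hom ≫ A.counit.app Z := A.homEquiv_counit Y Z g
    have h3 : (rModHom f hf : Y ⟶ (forgetR H).rightAdjoint.obj Z) = rModHom f' hf' :=
      (A.homEquiv Y Z).symm.injective ((e (rModHom f hf)).trans (h.trans (e (rModHom f' hf')).symm))
    exact congrArg Bimod.Hom.hom h3

variable [ModelCategory C]
  [ModelCategory (LMod H)] [ModelCategory (RMod H)]
  [ModelCategory (BMod H)] [CompatibleModuleModelStructures H]

open CompatibleModuleModelStructures

/-- The canonical map to the orbits of a bimodule. -/
def orbUnitB (K : BMod H) : K.X ⟶ ((orbBL H).obj K).X := ((adjOrbBL H).unit.app K).hom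

lemma orbUnit_invariant (Y : LMod H) :
    Y.actLeft ≫ orbUnit H Y = H ◁ orbUnit H Y ≫ ε[H] ▷ _ ≫ (λ_ _).hom :=
  ((adjOrbL H).unit.app Y).left_act_hom

lemma orbUnitB_invariant (K : BMod H) :
    K.actLeft ≫ orbUnitB H K = H ◁ orbUnitB H K ≫ ε[H] ▷ _ ≫ (λ_ _).hom := by
  rw [← actLeft_eq ((orbBL H).obj K)]
  exact ((adjOrbBL H).unit.app K).left_act_hom

lemma orbUnit_naturality {Y Y' : LMod H} (f : Y ⟶ Y') :
    orbUnit H Y ≫ (orbL H).map f = f.hom ≫ orbUnit H Y' :=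
  (congrArg Bimod.Hom.hom ((adjOrbL H).unit.naturality f)).symm

lemma orbUnitB_homEquiv {K : BMod H} {N : RMod H} (f : K ⟶ (trivBL H).obj N) :
    orbUnitB H K ≫ (((adjOrbBL H).homEquiv K N).symm f).hom = f.hom := by
  have h := ((adjOrbBL H).homEquiv K N).apply_symm_apply f
  rw [Adjunction.homEquiv_unit] at h
  exact congrArg Bimod.Hom.hom h

/-- Orbits of a bimodule are universal for maps of right modules only. A map to a mere object Z
becomes one to the cofree module on Z. -/
lemma orbBL_hom_ext [(forgetR H).IsLeftAdjoint] {K : BMod H} {Z : C}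
    (a b : ((orbBL H).obj K).X ⟶ Z) (h : orbUnitB H K ≫ a = orbUnitB H K ≫ b) : a = b := by
  obtain ⟨N, c, hN⟩ := exists_cofreeR H Z
  let O := (orbBL H).obj K
  have hr : K.actRight ≫ orbUnitB H K = orbUnitB H K ▷ H ≫ O.actRight :=
    ((adjOrbBL H).unit.app K).right_act_hom
  obtain ⟨h1, -⟩ := hN O.actRight O.actRight_one O.right_assoc
  obtain ⟨a', rfl, ha'⟩ := h1 a
  obtain ⟨b', rfl, hb'⟩ := h1 b
  have h2 : orbUnitB H K ≫ a' = orbUnitB H K ≫ b' := by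
    refine (hN K.actRight K.actRight_one K.right_assoc).2 _ _ ?_ ?_ (by simpa using h)
    · rw [comp_whiskerRight_assoc, ← ha', reassoc_of% hr]
    · rw [comp_whiskerRight_assoc, ← hb', reassoc_of% hr]
  have h3 : (rModHom a' ha' : O ⟶ N) = rModHom b' hb' := by
    apply ((adjOrbBL H).homEquiv _ _).injective
    rw [(adjOrbBL H).homEquiv_unit, (adjOrbBL H).homEquiv_unit]
    exact Bimod.hom_ext _ _ h2
  exact congrArg (fun k : O ⟶ N => k.hom ≫ c) h3

lemma orbBL_exists_hom [(forgetR H).IsLeftAdjoint] {K : BMod H} {Z : C} (k : K.X ⟶ Z)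
    (hk : K.actLeft ≫ k = H ◁ k ≫ ε[H] ▷ Z ≫ (λ_ Z).hom) :
    ∃ a : ((orbBL H).obj K).X ⟶ Z, orbUnitB H K ≫ a = k := by
  obtain ⟨N, c, hN⟩ := exists_cofreeR H Z
  obtain ⟨k', rfl, hk'⟩ := (hN K.actRight K.actRight_one K.right_assoc).1 k
  -- Both maps H ⊗ K ⟶ N respect the right action on K, so they agree because their projections to Z
  -- do.
  have h1 : (K.actLeft : H ⊗ K.X ⟶ K.X) ≫ k' = H ◁ k' ≫ ε[H] ▷ N.X ≫ (λ_ N.X).hom := by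
    let F := (freeBL H).obj ((forgetBR H).obj K)
    refine (hN (X := H ⊗ K.X) ((α_ H K.X H).hom ≫ H ◁ K.actRight) F.actRight_one
      F.right_assoc).2 _ _ ?_ ?_ ?_
    · have := K.middle_assoc
      dsimp at this
      rw [comp_whiskerRight_assoc, ← hk', reassoc_of% this, Category.assoc]
    · rw [Category.assoc, ← MonoidalCategory.whiskerLeft_comp_assoc, hk']
      rw [MonoidalCategory.whiskerLeft_comp_assoc, whisker_exchange_assoc (ε[H]),
        leftUnitor_naturality, ← associator_naturality_middle_assoc]
      simp
    · rw [Category.assoc, Category.assoc, Category.assoc]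
      refine hk.trans ?_
      rw [MonoidalCategory.whiskerLeft_comp_assoc, whisker_exchange_assoc, leftUnitor_naturality]
  let F : K ⟶ (trivBL H).obj N :=
    { hom := k'
      left_act_hom := by
        rw [← actLeft_eq N] at h1
        exact h1
      right_act_hom := hk' }
  refine ⟨(((adjOrbBL H).homEquiv K N).symm F).hom ≫ c, ?_⟩
  refine (Category.assoc _ _ _).symm.trans ?_
  exact congrArg (fun m => m ≫ c) (orbUnitB_homEquiv H F)

/-- The orbits of a bimodule are computed on underlying left modules. -/
lemma exists_orbIso (K : BMod H) :
    ∃ κ : (orbL H).obj ((forgetBL H).obj K) ≅ ((orbBL H).obj K).X,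
      orbUnit H ((forgetBL H).obj K) ≫ κ.hom = orbUnitB H K := by
  have := (isLeftQuillen_forgetR (H := H)).isLeftAdjoint
  obtain ⟨a, ha⟩ : ∃ a : (orbL H).obj ((forgetBL H).obj K) ⟶ ((orbBL H).obj K).X,
      orbUnit H ((forgetBL H).obj K) ≫ a = orbUnitB H K :=
    orbL_exists_hom H (Y := (forgetBL H).obj K) (orbUnitB H K) (orbUnitB_invariant H K)
  obtain ⟨b, hb⟩ := orbBL_exists_hom H (K := K) (orbUnit H ((forgetBL H).obj K))
    (orbUnit_invariant H ((forgetBL H).obj K))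
  refine ⟨⟨a, b, ?_, ?_⟩, ha⟩
  · apply orbL_hom_ext
    rw [reassoc_of% ha, Category.comp_id]
    exact hb
  · apply orbBL_hom_ext
    rw [reassoc_of% hb, Category.comp_id]
    exact ha

/-- The orbits of a free module. -/
lemma exists_orbFreeIso (X : C) : ∃ a : (orbL H).obj ((freeLeft H).obj X) ≅ X,
    orbUnit H ((freeLeft H).obj X) ≫ a.hom = ε[H] ▷ X ≫ (λ_ X).hom := by
  let u : H ⊗ X ⟶ (orbL H).obj ((freeLeft H).obj X) := orbUnit H ((freeLeft H).obj X)
  have hu : ((α_ H H X).inv ≫ μ[H] ▷ X) ≫ u = H ◁ u ≫ ε[H] ▷ _ ≫ (λ_ _).hom :=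
    orbUnit_invariant H ((freeLeft H).obj X)
  obtain ⟨a, ha⟩ : ∃ a : (orbL H).obj ((freeLeft H).obj X) ⟶ X, u ≫ a = ε[H] ▷ X ≫ (λ_ X).hom :=
    orbL_exists_hom H (Y := (freeLeft H).obj X) (ε[H] ▷ X ≫ (λ_ X).hom) (by
      change ((α_ H H X).inv ≫ μ[H] ▷ X) ≫ ε[H] ▷ X ≫ (λ_ X).hom =
        H ◁ (ε[H] ▷ X ≫ (λ_ X).hom) ≫ ε[H] ▷ X ≫ (λ_ X).hom
      have h : (α_ H H X).inv ≫ (ε[H] ⊗ₘ ε[H]) ▷ X ≫ (λ_ (𝟙_ C)).hom ▷ X ≫ (λ_ X).hom =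
          H ◁ (ε[H] ▷ X ≫ (λ_ X).hom) ≫ ε[H] ▷ X ≫ (λ_ X).hom := by
        rw [whisker_exchange_assoc, MonoidalCategory.tensorHom_def]
        simp
      rw [← h]
      simp only [Category.assoc, ← comp_whiskerRight_assoc, BimonObj.mul_counit]
      simp)
  refine ⟨⟨a, (λ_ X).inv ≫ η[H] ▷ X ≫ u, ?_, ?_⟩, ha⟩
  · apply orbL_hom_ext
    have h : H ◁ ((λ_ X).inv ≫ η[H] ▷ X) ≫ (α_ H H X).inv ≫ μ[H] ▷ X = 𝟙 _ := by
      rw [MonoidalCategory.whiskerLeft_comp_assoc, associator_inv_naturality_middle_assoc,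
        ← comp_whiskerRight, MonObj.mul_one]
      monoidal
    have h1 : u = H ◁ ((λ_ X).inv ≫ η[H] ▷ X ≫ u) ≫ ε[H] ▷ _ ≫ (λ_ _).hom := by
      have h2 := congrArg (fun k => H ◁ ((λ_ X).inv ≫ η[H] ▷ X) ≫ k) hu
      simp only [Category.assoc] at h2
      rw [reassoc_of% h] at h2
      simpa using h2
    change u ≫ a ≫ (λ_ X).inv ≫ η[H] ▷ X ≫ u = u ≫ 𝟙 _
    rw [reassoc_of% ha, Category.comp_id]
    conv_rhs => rw [h1]
    rw [whisker_exchange_assoc, leftUnitor_naturality]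
  · rw [Category.assoc, Category.assoc, ha, ← comp_whiskerRight_assoc, BimonObj.one_counit]
    simp

end Orbits

/-! ### The last map of the norm. -/

section OrbTensor

variable {C : Type u} [Category.{v} C] [MonoidalCategory C] [SymmetricCategory C] {H : C}
  [HopfObj H]

open MonObj ComonObj HopfObj

/-- The bimodule `M ⊗ H` is free as a left module. -/
lemma exists_diagFreeIso (M : RMod H) : ∃ i : (freeLeft H).obj M.X ≅
    (forgetBL H).obj ((diagTensor ((leftOfRight H).obj M) (Mon.mk H)).obj (regularB H)),
      i.hom.hom ≫ M.actRight = ε[H] ▷ M.X ≫ (λ_ M.X).hom := by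
  let B := (diagTensor ((leftOfRight H).obj M) (Mon.mk H)).obj (regularB H)
  let j : M.X ⟶ M.X ⊗ H := (ρ_ M.X).inv ≫ M.X ◁ η[H]
  let s : (freeLeft H).obj M.X ⟶ (forgetBL H).obj B :=
    (freeLeft H).map j ≫ (adjFreeLeft H).counit.app ((forgetBL H).obj B)
  have h1 : M.X ◁ η[H] ≫ M.actRight = (ρ_ M.X).hom := M.actRight_one
  have h2 : M.X ◁ μ[H] ≫ M.actRight = (α_ M.X H H).inv ≫ M.actRight ▷ H ≫ M.actRight :=
    M.right_assoc
  have hs : s.hom = (β_ H M.X).hom ≫ shear M.actRight Δ[H] 𝒮[H] := diag_unit_right M.actRight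
  have hi : IsIso (shear M.actRight Δ[H] 𝒮[H]) :=
    isIso_shear_antipode H _ _ h1 h2 (ComonObj.counit_comul H) (ComonObj.comul_assoc H)
  have hi' : IsIso s.hom := by
    rw [hs]
    exact IsIso.comp_isIso' (β_ H M.X).isIso_hom hi
  refine ⟨lModIso (asIso s.hom) s.left_act_hom, ?_⟩
  have h3 : B.actLeft ≫ M.actRight = H ◁ M.actRight ≫ ε[H] ▷ M.X ≫ (λ_ M.X).hom :=
    act_left M.actRight h2
  have h4 : j ≫ M.actRight = 𝟙 _ := by
    rw [Category.assoc, h1, Iso.inv_hom_id]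
  have h5 : H ◁ j ≫ H ◁ M.actRight ≫ ε[H] ▷ M.X ≫ (λ_ M.X).hom = ε[H] ▷ M.X ≫ (λ_ M.X).hom := by
    rw [← MonoidalCategory.whiskerLeft_comp_assoc, h4]
    simp
  exact (Category.assoc (H ◁ j) B.actLeft M.actRight).trans
    ((congrArg (fun k => H ◁ j ≫ k) h3).trans h5)

variable [ModelCategory C] [ModelCategory (LMod H)] [ModelCategory (RMod H)]
  [ModelCategory (BMod H)] [CompatibleModuleModelStructures H]
  [MonoidalClosed C] [MonoidalModelCategory C] [IsCofibrant H]

/-- The map `(M ⊗ H)_{hH} ⟶ M` is an isomorphism. -/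
theorem isIso_orbTensorHom (M : RMod H) [IsCofibrant M.X] : IsIso (orbTensorHom M) := by
  let P := (leftOfRight H).obj M
  let B := (diagTensor P (Mon.mk H)).obj (regularB H)
  suffices IsIso ((leftDerivedCounit (orbBL H)).app B ≫
      (hoQ (RMod H)).map (((adjOrbBL H).homEquiv _ M).symm (actHom H M))) from
    inferInstanceAs (IsIso ((horbBL H).map ((leftDerivedCounit (diagTensor P (Mon.mk H))).app
      (regularB H)) ≫ _))
  -- The left module underlying the resolution K is cofibrant and weakly equivalent to the free
  -- module on M, which is cofibrant too. Hence the orbits of K are weakly equivalent to those of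
  -- the free module, namely M.
  obtain ⟨K, _, q, _, _⟩ := CofibrantObject.HoCat.exists_resolution B
  obtain ⟨κ, hκ⟩ := exists_orbIso H K
  obtain ⟨a, ha⟩ := exists_orbFreeIso H M.X
  obtain ⟨i, hi⟩ := exists_diagFreeIso M
  rw [isIso_leftDerivedCounit_comp_iff (orbBL H) q, weakEquivalence_R_iff]
  let f : (forgetBL H).obj K ⟶ (freeLeft H).obj M.X := (forgetBL H).map q ≫ i.inv
  have hK : IsCofibrant ((forgetBL H).obj K) :=
    (CompatibleModuleModelStructures.isLeftQuillen_forgetBL (H :=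
      H)).preservesCofibrant.isCofibrant K inferInstance
  have hM : IsCofibrant ((freeLeft H).obj M.X) :=
    (isLeftQuillen_freeLeft H).preservesCofibrant.isCofibrant M.X inferInstance
  have hf : WeakEquivalence f := by
    have : WeakEquivalence ((forgetBL H).map q) := PreservesWE.map_we q inferInstance
    infer_instance
  have := LeftDerivable.map_we (F := orbL H) f hK hM hf
  have e : ((orbBL H).map q ≫ ((adjOrbBL H).homEquiv _ M).symm (actHom H M)).hom =
      κ.inv ≫ (orbL H).map f ≫ a.hom := by
    rw [Iso.eq_inv_comp]
    apply orbL_hom_ext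
    rw [← Category.assoc, hκ, ← Adjunction.homEquiv_naturality_left_symm, ← Category.assoc,
      orbUnit_naturality, Category.assoc, ha, ← hi]
    have h : i.inv.hom ≫ i.hom.hom = 𝟙 _ := congrArg Bimod.Hom.hom i.inv_hom_id
    refine (orbUnitB_homEquiv H (q ≫ actHom H M)).trans ?_
    have h' {w x y z : C} (q : w ⟶ x) (i : x ⟶ y) (j : y ⟶ x) (r : x ⟶ z) (h : i ≫ j = 𝟙 x) :
        q ≫ r = (q ≫ i) ≫ j ≫ r := by simp [reassoc_of% h]
    exact h' q.hom i.inv.hom i.hom.hom M.actRight h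
  rw [e]
  infer_instance

end OrbTensor

/-! ### The bimodule (H ⊗ x) ⊗ H, and the antipode twist of a free module. -/

section ModuleIsos

open MonObj ComonObj HopfObj

variable {C : Type u} [Category.{v} C] [MonoidalCategory C] [SymmetricCategory C] {H : C}

/-- The functoriality of `P ⊗ B` in `P`. -/
def diagTensorMap [BimonObj H] {P P' : LMod H} (f : P ⟶ P') (B : BMod H) :
    (diagTensor P (Mon.mk H)).obj B ⟶ (diagTensor P' (Mon.mk H)).obj B where
  hom := f.hom ▷ B.X
  left_act_hom := by
    have h := tensorμ_natural_right (Z₁ := H) (Z₂ := H) f.hom (𝟙 B.X)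
    have e := f.left_act_hom
    dsimp [diagTensor] at e ⊢
    rw [tensorHom_id, MonoidalCategory.whiskerLeft_id, tensorHom_id] at h
    rw [Category.assoc, Category.assoc, whisker_exchange_assoc, reassoc_of% h,
      MonoidalCategory.tensorHom_def', MonoidalCategory.tensorHom_def', Category.assoc,
      ← comp_whiskerRight, e, comp_whiskerRight, whisker_exchange_assoc]
  right_act_hom := by
    dsimp [diagTensor]
    rw [Category.assoc, whisker_exchange, associator_naturality_left_assoc]

/-- `H ⊗ H` is free over the first factor, with the diagonal left action. -/
def freeDiagIso [HopfObj H] (x : C) : (freeBL H).obj ((freeRight H).obj x) ≅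
    (diagTensor ((freeLeft H).obj x) (Mon.mk H)).obj (regularB H) :=
  let B := (diagTensor ((freeLeft H).obj x) (Mon.mk H)).obj (regularB H)
  let j : (freeRight H).obj x ⟶ (forgetBR H).obj B :=
    rModHom (((λ_ x).inv ≫ η[H] ▷ x) ▷ H) (by
      change ((α_ x H H).hom ≫ x ◁ μ[H]) ≫ ((λ_ x).inv ≫ η[H] ▷ x) ▷ H =
        (((λ_ x).inv ≫ η[H] ▷ x) ▷ H) ▷ H ≫ (α_ (H ⊗ x) H H).hom ≫ (H ⊗ x) ◁ μ[H]
      rw [Category.assoc, whisker_exchange, associator_naturality_left_assoc])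
  let s : (freeBL H).obj ((freeRight H).obj x) ⟶ B :=
    (freeBL H).map j ≫ (adjFreeBL H).counit.app B
  have hs : s.hom = (α_ H x H).inv ≫ (β_ H x).hom ▷ H ≫ (α_ x H H).hom ≫
    x ◁ mulShear H (𝟙 H) ≫ (α_ x H H).inv ≫ (β_ x H).hom ▷ H := diag_unit_left x
  have : IsIso s.hom := by
    rw [hs]
    exact inferInstanceAs (IsIso ((α_ H x H).inv ≫ (β_ H x).hom ▷ H ≫ (α_ x H H).hom ≫
      x ◁ mulShear H (𝟙 H) ≫ (α_ x H H).inv ≫ (β_ x H).hom ▷ H))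
  Bimod.isoOfIso (asIso s.hom) s.left_act_hom s.right_act_hom

/-- The twist of a free right module by the antipode is the target of a map from a free left
module. -/
lemma exists_freeLeft_hom [HopfObj H] (x : C) :
    ∃ f : (freeLeft H).obj x ⟶ (leftOfRight H).obj ((freeRight H).obj x),
      f.hom = (β_ H x).hom ≫ x ◁ 𝒮[H] := by
  let N := (leftOfRight H).obj ((freeRight H).obj x)
  refine ⟨(freeLeft H).map ((ρ_ x).inv ≫ x ◁ η[H]) ≫ (adjFreeLeft H).counit.app N, ?_⟩
  change H ◁ ((ρ_ x).inv ≫ x ◁ η[H]) ≫ (β_ H (x ⊗ H)).hom ≫ (x ⊗ H) ◁ 𝒮[H] ≫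
    (α_ x H H).hom ≫ x ◁ μ[H] = (β_ H x).hom ≫ x ◁ 𝒮[H]
  rw [BraidedCategory.braiding_naturality_right_assoc, ← whisker_exchange_assoc,
    comp_whiskerRight_assoc, associator_naturality_middle_assoc,
    ← MonoidalCategory.whiskerLeft_comp, MonObj.one_mul]
  simp

end ModuleIsos

/-! ### The middle map of the norm on free bimodules. -/

section OrbitsOfFree

variable {C : Type u} [Category.{v} C] [MonoidalCategory C] [SymmetricCategory C]
  [ModelCategory C] (H : C) [BimonObj H]
  [ModelCategory (LMod H)] [ModelCategory (RMod H)]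
  [ModelCategory (BMod H)] [CompatibleModuleModelStructures H]

open CompatibleModuleModelStructures MonObj ComonObj

/-- The projection from a free bimodule to its orbits. -/
def freeBLCounit (y : RMod H) : (freeBL H).obj y ⟶ (trivBL H).obj y where
  hom := ε[H] ▷ y.X ≫ (λ_ y.X).hom
  left_act_hom := by
    change ((α_ H H y.X).inv ≫ μ[H] ▷ y.X) ≫ ε[H] ▷ y.X ≫ (λ_ y.X).hom =
      H ◁ (ε[H] ▷ y.X ≫ (λ_ y.X).hom) ≫ ε[H] ▷ y.X ≫ y.actLeft
    have h : (α_ H H y.X).inv ≫ (ε[H] ⊗ₘ ε[H]) ▷ y.X ≫ (λ_ (𝟙_ C)).hom ▷ y.X ≫ (λ_ y.X).hom =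
        H ◁ (ε[H] ▷ y.X ≫ (λ_ y.X).hom) ≫ ε[H] ▷ y.X ≫ (λ_ y.X).hom := by
      rw [whisker_exchange_assoc, MonoidalCategory.tensorHom_def]
      simp
    rw [actLeft_eq, ← h]
    simp only [Category.assoc, ← comp_whiskerRight_assoc, BimonObj.mul_counit]
    simp
  right_act_hom := by
    change ((α_ H y.X H).hom ≫ H ◁ y.actRight) ≫ ε[H] ▷ y.X ≫ (λ_ y.X).hom =
      (ε[H] ▷ y.X ≫ (λ_ y.X).hom) ▷ H ≫ y.actRight
    rw [Category.assoc, whisker_exchange_assoc]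
    simp

/-- The orbits of a free bimodule. -/
lemma isIso_orbBL_freeBL (y : RMod H) :
    IsIso (((adjOrbBL H).homEquiv _ y).symm (freeBLCounit H y)) := by
  let c := ((adjOrbBL H).homEquiv _ y).symm (freeBLCounit H y)
  have hc : orbUnitB H ((freeBL H).obj y) ≫ c.hom = ε[H] ▷ y.X ≫ (λ_ y.X).hom :=
    orbUnitB_homEquiv H (freeBLCounit H y)
  obtain ⟨κ, hκ⟩ := exists_orbIso H ((freeBL H).obj y)
  obtain ⟨a, ha⟩ := exists_orbFreeIso H y.X
  let i : (freeLeft H).obj y.X ≅ (forgetBL H).obj ((freeBL H).obj y) :=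
    lModIso (Iso.refl (H ⊗ y.X)) (refl_left _)
  have e : c.hom = κ.inv ≫ (orbL H).map i.inv ≫ a.hom := by
    rw [Iso.eq_inv_comp]
    apply orbL_hom_ext
    rw [← Category.assoc, hκ, ← Category.assoc, orbUnit_naturality, Category.assoc, ha]
    exact hc.trans (Category.id_comp _).symm
  have : IsIso c.hom := by
    rw [e]
    infer_instance
  exact (rModIso (asIso c.hom) c.right_act_hom).isIso_hom

/-- The transformation from the orbits of the fixed points to the fixed points of the orbits is
invertible on free bimodules. -/
lemma isIso_kappa_app_freeBL {v : C} {y : RMod H} [IsCofibrant ((freeLeft H).obj v)]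
    [IsCofibrant ((freeBL H).obj y)] (t : (trivR H).obj v ⟶ y)
    (ht : IsUniversal (hoMap (trivR H)) (hoArrow (trivR H) t))
    (ht' : IsUniversal (hoMap (trivR H)) (hoArrow (trivR H)
      ((tensTrivIso H H).inv.app v ≫ (tensR H H).map t))) :
    IsIso ((kappa H).app ((hoQ (BMod H)).obj ((freeBL H).obj y))) := by
  -- By ht', tensoring with H preserves the universality of t. So g, which is H ⊗ t, presents the
  -- free left module on v as the fixed points of the free bimodule on y.
  let g : (trivBR H).obj ((freeLeft H).obj v) ⟶ (freeBL H).obj y :=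
    (trivFreeIso H).inv.app v ≫ (freeBL H).map t
  let i : (tensR H H).obj y ≅ (forgetBR H).obj ((freeBL H).obj y) :=
    rModIso (Iso.refl (H ⊗ y.X)) (refl_right _)
  have hg : IsUniversal (hoMap (trivBR H)) (hoArrow (trivBR H) g) := by
    rw [isUniversal_hoArrow_forgetBR_iff]
    have e : (trivForgetIso H).hom.app ((freeLeft H).obj v) ≫ (forgetBR H).map g =
        ((tensTrivIso H H).inv.app v ≫ (tensR H H).map t) ≫ i.hom := by
      ext
      change 𝟙 _ ≫ 𝟙 _ ≫ H ◁ t.hom = (𝟙 _ ≫ H ◁ t.hom) ≫ 𝟙 _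
      simp only [Category.id_comp, Category.comp_id]
    rw [e]
    exact (isUniversal_hoArrow_comp_iff (trivR H) _ _).2 ht'
  refine (isIso_mate_leftDerivedCommIso_iff (orbL H) (orbBL H) (trivBR H) (trivR H)
    (asIso (orbTrivHom H)) (adjFixBR H) (adjFixR H) g hg inferInstance inferInstance).2 ?_
  let c := ((adjOrbBL H).homEquiv _ y).symm (freeBLCounit H y)
  have hc : IsIso c := isIso_orbBL_freeBL H y
  obtain ⟨a, ha⟩ := exists_orbFreeIso H v
  -- Taking orbits undoes H ⊗ (-): g becomes t again, and t is universal by ht.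
  have e1 : (orbBL H).map g ≫ c =
      (orbTrivHom H).app ((freeLeft H).obj v) ≫ (trivR H).map a.hom ≫ t := by
    apply ((adjOrbBL H).homEquiv _ _).injective
    apply Bimod.hom_ext
    refine Eq.trans ?_ (orbTrivHom_homEquiv H _ _ _).symm
    rw [Adjunction.homEquiv_naturality_left, Equiv.apply_symm_apply]
    have e2 (k : v ⟶ y.X) : orbUnit H ((freeLeft H).obj v) ≫ a.hom ≫ k = H ◁ k ≫ ε[H] ▷ y.X ≫
        (λ_ y.X).hom := by
      rw [reassoc_of% ha, whisker_exchange_assoc, leftUnitor_naturality]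
      exact Category.assoc _ _ _
    refine Eq.trans ?_ (e2 t.hom).symm
    exact congrArg (fun k => k ≫ _) (Category.id_comp (H ◁ t.hom))
  have e3 : (asIso (orbTrivHom H)).inv.app ((freeLeft H).obj v) ≫ (orbBL H).map g =
      ((trivR H).map a.hom ≫ t) ≫ inv c := by
    rw [IsIso.eq_comp_inv, Category.assoc, e1, asIso_inv, NatIso.isIso_inv_app,
      IsIso.inv_hom_id_assoc]
  rw [e3]
  exact (isUniversal_hoArrow_comp_iff (trivR H) _ _).2
    ((isUniversal_map_hoArrow_iff (trivR H) t a.hom).2 ht)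

end OrbitsOfFree

/-! ### Assembling the norm map. -/

section Norm

variable {C : Type u} [Category.{v} C] [MonoidalCategory C] [SymmetricCategory C]
  [ModelCategory C] {H : C} [HopfObj H]
  [ModelCategory (LMod H)] [ModelCategory (RMod H)]
  [ModelCategory (BMod H)] [CompatibleModuleModelStructures H]

open CompatibleModuleModelStructures MonObj HopfObj

/-- The isomorphism lifts to a morphism from a cofibrant resolution to a fibrant one. The fibrant
one keeps a cofibrant underlying object, so that tensoring with H preserves the whole zigzag. -/
lemma exists_weakEquivalences_of_iso {P P' : LMod H} [hP' : IsCofibrant P'.X]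
    (i : (hoQ (LMod H)).obj P ≅ (hoQ (LMod H)).obj P') :
    ∃ (P₁ P₂ : LMod H) (_ : IsCofibrant P₁.X) (_ : IsCofibrant P₂.X) (f : P₁ ⟶ P) (g : P₁ ⟶ P₂)
      (h : P' ⟶ P₂), WeakEquivalence f ∧ WeakEquivalence g ∧ WeakEquivalence h := by
  obtain ⟨P₁, _, f, _, hf⟩ := CofibrantObject.HoCat.exists_resolution P
  obtain ⟨P₂, _, h, _, hh⟩ := FibrantObject.HoCat.exists_resolution P'
  have : IsCofibrant ((forgetL H).obj P') := hP'
  have : Cofibration ((forgetL H).map h) := (isLeftQuillen_forgetL (H := H)).cofibration h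
  have hP₂ : IsCofibrant ((forgetL H).obj P₂) := isCofibrant_of_cofibration ((forgetL H).map h)
  obtain ⟨g, hg⟩ := map_surjective_of_isLocalization (hoQ (LMod H)) P₁ P₂
    ((hoQ _).map f ≫ i.hom ≫ (hoQ _).map h)
  refine ⟨P₁, P₂, isCofibrant_L H P₁, hP₂, f, g, h, hf, ?_, hh⟩
  rw [← isIso_hoQ_map_iff, hg]
  infer_instance

variable [MonoidalClosed C] [MonoidalModelCategory C] [IsCofibrant H]

lemma weakEquivalence_diagTensorMap {P P' : LMod H} [IsCofibrant P.X] [IsCofibrant P'.X]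
    (f : P ⟶ P') [hf : WeakEquivalence f] :
    WeakEquivalence (diagTensorMap f (regularB H)) :=
  have := (weakEquivalence_L_iff H f).1 hf
  (weakEquivalence_B_iff H _).2 (weakEquivalence_whiskerRight H f.hom)

/-- The bimodule `P ⊗ H` depends only on `P` in the homotopy category. -/
lemma nonempty_iso_diagTensor {P P' : LMod H} [IsCofibrant P.X] [IsCofibrant P'.X]
    (i : (hoQ (LMod H)).obj P ≅ (hoQ (LMod H)).obj P') :
    Nonempty ((hoQ (BMod H)).obj ((diagTensor P (Mon.mk H)).obj (regularB H)) ≅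
      (hoQ (BMod H)).obj ((diagTensor P' (Mon.mk H)).obj (regularB H))) := by
  obtain ⟨P₁, P₂, _, _, f, g, h, _, _, _⟩ := exists_weakEquivalences_of_iso i
  have := weakEquivalence_diagTensorMap f
  have := weakEquivalence_diagTensorMap g
  have := weakEquivalence_diagTensorMap h
  exact ⟨(asIso ((hoQ (BMod H)).map (diagTensorMap f (regularB H)))).symm ≪≫
    asIso ((hoQ (BMod H)).map (diagTensorMap g (regularB H))) ≪≫
    (asIso ((hoQ (BMod H)).map (diagTensorMap h (regularB H)))).symm⟩

lemma weakEquivalence_freeBL_map {m n : RMod H} [IsCofibrant m.X] [IsCofibrant n.X] (f : m ⟶ n)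
    [WeakEquivalence f] : WeakEquivalence ((freeBL H).map f) :=
  have := weakEquivalence_hom_R f
  (weakEquivalence_B_iff H _).2 (weakEquivalence_whiskerLeft H f.hom)

/-- Let triv z ⟶ b be the universal arrow to a replacement b of H. Tensoring it with x gives the
universal arrow for x ⊗ H; the second hypothesis of `isIso_kappa_app_freeBL` holds because tensoring
with H ⊗ x preserves universality as well. -/
lemma isIso_kappa_app_freeBL_freeRight (hH : IsDualizable (toMonoidalHo H)) (x : C)
    [IsCofibrant x] :
    IsIso ((kappa H).app ((hoQ (BMod H)).obj ((freeBL H).obj ((freeRight H).obj x)))) := by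
  obtain ⟨b, _, hb, j, hj, z, hz, g, -, hg⟩ := exists_isUniversal_regularB hH
  have hz' : IsCofibrant z.X := isCofibrant_L H z
  let G : (trivR H).obj z.X ⟶ (forgetBR H).obj b :=
    (trivForgetIso H).hom.app z ≫ (forgetBR H).map g
  let N := (tensR H x).obj ((forgetBR H).obj b)
  have hb' : IsCofibrant ((forgetBR H).obj b).X := hb
  have hN : IsCofibrant N.X := isCofibrant_tensor x b.X
  let v := x ⊗ z.X
  have hv : IsCofibrant v := isCofibrant_tensor x z.X
  obtain ⟨y, hy, π, _, _⟩ := CofibrantObject.HoCat.exists_resolution N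
  have hy' := isCofibrant_R H y
  let G' : (trivR H).obj v ⟶ N := (tensTrivIso H x).inv.app z.X ≫ (tensR H x).map G
  have hv' : IsCofibrant ((trivR H).obj v) := PreservesCofibrant.isCofibrant v hv
  -- The trivial module on v is cofibrant, so the universal arrow to N lifts to the cofibrant
  -- replacement y that the criterion for κ requires.
  have sq : CommSq (initial.to y) (initial.to ((trivR H).obj v)) π G' := ⟨by simp⟩
  let t : (trivR H).obj v ⟶ y := sq.lift
  have ht : t ≫ π = G' := sq.fac_right
  have h1 : IsUniversal (hoMap (trivR H)) (hoArrow (trivR H) t) := by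
    rw [← isUniversal_hoArrow_comp_iff (trivR H) t π, ht]
    exact hg x
  have h2 : IsUniversal (hoMap (trivR H)) (hoArrow (trivR H)
      ((tensTrivIso H H).inv.app v ≫ (tensR H H).map t)) := by
    have := weakEquivalence_tensR_map H π
    have hHx : IsCofibrant (H ⊗ x) := isCofibrant_tensor H x
    let k : (tensR H (H ⊗ x)).obj ((forgetBR H).obj b) ≅ (tensR H H).obj N :=
      rModIso (α_ H x b.X) (by
        let r : b.X ⊗ H ⟶ b.X := ((forgetBR H).obj b).actRight
        change ((α_ (H ⊗ x) b.X H).hom ≫ (H ⊗ x) ◁ r) ≫ (α_ H x b.X).hom =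
          (α_ H x b.X).hom ▷ H ≫ (α_ H (x ⊗ b.X) H).hom ≫ H ◁ ((α_ x b.X H).hom ≫ x ◁ r)
        simp)
    rw [← isUniversal_hoArrow_comp_iff (trivR H) _ ((tensR H H).map π)]
    have e : (trivR H).map (α_ H x z.X).hom ≫
        ((tensTrivIso H H).inv.app v ≫ (tensR H H).map t) ≫ (tensR H H).map π =
        ((tensTrivIso H (H ⊗ x)).inv.app z.X ≫ (tensR H (H ⊗ x)).map G) ≫ k.hom := by
      rw [Category.assoc, ← Functor.map_comp, ht]
      ext
      change (α_ H x z.X).hom ≫ 𝟙 _ ≫ H ◁ (𝟙 _ ≫ x ◁ G.hom) =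
        (𝟙 _ ≫ (H ⊗ x) ◁ G.hom) ≫ (α_ H x b.X).hom
      let G₀ : z.X ⟶ b.X := G.hom
      have e' : (α_ H x z.X).hom ≫ 𝟙 _ ≫ H ◁ (𝟙 _ ≫ x ◁ G₀) =
        (𝟙 _ ≫ (H ⊗ x) ◁ G₀) ≫ (α_ H x b.X).hom := by simp
      exact e'
    refine (isUniversal_map_hoArrow_iff (trivR H) _ (α_ H x z.X).hom).1 ?_
    have h3 := (isUniversal_hoArrow_comp_iff (trivR H)
      ((tensTrivIso H (H ⊗ x)).inv.app z.X ≫ (tensR H (H ⊗ x)).map G) k.hom).2 (hg (H ⊗ x))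
    rw [← e] at h3
    exact h3
  have hy'' : IsCofibrant ((freeBL H).obj y) :=
    (isLeftQuillen_freeBL H).preservesCofibrant.isCofibrant y hy
  have hf : IsCofibrant ((freeLeft H).obj v) :=
    (isLeftQuillen_freeLeft H).preservesCofibrant.isCofibrant v hv
  have h3 := isIso_kappa_app_freeBL H t h1 h2
  let m : (freeRight H).obj x ≅ (tensR H x).obj ((forgetBR H).obj (regularB H)) :=
    rModIso (Iso.refl (x ⊗ H)) (refl_right _)
  have hm : WeakEquivalence ((forgetBR H).map j) := PreservesWE.map_we j hj
  have : IsCofibrant ((forgetBR H).obj (regularB H)).X := inferInstanceAs (IsCofibrant H)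
  have := weakEquivalence_tensR_map x ((forgetBR H).map j)
  let m' : (freeRight H).obj x ⟶ N := m.hom ≫ (tensR H x).map ((forgetBR H).map j)
  have := weakEquivalence_freeBL_map m'
  have := weakEquivalence_freeBL_map π
  exact isIso_app_of_iso (kappa H) (asIso ((hoQ (BMod H)).map ((freeBL H).map m')) ≪≫
    (asIso ((hoQ (BMod H)).map ((freeBL H).map π))).symm)

/-- The norm map of a module is an isomorphism if the module is free in the homotopy category of
left modules. -/
theorem isIso_normMap (hH : IsDualizable (toMonoidalHo H)) (M : RMod H) [IsCofibrant M.X] (x : C)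
    [IsCofibrant x] (i : (hoQ (LMod H)).obj ((leftOfRight H).obj M) ≅
      (hoQ (LMod H)).obj ((freeLeft H).obj x)) : IsIso (normMap M) := by
  have h1 := isIso_tensorFix_app hH ((leftOfRight H).obj M)
  have h2 := isIso_orbTensorHom M
  have hx : IsCofibrant ((freeLeft H).obj x).X := isCofibrant_tensor H x
  obtain ⟨j⟩ := nonempty_iso_diagTensor i
  have h3 := isIso_kappa_app_freeBL_freeRight hH x
  let k : (tensB M).obj ((hoQ (BMod H)).obj (regularB H)) ≅
      (hoQ (BMod H)).obj ((diagTensor ((leftOfRight H).obj M) (Mon.mk H)).obj (regularB H)) :=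
    asIso ((leftDerivedCounit (diagTensor ((leftOfRight H).obj M) (Mon.mk H))).app (regularB H))
  -- The bimodule M ⊗ H is identified with (H ⊗ x) ⊗ H and then with the free bimodule H ⊗ (x ⊗ H).
  have h4 := isIso_app_of_iso (kappa H) (k ≪≫ j ≪≫ (hoQ (BMod H)).mapIso (freeDiagIso x).symm)
  have h5 : IsIso ((horbL H).map ((tensorFix ((leftOfRight H).obj M)).app
      ((hoQ (BMod H)).obj (regularB H)))) := ((horbL H).mapIso (@asIso _ _ _ _ _ h1)).isIso_hom
  exact IsIso.comp_isIso' h5 (IsIso.comp_isIso' h4 (Functor.map_isIso _ _))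

instance : PreservesWE (leftOfRight H) where
  map_we f hf := (weakEquivalence_L_iff H _).2 ((weakEquivalence_R_iff H f).1 hf)

/-- A free right module is also a free left module. -/
lemma nonempty_iso_freeLeft (hH : IsDualizable (toMonoidalHo H)) (x : C) [IsCofibrant x] :
    Nonempty ((hoQ (LMod H)).obj ((leftOfRight H).obj ((freeRight H).obj x)) ≅
      (hoQ (LMod H)).obj ((freeLeft H).obj x)) := by
  obtain ⟨f, hf⟩ := exists_freeLeft_hom (H := H) x
  -- The map f is h ⊗ y ↦ y ⊗ S(h), so it is a weak equivalence because S is one.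
  have := weakEquivalence_antipode H hH
  have h := weakEquivalence_whiskerLeft x 𝒮[H]
  have : WeakEquivalence f := by
    rw [weakEquivalence_L_iff, hf]
    exact inferInstanceAs (WeakEquivalence ((β_ H x).hom ≫ x ◁ 𝒮[H]))
  exact ⟨(asIso ((hoQ (LMod H)).map f)).symm⟩

end Norm

end

end HopfNorm

theorem theorem2 {C : Type u} [Category.{v} C] [MonoidalCategory C] [SymmetricCategory C]
    [MonoidalClosed C] [ModelCategory C] [HasZeroObject C] [MonoidalModelCategory C]
    (H : C) [HopfObj H] [IsCofibrant H]
    [ModelCategory (LMod H)] [ModelCategory (RMod H)] [ModelCategory (BMod H)]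
    [CompatibleModuleModelStructures H]
    (hH : IsDualizable (toMonoidalHo H)) (X : Ho C) :
    (∀ (M : RMod H) [IsCofibrant M.X],
      Nonempty ((hoQ (LMod H)).obj ((leftOfRight H).obj M) ≅ (leftDerived (freeLeft H)).obj X) →
        IsIso (normMap M)) ∧
    (∀ (M : RMod H) [IsCofibrant M.X],
      Nonempty ((hoQ (RMod H)).obj M ≅ (leftDerived (freeRight H)).obj X) →
        IsIso (normMap M)) := by
  refine ⟨fun M _ ⟨i⟩ => ?_, fun M _ ⟨i⟩ => ?_⟩
  · obtain ⟨x, _, ⟨j⟩⟩ := exists_cofibrant_iso X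
    exact isIso_normMap hH M x (i ≪≫ (leftDerived (freeLeft H)).mapIso j.symm ≪≫
      asIso ((leftDerivedCounit (freeLeft H)).app x))
  · obtain ⟨x, _, ⟨j⟩⟩ := exists_cofibrant_iso X
    -- The antipode twist preserves weak equivalences and takes x ⊗ H to a module isomorphic to H ⊗
    -- x in the homotopy category, which reduces this case to the first one.
    obtain ⟨k⟩ := nonempty_iso_freeLeft hH x
    exact isIso_normMap hH M x (((hoMapFac (leftOfRight H)).app M).symm ≪≫
      (hoMap (leftOfRight H)).mapIso (i ≪≫ (leftDerived (freeRight H)).mapIso j.symm ≪≫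
        asIso ((leftDerivedCounit (freeRight H)).app x)) ≪≫
      (hoMapFac (leftOfRight H)).app ((freeRight H).obj x) ≪≫ k)
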